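/- Let $M=(0,1)^3$ and, for $u\in\mathbb{R}$, let $h(u)=\lfloor u+\tfrac12\rfloor$ if $u\notin\tfrac12+\mathbb{Z}$ and $h(u)=0$ otherwise. For $\epsilon\in[0,\tfrac12)$ let $G_{3,\epsilon}(x)=\{2(1-\epsilon)x+2\epsilon B_3(x)\}$ ($\{\cdot\}$ denotes coordinatewise fractional part), where $$(B_3(x))_1=\tfrac{2h(x_1)-h(x_2)+h(x_1+x_2)-h(x_2+x_3)+h(x_1+x_2+x_3)}4,$$ $$(B_3(x))_2=\tfrac{2h(x_2)-h(x_1)-h(x_3)+h(x_1+x_2)+h(x_2+x_3)}4,$$ $$(B_3(x))_3=\tfrac{2h(x_3)-h(x_2)-h(x_1+x_2)+h(x_2+x_3)+h(x_1+x_2+x_3)}4.$$ The atom $A_\omega$ is the open set of the $x\in M$ such that $x_1,x_2,x_3,x_1+x_2,x_2+x_3,x_1+x_2+x_3\notin\frac12+\mathbb{Z}$ and the values of $h$ at these six sums, in this order, form the word $\omega$; the atoms partition $M$ up to a null set. Let $\sigma_{4231}(x)=\{(-x_2-x_3,x_2,-x_1-x_2)\}$, $\sigma_{1324}(x)=\{(x_1+x_2,-x_2,x_2+x_3)\}$,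 $\sigma_{4321}=\sigma_{4231}\circ\sigma_{1324}$ and $\Sigma(x)=1-x$. The canonical coefficient matrix $\alpha\in\mathbb{R}^{6\times3}$ has as rows the linear forms $x_1,x_2,x_3,x_1+x_2,x_2+x_3,x_1+x_2+x_3$, and for $m=(\underline m_i\ \overline m_i)_{i=1}^6\in\mathbb{R}^{6\times2}$ let $P^\alpha_m=\{x\in\mathbb{R}^3:\underline m_i<(\alpha x)_i<\overline m_i,\ 1\le i\le 6\}$. A polytope means a non-empty bounded open convex polytope. Conditioning Problem 3: find polytopes $P_1,P_2\subset M$ such that * $P_1\cap A_\omega\ne\emptyset$ iff $\omega\in\{000101,100101\}$; * $\sigma_{4321}(P_2)=P_2$, and $P_2\cap A_\omega\neq\emptyset$ iff $\omega\in\{110111,110112,110212,100101,100111,100112\}$; * $G_{3,\epsilon}(P_1\cap A_{000101})\subset P_2$ and $G_{3,\epsilon}(P_1\cap A_{100101})\subset P_1$; * $G_{3,\epsilon}(P_2\cap A_{110111})=P_1$, $G_{3,\epsilon}(P_2\cap A_{110112})\subset\sigma_{4231}(P_1)$ and $G_{3,\epsilon}(P_2\cap A_{110212})\subset P_2$. A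 set $U$ is an IUP of $G_{3,\epsilon}$ if it is a non-empty finite union of polytopes contained in $M$ and $G_{3,\epsilon}(U\cap A_\omega)\subset U$ for every atom $A_\omega$; it is an AsIUP if moreover $\Sigma(U)\cap U=\emptyset$. Let $\mathrm{Orb}(P_1,P_2)$ be the union of the sets $\sigma(P_k)$, $k=1,2$, over the group $\langle\sigma_{4231},\sigma_{1324}\rangle=\{\mathrm{Id},\sigma_{4231},\sigma_{1324},\sigma_{4321}\}$. Let $p^\ast=\frac{2-\epsilon}{2(3-2\epsilon)}$. For $\delta=(\delta_1,\dots,\delta_5)\in\mathbb{R}^5$ let $m_1(\delta)$ be the constraint matrix with rows $(\underline m_i\ \overline m_i)$ $$(1-2p^\ast+2(1-\epsilon)\delta_1,\ 1-\epsilon),\quad (\tfrac\epsilon2,\ p^\ast-2(1-\epsilon)\delta_2),\quad (0,\ p^\ast-\tfrac\epsilon2-2(1-\epsilon)\delta_3),$$ $$(1-p^\ast+2(1-\epsilon)\delta_3,\ 1-\tfrac\epsilon2),\quad (\tfrac\epsilon2,\ p^\ast-2(1-\epsilon)\delta_3),\quad (1-p^\ast+2(1-\epsilon)\delta_4,\ 1-\tfrac\epsilon2)$$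 and $m_2(\delta)$ the one with rows $$(2p^\ast+\delta_1,\ 1),\quad (p^\ast+\delta_2,\ 1-p^\ast-\delta_2),\quad (0,\ 1-2p^\ast-\delta_1),$$ $$(1+p^\ast+\delta_3,\ 2-p^\ast-\delta_5),\quad (p^\ast+\delta_5,\ 1-p^\ast-\delta_3),\quad (1+p^\ast+\delta_4,\ 2-p^\ast-\delta_4).$$ Let $\Delta_\epsilon$ be the set of all $\delta\in\mathbb{R}^5$ that satisfy $$0\le 2(1-\epsilon)\delta_1\le 2p^\ast-(1-\epsilon),\qquad \delta_1\le\epsilon(1-2p^\ast)+2(1-\epsilon)\min\{\delta_2,\delta_4\},$$ $$0\le 2(1-\epsilon)\max\{\delta_2,\delta_4\}\le p^\ast-(1-\epsilon)^2,\qquad 0\le\delta_3\le\min\{\delta_2,\delta_4\},\qquad \delta_3+\max\{\delta_2,\delta_4\}\le\delta_1,$$ $$\max\{\delta_2,\delta_4\}\le\delta_5\le\epsilon-p^\ast,\qquad \delta_5+\delta_1\le 1-2p^\ast+\min\{\delta_2,\delta_4\},$$ $$2(1-\epsilon)\min\{p^\ast-\tfrac\epsilon2-2(1-\epsilon)\delta_3,\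 2p^\ast-\tfrac12-4(1-\epsilon)\delta_3\}\le 1-2p^\ast-\delta_1.$$ **Theorem.** The polynomial $4t^3-14t^2+15t-4$ has exactly one real root $\epsilon_3$, and $0<\epsilon_3<\frac12$. For every $\epsilon\in[0,\frac12)$: 1. Conditioning Problem 3 has a solution of the form $(P_1,P_2)=(P^\alpha_{m_1},P^\alpha_{m_2})$ if and only if $\epsilon\in[\epsilon_3,\frac12)$. 2. A pair $(P^\alpha_{m_1},P^\alpha_{m_2})$ solves Conditioning Problem 3 if and only if it equals $(P^\alpha_{m_1(\delta)},P^\alpha_{m_2(\delta)})$ for some $\delta\in\Delta_\epsilon$. 3. For every $\delta\in\Delta_\epsilon$ the set $\mathrm{Orb}(P^\alpha_{m_1(\delta)},P^\alpha_{m_2(\delta)})$ is an AsIUP of $G_{3,\epsilon}$. -/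

import Mathlib

noncomputable section

namespace CoupledMap

/-- The integer-valued step function `h`: the integer nearest to `u` if `u ∉ 1/2 + ℤ`, and `0`
otherwise. -/
def h (u : ℝ) : ℤ :=
  open Classical in if ∃ n : ℤ, u = n + 1 / 2 then 0 else ⌊u + 1 / 2⌋

/-- The open unit cube `(0,1)³`, with coordinates `x₁ = x 0`, `x₂ = x 1`, `x₃ = x 2`. -/
def cube : Set (Fin 3 → ℝ) := {x | ∀ i, 0 < x i ∧ x i < 1}

/-- The piecewise constant function `B₃` of the uniform cluster distribution on four sites. -/
def B₃ (x : Fin 3 → ℝ) : Fin 3 → ℝ :=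
  ![(2 * h (x 0) - h (x 1) + h (x 0 + x 1) - h (x 1 + x 2) + h (x 0 + x 1 + x 2)) / 4,
    (2 * h (x 1) - h (x 0) - h (x 2) + h (x 0 + x 1) + h (x 1 + x 2)) / 4,
    (2 * h (x 2) - h (x 1) - h (x 0 + x 1) + h (x 1 + x 2) + h (x 0 + x 1 + x 2)) / 4]

/-- The reduced coupled map `G_{3,ε}(x) = {2(1 - ε) x + 2 ε B₃(x)}` (fractional parts,
coordinatewise). -/
def G (ε : ℝ) (x : Fin 3 → ℝ) : Fin 3 → ℝ :=
  fun i => Int.fract (2 * (1 - ε) * x i + 2 * ε * B₃ x i)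

/-- `P^α_m`: the intersection of the open slabs `m i 0 < (α x)_i < m i 1`. Row `i` of the constraint
matrix `m` is (lower bound, upper bound). -/
def polytope {e : ℕ} (α : Matrix (Fin e) (Fin 3) ℝ) (m : Matrix (Fin e) (Fin 2) ℝ) :
    Set (Fin 3 → ℝ) :=
  {x | ∀ i, m i 0 < α.mulVec x i ∧ α.mulVec x i < m i 1}

/-- Non-empty, bounded, open convex polytopes of `ℝ³`. -/
def IsOpenPolytope (P : Set (Fin 3 → ℝ)) : Prop :=
  P.Nonempty ∧ Bornology.IsBounded P ∧
    ∃ (e : ℕ) (α : Matrix (Fin e) (Fin 3) ℝ) (m : Matrix (Fin e) (Fin 2) ℝ), P = polytope α m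

/-- The canonical coefficient matrix: its rows are the linear forms
`x₁, x₂, x₃, x₁ + x₂, x₂ + x₃, x₁ + x₂ + x₃`. -/
def canonical : Matrix (Fin 6) (Fin 3) ℝ :=
  !![1, 0, 0;
     0, 1, 0;
     0, 0, 1;
     1, 1, 0;
     0, 1, 1;
     1, 1, 1]

/-- The atom `A_ω` of the symbolic partition: the open set of the points of the cube at which
`h(x₁), h(x₂), h(x₃), h(x₁+x₂), h(x₂+x₃), h(x₁+x₂+x₃)` are the entries of the label `ω` and none of
these six sums lies in `1/2 + ℤ`. (It is empty for all but 26 labels.) -/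
def atom (ω : Fin 6 → ℤ) : Set (Fin 3 → ℝ) :=
  {x | x ∈ cube ∧ ∀ i, (ω i : ℝ) - 1 / 2 < canonical.mulVec x i ∧
    canonical.mulVec x i < (ω i : ℝ) + 1 / 2}

/-- Action modulo 1 of the transposition `(u₁,u₂,u₃,u₄) ↦ (u₄,u₂,u₃,u₁)`. -/
def σ4231 (x : Fin 3 → ℝ) : Fin 3 → ℝ :=
  ![Int.fract (-x 1 - x 2), Int.fract (x 1), Int.fract (-x 0 - x 1)]

/-- Action modulo 1 of the transposition `(u₁,u₂,u₃,u₄) ↦ (u₁,u₃,u₂,u₄)`. -/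
def σ1324 (x : Fin 3 → ℝ) : Fin 3 → ℝ :=
  ![Int.fract (x 0 + x 1), Int.fract (-x 1), Int.fract (x 1 + x 2)]

/-- `σ4321 = σ4231 ∘ σ1324`. -/
def σ4321 : (Fin 3 → ℝ) → (Fin 3 → ℝ) := σ4231 ∘ σ1324

/-- The inversion symmetry `Σ = 1 - Id`. -/
def inversion (x : Fin 3 → ℝ) : Fin 3 → ℝ := fun i => 1 - x i

/-- Conditioning Problem 3 for the pair of polytopes `(P₁, P₂)`. -/
structure ConditioningProblem3 (ε : ℝ) (P₁ P₂ : Set (Fin 3 → ℝ)) : Prop where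
  polytope₁ : IsOpenPolytope P₁
  polytope₂ : IsOpenPolytope P₂
  subset₁ : P₁ ⊆ cube
  subset₂ : P₂ ⊆ cube
  loc₁ : ∀ ω : Fin 6 → ℤ, (P₁ ∩ atom ω).Nonempty ↔
    ω ∈ ({![0, 0, 0, 1, 0, 1], ![1, 0, 0, 1, 0, 1]} : Set (Fin 6 → ℤ))
  symm₂ : σ4321 '' P₂ = P₂
  loc₂ : ∀ ω : Fin 6 → ℤ, (P₂ ∩ atom ω).Nonempty ↔
    ω ∈ ({![1, 1, 0, 1, 1, 1], ![1, 1, 0, 1, 1, 2], ![1, 1, 0, 2, 1, 2],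
      ![1, 0, 0, 1, 0, 1], ![1, 0, 0, 1, 1, 1], ![1, 0, 0, 1, 1, 2]} : Set (Fin 6 → ℤ))
  dyn_000101 : G ε '' (P₁ ∩ atom ![0, 0, 0, 1, 0, 1]) ⊆ P₂
  dyn_100101 : G ε '' (P₁ ∩ atom ![1, 0, 0, 1, 0, 1]) ⊆ P₁
  dyn_110111 : G ε '' (P₂ ∩ atom ![1, 1, 0, 1, 1, 1]) = P₁
  dyn_110112 : G ε '' (P₂ ∩ atom ![1, 1, 0, 1, 1, 2]) ⊆ σ4231 '' P₁
  dyn_110212 : G ε '' (P₂ ∩ atom ![1, 1, 0, 2, 1, 2]) ⊆ P₂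

/-- `p* = (2 - ε) / (2 (3 - 2 ε))`. -/
def pstar (ε : ℝ) : ℝ := (2 - ε) / (2 * (3 - 2 * ε))

/-- The constraint matrix `m₁(δ)`, where `δ₁, …, δ₅` are `δ 0, …, δ 4`. -/
def m₁ (ε : ℝ) (δ : Fin 5 → ℝ) : Matrix (Fin 6) (Fin 2) ℝ :=
  !![1 - 2 * pstar ε + 2 * (1 - ε) * δ 0, 1 - ε;
     ε / 2, pstar ε - 2 * (1 - ε) * δ 1;
     0, pstar ε - ε / 2 - 2 * (1 - ε) * δ 2;
     1 - pstar ε + 2 * (1 - ε) * δ 2, 1 - ε / 2;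
     ε / 2, pstar ε - 2 * (1 - ε) * δ 2;
     1 - pstar ε + 2 * (1 - ε) * δ 3, 1 - ε / 2]

/-- The constraint matrix `m₂(δ)`. -/
def m₂ (ε : ℝ) (δ : Fin 5 → ℝ) : Matrix (Fin 6) (Fin 2) ℝ :=
  !![2 * pstar ε + δ 0, 1;
     pstar ε + δ 1, 1 - pstar ε - δ 1;
     0, 1 - 2 * pstar ε - δ 0;
     1 + pstar ε + δ 2, 2 - pstar ε - δ 4;
     pstar ε + δ 4, 1 - pstar ε - δ 2;
     1 + pstar ε + δ 3, 2 - pstar ε - δ 3]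

/-- The parameter set `Δ_ε`. -/
def Δ (ε : ℝ) : Set (Fin 5 → ℝ) :=
  {δ | (0 ≤ 2 * (1 - ε) * δ 0 ∧ 2 * (1 - ε) * δ 0 ≤ 2 * pstar ε - (1 - ε)) ∧
    δ 0 ≤ ε * (1 - 2 * pstar ε) + 2 * (1 - ε) * min (δ 1) (δ 3) ∧
    (0 ≤ 2 * (1 - ε) * max (δ 1) (δ 3) ∧
      2 * (1 - ε) * max (δ 1) (δ 3) ≤ pstar ε - (1 - ε) ^ 2) ∧
    (0 ≤ δ 2 ∧ δ 2 ≤ min (δ 1) (δ 3)) ∧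
    δ 2 + max (δ 1) (δ 3) ≤ δ 0 ∧
    (max (δ 1) (δ 3) ≤ δ 4 ∧ δ 4 ≤ ε - pstar ε) ∧
    δ 4 + δ 0 ≤ 1 - 2 * pstar ε + min (δ 1) (δ 3) ∧
    2 * (1 - ε) * min (pstar ε - ε / 2 - 2 * (1 - ε) * δ 2)
        (2 * pstar ε - 1 / 2 - 4 * (1 - ε) * δ 2)
      ≤ 1 - 2 * pstar ε - δ 0}

/-- The orbit set of `P₁, P₂` under the group generated by `σ4231` and `σ1324`. These two maps act on
`[0,1)³` as commuting involutions, so the group consists of `id, σ4231, σ1324, σ4321`. -/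
def orb (P₁ P₂ : Set (Fin 3 → ℝ)) : Set (Fin 3 → ℝ) :=
  (P₁ ∪ σ4231 '' P₁ ∪ σ1324 '' P₁ ∪ σ4321 '' P₁) ∪
    (P₂ ∪ σ4231 '' P₂ ∪ σ1324 '' P₂ ∪ σ4321 '' P₂)

/-- Invariant Union of Polytopes of `G_{3,ε}`: a non-empty finite union of open polytopes of the cube
that is mapped into itself. As the atoms form a partition modulo a null set and the map is specified
on atoms, invariance is required at all the points of the atoms. -/
def IsIUP (ε : ℝ) (U : Set (Fin 3 → ℝ)) : Prop :=
  U.Nonempty ∧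
  (∃ (n : ℕ) (P : Fin n → Set (Fin 3 → ℝ)),
    (∀ k, IsOpenPolytope (P k) ∧ P k ⊆ cube) ∧ U = ⋃ k, P k) ∧
  ∀ ω, G ε '' (U ∩ atom ω) ⊆ U

/-- Asymmetric IUP: an IUP that is disjoint from its image under `Σ`. -/
def IsAsIUP (ε : ℝ) (U : Set (Fin 3 → ℝ)) : Prop :=
  IsIUP ε U ∧ inversion '' U ∩ U = ∅

end CoupledMap

end

/-! ### Coordinates for polytopes and atoms, affine branches of `G`, symmetries -/

namespace CoupledMap

/-! On each of the atoms in the dynamical conditions `G ε` is affine, x ↦ s x + c with s = 2(1 - ε)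
> 1, so the problem is about how parallel faces move. The constant p* is where they close up: the
face x₁ = 2p* of P₂ goes to x₁ = 1 - 2p* on atom 110111 and returns to x₁ = 2p* on atom 000101, and
x₁ + x₂ alternates in the same way between 1 + p* and 1 - p*. An inward displacement of such a face
returns multiplied by s², which is why displacements must be non-negative. The other inequalities of
`Δ` mostly control the images of pieces cut off by the walls between atoms.

Sufficiency is then a check of linear inequalities. Away from half-integer sums `G ε` commutes with
the two transpositions, so invariance passes from P₁ and P₂ to the whole orbit (`G_mem_orb`).
Asymmetry holds because `Δ ε` can be non-empty only for ε > 3/8, where bounds independent of δ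
already separate the orbit from its inversion.

For necessity, the symmetry of P₂ and the fact that x₁ comes arbitrarily close to 1 on it leave five
free tight bounds (`exists_eq_m₂`), and the equality on 110111 computes P₁ from P₂
(`mem₁_iff_slabs`). Every remaining inclusion bounds a linear form on a cell. The six canonical
forms are the pairwise differences of 0, x₃, x₂ + x₃, x₁ + x₂ + x₃, so a cell is a system of
difference constraints and its optimal bounds are shortest paths (`exists_path_le`). Tightness
leaves at most two relevant paths in each case, and they yield the inequalities of `Δ`
(`Tight.admissible`).

Finally `Δ ε` is non-empty iff (1 - ε)² ≤ p*, with δ = 0 as witness; clearing denominators gives the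
cubic. -/

lemma mem_polytope_canonical (m : Matrix (Fin 6) (Fin 2) ℝ) (x : Fin 3 → ℝ) :
    x ∈ polytope canonical m ↔
      (m 0 0 < x 0 ∧ x 0 < m 0 1) ∧ (m 1 0 < x 1 ∧ x 1 < m 1 1) ∧ (m 2 0 < x 2 ∧ x 2 < m 2 1) ∧
      (m 3 0 < x 0 + x 1 ∧ x 0 + x 1 < m 3 1) ∧ (m 4 0 < x 1 + x 2 ∧ x 1 + x 2 < m 4 1) ∧
      (m 5 0 < x 0 + x 1 + x 2 ∧ x 0 + x 1 + x 2 < m 5 1) := by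
  simp [polytope, canonical, Fin.forall_fin_succ, Matrix.mulVec, dotProduct, Fin.sum_univ_three]

lemma mem_polytope_m₁ (ε : ℝ) (δ : Fin 5 → ℝ) (x : Fin 3 → ℝ) :
    x ∈ polytope canonical (m₁ ε δ) ↔
      (1 - 2 * pstar ε + 2 * (1 - ε) * δ 0 < x 0 ∧ x 0 < 1 - ε) ∧
      (ε / 2 < x 1 ∧ x 1 < pstar ε - 2 * (1 - ε) * δ 1) ∧
      (0 < x 2 ∧ x 2 < pstar ε - ε / 2 - 2 * (1 - ε) * δ 2) ∧
      (1 - pstar ε + 2 * (1 - ε) * δ 2 < x 0 + x 1 ∧ x 0 + x 1 < 1 - ε / 2) ∧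
      (ε / 2 < x 1 + x 2 ∧ x 1 + x 2 < pstar ε - 2 * (1 - ε) * δ 2) ∧
      (1 - pstar ε + 2 * (1 - ε) * δ 3 < x 0 + x 1 + x 2 ∧ x 0 + x 1 + x 2 < 1 - ε / 2) := by
  rw [mem_polytope_canonical]
  simp [m₁]

lemma mem_polytope_m₂ (ε : ℝ) (δ : Fin 5 → ℝ) (x : Fin 3 → ℝ) :
    x ∈ polytope canonical (m₂ ε δ) ↔
      (2 * pstar ε + δ 0 < x 0 ∧ x 0 < 1) ∧
      (pstar ε + δ 1 < x 1 ∧ x 1 < 1 - pstar ε - δ 1) ∧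
      (0 < x 2 ∧ x 2 < 1 - 2 * pstar ε - δ 0) ∧
      (1 + pstar ε + δ 2 < x 0 + x 1 ∧ x 0 + x 1 < 2 - pstar ε - δ 4) ∧
      (pstar ε + δ 4 < x 1 + x 2 ∧ x 1 + x 2 < 1 - pstar ε - δ 2) ∧
      (1 + pstar ε + δ 3 < x 0 + x 1 + x 2 ∧ x 0 + x 1 + x 2 < 2 - pstar ε - δ 3) := by
  rw [mem_polytope_canonical]
  simp [m₂]

lemma mem_cube (x : Fin 3 → ℝ) :
    x ∈ cube ↔ (0 < x 0 ∧ x 0 < 1) ∧ (0 < x 1 ∧ x 1 < 1) ∧ (0 < x 2 ∧ x 2 < 1) := by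
  simp [cube, Fin.forall_fin_succ]

lemma mem_atom (ω : Fin 6 → ℤ) (x : Fin 3 → ℝ) :
    x ∈ atom ω ↔ x ∈ cube ∧
      ((ω 0 : ℝ) - 1 / 2 < x 0 ∧ x 0 < (ω 0 : ℝ) + 1 / 2) ∧
      ((ω 1 : ℝ) - 1 / 2 < x 1 ∧ x 1 < (ω 1 : ℝ) + 1 / 2) ∧
      ((ω 2 : ℝ) - 1 / 2 < x 2 ∧ x 2 < (ω 2 : ℝ) + 1 / 2) ∧
      ((ω 3 : ℝ) - 1 / 2 < x 0 + x 1 ∧ x 0 + x 1 < (ω 3 : ℝ) + 1 / 2) ∧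
      ((ω 4 : ℝ) - 1 / 2 < x 1 + x 2 ∧ x 1 + x 2 < (ω 4 : ℝ) + 1 / 2) ∧
      ((ω 5 : ℝ) - 1 / 2 < x 0 + x 1 + x 2 ∧ x 0 + x 1 + x 2 < (ω 5 : ℝ) + 1 / 2) := by
  rw [atom, Set.mem_ofPred_eq]
  refine and_congr_right fun _ => ?_
  simp [canonical, Fin.forall_fin_succ, Matrix.mulVec, dotProduct, Fin.sum_univ_three]

lemma mem_atom_vec (a b c d e f : ℤ) (x : Fin 3 → ℝ) :
    x ∈ atom ![a, b, c, d, e, f] ↔ x ∈ cube ∧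
      ((a : ℝ) - 1 / 2 < x 0 ∧ x 0 < (a : ℝ) + 1 / 2) ∧
      ((b : ℝ) - 1 / 2 < x 1 ∧ x 1 < (b : ℝ) + 1 / 2) ∧
      ((c : ℝ) - 1 / 2 < x 2 ∧ x 2 < (c : ℝ) + 1 / 2) ∧
      ((d : ℝ) - 1 / 2 < x 0 + x 1 ∧ x 0 + x 1 < (d : ℝ) + 1 / 2) ∧
      ((e : ℝ) - 1 / 2 < x 1 + x 2 ∧ x 1 + x 2 < (e : ℝ) + 1 / 2) ∧
      ((f : ℝ) - 1 / 2 < x 0 + x 1 + x 2 ∧ x 0 + x 1 + x 2 < (f : ℝ) + 1 / 2) := by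
  rw [mem_atom]
  simp

lemma vec3_eq {a b c : ℝ} {x : Fin 3 → ℝ} (h0 : a = x 0) (h1 : b = x 1) (h2 : c = x 2) :
    ![a, b, c] = x := by
  funext i
  fin_cases i
  exacts [h0, h1, h2]

lemma h_eq {u : ℝ} {n : ℤ} (h₁ : (n : ℝ) - 1 / 2 < u) (h₂ : u < n + 1 / 2) : h u = n := by
  have hn : ¬ ∃ k : ℤ, u = k + 1 / 2 := by
    rintro ⟨k, rfl⟩
    have h3 : (n : ℝ) < k + 1 := by linarith
    have h4 : (k : ℝ) < n := by linarith
    norm_cast at h3 h4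
    omega
  rw [h, if_neg hn, Int.floor_eq_iff]
  constructor <;> linarith

/-- Coordinates of `G` at the points of an atom. -/
lemma G_apply_atom {ε : ℝ} {a b c d e f : ℤ} {x : Fin 3 → ℝ} (hx : x ∈ atom ![a, b, c, d, e, f]) :
    G ε x = ![Int.fract (2 * (1 - ε) * x 0 + 2 * ε * ((2 * a - b + d - e + f) / 4)),
      Int.fract (2 * (1 - ε) * x 1 + 2 * ε * ((2 * b - a - c + d + e) / 4)),
      Int.fract (2 * (1 - ε) * x 2 + 2 * ε * ((2 * c - b - d + e + f) / 4))] := by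
  rw [mem_atom_vec] at hx
  obtain ⟨-, h1, h2, h3, h4, h5, h6⟩ := hx
  have e1 := h_eq h1.1 h1.2
  have e2 := h_eq h2.1 h2.2
  have e3 := h_eq h3.1 h3.2
  have e4 := h_eq h4.1 h4.2
  have e5 := h_eq h5.1 h5.2
  have e6 := h_eq h6.1 h6.2
  funext i
  fin_cases i <;> simp [G, B₃, e1, e2, e3, e4, e5, e6]

lemma fract_eq_sub {a b : ℝ} (n : ℤ) (h : a = b + n) (h0 : 0 ≤ b) (h1 : b < 1) :
    Int.fract a = b :=
  Int.fract_eq_iff.2 ⟨h0, h1, n, by rw [h]; ring⟩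

lemma G_000101 {ε : ℝ} (h0 : 0 ≤ ε) (h1 : ε < 1 / 2) {x : Fin 3 → ℝ}
    (hx : x ∈ atom ![0, 0, 0, 1, 0, 1]) :
    G ε x = ![2 * (1 - ε) * x 0 + ε, 2 * (1 - ε) * x 1 + ε / 2, 2 * (1 - ε) * x 2] := by
  rw [G_apply_atom hx]
  rw [mem_atom_vec, mem_cube] at hx
  norm_num at hx
  obtain ⟨⟨a1, a2, a3⟩, a4, a5, a6, -⟩ := hx
  congr 1
  · refine fract_eq_sub 0 ?_ ?_ ?_ <;> push_cast <;> nlinarith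
  congr 1
  · refine fract_eq_sub 0 ?_ ?_ ?_ <;> push_cast <;> nlinarith
  congr 1
  · refine fract_eq_sub 0 ?_ ?_ ?_ <;> push_cast <;> nlinarith

lemma G_100101 {ε : ℝ} (h0 : 0 ≤ ε) (h1 : ε < 1 / 2) {x : Fin 3 → ℝ}
    (hx : x ∈ atom ![1, 0, 0, 1, 0, 1]) :
    G ε x = ![2 * (1 - ε) * x 0 + 2 * ε - 1, 2 * (1 - ε) * x 1, 2 * (1 - ε) * x 2] := by
  rw [G_apply_atom hx]
  rw [mem_atom_vec, mem_cube] at hx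
  norm_num at hx
  obtain ⟨⟨a1, a2, a3⟩, a4, a5, a6, -⟩ := hx
  congr 1
  · refine fract_eq_sub 1 ?_ ?_ ?_ <;> push_cast <;> nlinarith
  congr 1
  · refine fract_eq_sub 0 ?_ ?_ ?_ <;> push_cast <;> nlinarith
  congr 1
  · refine fract_eq_sub 0 ?_ ?_ ?_ <;> push_cast <;> nlinarith

lemma G_110111 {ε : ℝ} (h0 : 0 ≤ ε) (h1 : ε < 1 / 2) {x : Fin 3 → ℝ}
    (hx : x ∈ atom ![1, 1, 0, 1, 1, 1]) :
    G ε x = ![2 * (1 - ε) * x 0 + ε - 1, 2 * (1 - ε) * x 1 + 3 * ε / 2 - 1,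
      2 * (1 - ε) * x 2] := by
  rw [G_apply_atom hx]
  rw [mem_atom_vec, mem_cube] at hx
  norm_num at hx
  obtain ⟨⟨a1, a2, a3⟩, a4, a5, a6, -⟩ := hx
  congr 1
  · refine fract_eq_sub 1 ?_ ?_ ?_ <;> push_cast <;> nlinarith
  congr 1
  · refine fract_eq_sub 1 ?_ ?_ ?_ <;> push_cast <;> nlinarith
  congr 1
  · refine fract_eq_sub 0 ?_ ?_ ?_ <;> push_cast <;> nlinarith

lemma G_110112 {ε : ℝ} (h0 : 0 ≤ ε) (h1 : ε < 1 / 2) {x : Fin 3 → ℝ}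
    (hx : x ∈ atom ![1, 1, 0, 1, 1, 2]) :
    G ε x = ![2 * (1 - ε) * x 0 + 3 * ε / 2 - 1, 2 * (1 - ε) * x 1 + 3 * ε / 2 - 1,
      2 * (1 - ε) * x 2 + ε / 2] := by
  rw [G_apply_atom hx]
  rw [mem_atom_vec, mem_cube] at hx
  norm_num at hx
  obtain ⟨⟨a1, a2, a3⟩, a4, a5, a6, -⟩ := hx
  congr 1
  · refine fract_eq_sub 1 ?_ ?_ ?_ <;> push_cast <;> nlinarith
  congr 1
  · refine fract_eq_sub 1 ?_ ?_ ?_ <;> push_cast <;> nlinarith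
  congr 1
  · refine fract_eq_sub 0 ?_ ?_ ?_ <;> push_cast <;> nlinarith

lemma G_110212 {ε : ℝ} (h0 : 0 ≤ ε) (h1 : ε < 1 / 2) {x : Fin 3 → ℝ}
    (hx : x ∈ atom ![1, 1, 0, 2, 1, 2]) :
    G ε x = ![2 * (1 - ε) * x 0 + 2 * ε - 1, 2 * (1 - ε) * x 1 + 2 * ε - 1,
      2 * (1 - ε) * x 2] := by
  rw [G_apply_atom hx]
  rw [mem_atom_vec, mem_cube] at hx
  norm_num at hx
  obtain ⟨⟨a1, a2, a3⟩, a4, a5, a6, -⟩ := hx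
  congr 1
  · refine fract_eq_sub 1 ?_ ?_ ?_ <;> push_cast <;> nlinarith
  congr 1
  · refine fract_eq_sub 1 ?_ ?_ ?_ <;> push_cast <;> nlinarith
  congr 1
  · refine fract_eq_sub 0 ?_ ?_ ?_ <;> push_cast <;> nlinarith

/-- Once the integer parts are fixed the symmetry is affine. Only `k` varies in the applications: 0
on P₁ and 1 on P₂. The half-open intervals are those on which the fractional part of a negated sum
is a single affine function. -/
lemma σ4231_eq {x : Fin 3 → ℝ} (k : ℤ) (h1 : 0 ≤ x 1) (h1' : x 1 < 1) (h2 : 0 < x 1 + x 2)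
    (h2' : x 1 + x 2 ≤ 1) (h3 : k < x 0 + x 1) (h3' : x 0 + x 1 ≤ k + 1) :
    σ4231 x = ![1 - x 1 - x 2, x 1, k + 1 - x 0 - x 1] := by
  rw [σ4231, fract_eq_sub (b := 1 - x 1 - x 2) (-1) (by push_cast; ring) (by linarith) (by linarith),
    fract_eq_sub (b := x 1) 0 (by push_cast; ring) (by linarith) (by linarith),
    fract_eq_sub (b := k + 1 - x 0 - x 1) (-(k + 1)) (by push_cast; ring) (by linarith)
      (by linarith)]

lemma σ1324_eq {x : Fin 3 → ℝ} (k : ℤ) (h1 : 0 < x 1) (h1' : x 1 ≤ 1) (h2 : 0 ≤ x 1 + x 2)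
    (h2' : x 1 + x 2 < 1) (h3 : k ≤ x 0 + x 1) (h3' : x 0 + x 1 < k + 1) :
    σ1324 x = ![x 0 + x 1 - k, 1 - x 1, x 1 + x 2] := by
  rw [σ1324, fract_eq_sub (b := x 0 + x 1 - k) k (by ring) (by linarith) (by linarith),
    fract_eq_sub (b := 1 - x 1) (-1) (by push_cast; ring) (by linarith) (by linarith),
    fract_eq_sub (b := x 1 + x 2) 0 (by push_cast; ring) (by linarith) (by linarith)]

lemma σ4321_apply (x : Fin 3 → ℝ) :
    σ4321 x = ![Int.fract (-x 2), Int.fract (-x 1), Int.fract (-x 0)] := by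
  simp only [σ4321, Function.comp, σ4231, σ1324]
  congr 1
  · refine Int.fract_eq_fract.2 ⟨⌊-x 1⌋ + ⌊x 1 + x 2⌋, ?_⟩
    simp only [Int.fract, Matrix.cons_val]; push_cast; ring
  congr 1
  · simp
  congr 1
  · refine Int.fract_eq_fract.2 ⟨⌊-x 1⌋ + ⌊x 0 + x 1⌋, ?_⟩
    simp only [Int.fract, Matrix.cons_val]; push_cast; ring

lemma fract_neg_of_mem {a : ℝ} (h0 : 0 < a) (h1 : a < 1) : Int.fract (-a) = 1 - a :=
  fract_eq_sub (-1) (by push_cast; ring) (by linarith) (by linarith)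

lemma σ4321_of_mem_cube {x : Fin 3 → ℝ} (hx : x ∈ cube) :
    σ4321 x = ![1 - x 2, 1 - x 1, 1 - x 0] := by
  rw [σ4321_apply, fract_neg_of_mem (hx 0).1 (hx 0).2, fract_neg_of_mem (hx 1).1 (hx 1).2,
    fract_neg_of_mem (hx 2).1 (hx 2).2]

end CoupledMap

/-! ### The parameter set and the dynamics of the explicit polytopes -/

namespace CoupledMap

/-- The defining equation of p*, solved for its product with ε. It makes the images of the faces at
p* linear in p* and ε, for instance 2(1 - ε)(1 - 2p*) = 2p* - ε. -/
lemma pstar_mul {ε : ℝ} (h1 : ε < 1 / 2) : pstar ε * ε = (3 * pstar ε - 1 + ε / 2) / 2 := by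
  have : 3 - 2 * ε ≠ 0 := by linarith
  rw [pstar]
  field_simp
  ring

lemma pstar_bounds {ε : ℝ} (h0 : 0 ≤ ε) (h1 : ε < 1 / 2) :
    1 / 3 ≤ pstar ε ∧ pstar ε ≤ 3 / 8 := by
  have h3 : 0 < 2 * (3 - 2 * ε) := by linarith
  rw [pstar, le_div_iff₀ h3, div_le_iff₀ h3]
  constructor <;> linarith

/-- The inequalities that define `Δ ε`, with the minima and maxima resolved, together with two
consequences. -/
structure Admissible (ε p d₁ d₂ d₃ d₄ d₅ : ℝ) : Prop where
  nonneg₁ : 0 ≤ d₁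
  le₁ : 2 * (1 - ε) * d₁ ≤ 2 * p - (1 - ε)
  le₁₂ : d₁ ≤ ε * (1 - 2 * p) + 2 * (1 - ε) * d₂
  le₁₄ : d₁ ≤ ε * (1 - 2 * p) + 2 * (1 - ε) * d₄
  le₂ : 2 * (1 - ε) * d₂ ≤ p - (1 - ε) ^ 2
  le₄ : 2 * (1 - ε) * d₄ ≤ p - (1 - ε) ^ 2
  nonneg₃ : 0 ≤ d₃
  le₃₂ : d₃ ≤ d₂
  le₃₄ : d₃ ≤ d₄
  add₃₂ : d₃ + d₂ ≤ d₁
  add₃₄ : d₃ + d₄ ≤ d₁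
  le₂₅ : d₂ ≤ d₅
  le₄₅ : d₄ ≤ d₅
  le₅ : d₅ ≤ ε - p
  add₅₂ : d₅ + d₁ ≤ 1 - 2 * p + d₂
  add₅₄ : d₅ + d₁ ≤ 1 - 2 * p + d₄
  or₃ : 2 * (1 - ε) * (p - ε / 2 - 2 * (1 - ε) * d₃) ≤ 1 - 2 * p - d₁ ∨
    2 * (1 - ε) * (2 * p - 1 / 2 - 4 * (1 - ε) * d₃) ≤ 1 - 2 * p - d₁

lemma mem_Δ_iff {ε : ℝ} (h1 : ε < 1 / 2) (δ : Fin 5 → ℝ) :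
    δ ∈ Δ ε ↔ Admissible ε (pstar ε) (δ 0) (δ 1) (δ 2) (δ 3) (δ 4) := by
  have hs : 0 < 2 * (1 - ε) := by linarith
  rw [Δ, Set.mem_ofPred_eq]
  constructor
  · rintro ⟨⟨a1, a2⟩, a3, ⟨a4, a5⟩, ⟨a6, a7⟩, a8, ⟨a9, a10⟩, a11, a12⟩
    have l1 := min_le_left (δ 1) (δ 3)
    have l2 := min_le_right (δ 1) (δ 3)
    have g1 := le_max_left (δ 1) (δ 3)
    have g2 := le_max_right (δ 1) (δ 3)
    have l1' := mul_le_mul_of_nonneg_left l1 hs.le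
    have l2' := mul_le_mul_of_nonneg_left l2 hs.le
    have g1' := mul_le_mul_of_nonneg_left g1 hs.le
    have g2' := mul_le_mul_of_nonneg_left g2 hs.le
    refine ⟨nonneg_of_mul_nonneg_right a1 hs, a2, by linarith, by linarith, by linarith,
      by linarith, a6, by linarith, by linarith, by linarith, by linarith, by linarith,
      by linarith, a10, by linarith, by linarith, ?_⟩
    rcases min_choice (pstar ε - ε / 2 - 2 * (1 - ε) * δ 2)
      (2 * pstar ε - 1 / 2 - 4 * (1 - ε) * δ 2) with e | e <;> rw [e] at a12
    exacts [Or.inl a12, Or.inr a12]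
  · intro H
    have hm : 0 ≤ max (δ 1) (δ 3) := le_max_of_le_left (H.nonneg₃.trans H.le₃₂)
    refine ⟨⟨mul_nonneg hs.le H.nonneg₁, H.le₁⟩, ?_, ⟨mul_nonneg hs.le hm, ?_⟩,
      ⟨H.nonneg₃, le_min H.le₃₂ H.le₃₄⟩, ?_, ⟨max_le H.le₂₅ H.le₄₅, H.le₅⟩, ?_, ?_⟩
    · rcases min_choice (δ 1) (δ 3) with e | e <;> rw [e]
      exacts [H.le₁₂, H.le₁₄]
    · rcases max_choice (δ 1) (δ 3) with e | e <;> rw [e]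
      exacts [H.le₂, H.le₄]
    · rcases max_choice (δ 1) (δ 3) with e | e <;> rw [e]
      exacts [H.add₃₂, H.add₃₄]
    · rcases min_choice (δ 1) (δ 3) with e | e <;> rw [e]
      exacts [H.add₅₂, H.add₅₄]
    · rcases H.or₃ with e | e
      exacts [(mul_le_mul_of_nonneg_left (min_le_left _ _) hs.le).trans e,
        (mul_le_mul_of_nonneg_left (min_le_right _ _) hs.le).trans e]

namespace Admissible

variable {ε p d₁ d₂ d₃ d₄ d₅ : ℝ}

/-- The upper bound of `x₃` in `P₁` is implied by the other constraints. -/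
lemma sub_le (H : Admissible ε p d₁ d₂ d₃ d₄ d₅) (h1 : ε < 1 / 2)
    (hp : p * ε = (3 * p - 1 + ε / 2) / 2) : d₁ - d₃ ≤ 1 / 2 - p := by
  have hs : 0 < 2 * (1 - ε) := by linarith
  have k1 := mul_le_mul_of_nonneg_left H.le₃₂ hs.le
  have k2 := H.le₂
  have k3 := H.le₁
  have hd3 : 2 * (1 - ε) * d₃ ≤ p - ε / 2 := by nlinarith
  have hd3' : d₃ ≤ 1 / 2 - p := by
    refine le_of_mul_le_mul_left ?_ hs
    linarith
  -- Since p - ε/2 = 2(1 - ε)(1/2 - p), the left side is (2(1 - ε))² (1/2 - p - d₃), which is at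
  -- least 1/2 - p - d₃.
  have key : 2 * (1 - ε) * (p - ε / 2 - 2 * (1 - ε) * d₃) ≤ 1 - 2 * p - d₁ →
      d₁ - d₃ ≤ 1 / 2 - p := by
    intro h
    have : 0 ≤ ((2 * (1 - ε)) ^ 2 - 1) * (1 / 2 - p - d₃) :=
      mul_nonneg (by nlinarith) (by linarith)
    have e : 2 * (1 - ε) * (p - ε / 2) = (2 * (1 - ε)) ^ 2 * (1 / 2 - p) := by
      have : p - ε / 2 = 2 * (1 - ε) * (1 / 2 - p) := by linarith
      rw [this]; ring
    linarith
  rcases H.or₃ with h | h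
  · exact key h
  -- If d₃ is large, `le₁` alone suffices; otherwise the second alternative of `or₃` implies the
  -- first.
  · by_cases hc : p - 1 / 2 + ε / 2 ≤ 2 * (1 - ε) * d₃
    · refine le_of_mul_le_mul_left ?_ hs
      linarith
    · refine key (le_trans (mul_le_mul_of_nonneg_left ?_ hs.le) h)
      linarith

lemma lt_one_sub (H : Admissible ε p d₁ d₂ d₃ d₄ d₅) (h1 : ε < 1 / 2)
    (hp : p * ε = (3 * p - 1 + ε / 2) / 2) : d₁ < 1 - 2 * p := by
  have hs : 0 < 2 * (1 - ε) := by linarith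
  refine lt_of_mul_lt_mul_left ?_ hs.le
  linarith [H.le₁]

end Admissible

lemma exists_eq_mul_add {s : ℝ} (hs : 0 < s) (y c : ℝ) : ∃ x, y = s * x + c :=
  ⟨(y - c) / s, by rw [mul_div_cancel₀ _ hs.ne']; ring⟩

section Sufficiency

variable {ε : ℝ} {δ : Fin 5 → ℝ}

lemma m₁_subset_cube (h0 : 0 ≤ ε) (h1 : ε < 1 / 2) (hδ : δ ∈ Δ ε) :
    polytope canonical (m₁ ε δ) ⊆ cube := by
  intro x hx
  have H := (mem_Δ_iff h1 δ).1 hδ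
  have hs : 0 < 2 * (1 - ε) := by linarith
  obtain ⟨p1, p2⟩ := pstar_bounds h0 h1
  have k1 := mul_nonneg hs.le H.nonneg₁
  have k2 := mul_nonneg hs.le H.nonneg₃
  have k3 := mul_nonneg hs.le (H.nonneg₃.trans H.le₃₂)
  rw [mem_polytope_m₁] at hx
  obtain ⟨a1, a2, a3, a4, a5, a6⟩ := hx
  rw [mem_cube]
  refine ⟨⟨?_, ?_⟩, ⟨?_, ?_⟩, ⟨?_, ?_⟩⟩ <;> linarith

lemma m₂_subset_cube (h0 : 0 ≤ ε) (h1 : ε < 1 / 2) (hδ : δ ∈ Δ ε) :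
    polytope canonical (m₂ ε δ) ⊆ cube := by
  intro x hx
  have H := (mem_Δ_iff h1 δ).1 hδ
  obtain ⟨p1, p2⟩ := pstar_bounds h0 h1
  have k1 := H.nonneg₁
  have k3 := H.nonneg₃.trans H.le₃₂
  rw [mem_polytope_m₂] at hx
  obtain ⟨a1, a2, a3, a4, a5, a6⟩ := hx
  rw [mem_cube]
  refine ⟨⟨?_, ?_⟩, ⟨?_, ?_⟩, ⟨?_, ?_⟩⟩ <;> linarith

lemma image_G_m₁_000101 (h0 : 0 ≤ ε) (h1 : ε < 1 / 2) (hδ : δ ∈ Δ ε) :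
    G ε '' (polytope canonical (m₁ ε δ) ∩ atom ![0, 0, 0, 1, 0, 1]) ⊆
      polytope canonical (m₂ ε δ) := by
  rintro _ ⟨x, ⟨hx, hxa⟩, rfl⟩
  rw [G_000101 h0 h1 hxa, mem_polytope_m₂]
  have H := (mem_Δ_iff h1 δ).1 hδ
  have hs : 0 < 2 * (1 - ε) := by linarith
  have hp := pstar_mul h1
  obtain ⟨p1, p2⟩ := pstar_bounds h0 h1
  rw [mem_atom_vec] at hxa
  norm_num at hxa
  rw [mem_polytope_m₁] at hx
  obtain ⟨⟨a1, a1'⟩, ⟨a2, a2'⟩, ⟨a3, a3'⟩, ⟨a4, a4'⟩, ⟨a5, a5'⟩, ⟨a6, a6'⟩⟩ := hx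
  have b1' := mul_lt_mul_of_pos_left hxa.2.1.2 hs
  replace a1 := mul_lt_mul_of_pos_left a1 hs
  replace a2 := mul_lt_mul_of_pos_left a2 hs
  replace a2' := mul_lt_mul_of_pos_left a2' hs
  replace a3 := mul_pos hs a3
  have c3 := mul_lt_mul_of_pos_left a3' hs
  replace a4 := mul_lt_mul_of_pos_left a4 hs
  replace a4' := mul_lt_mul_of_pos_left a4' hs
  replace a5 := mul_lt_mul_of_pos_left a5 hs
  replace a5' := mul_lt_mul_of_pos_left a5' hs
  replace a6 := mul_lt_mul_of_pos_left a6 hs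
  replace a6' := mul_lt_mul_of_pos_left a6' hs
  have hss : 0 ≤ (2 * (1 - ε)) ^ 2 - 1 := by nlinarith
  -- Gains from the loop P₂ → P₁ → P₂, which multiplies displacements by (2(1 - ε))².
  have d0 := mul_nonneg hss H.nonneg₁
  have d1 := mul_nonneg hss (H.nonneg₃.trans H.le₃₂)
  have d2 := mul_nonneg hss H.nonneg₃
  have d3 := mul_nonneg hss (H.nonneg₃.trans H.le₃₄)
  have n0 := H.nonneg₁
  have n2 := H.nonneg₃
  have n1 := H.le₃₂
  have n3 := H.le₃₄
  have n5 := H.le₅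
  have n6 := H.le₂₅
  have n7 := H.le₄₅
  -- The face x₂ = ε/2 is sent to x₂ = 3ε/2 - ε², and this is at least ε ≥ p* + `δ 4`.
  have hε : 0 ≤ ε * (1 / 2 - ε) := mul_nonneg h0 (by linarith)
  simp only [Matrix.cons_val]
  refine ⟨⟨by linarith, by linarith⟩, ⟨by linarith, by linarith⟩, ⟨by linarith, ?_⟩,
    ⟨by linarith, by linarith⟩, ⟨by linarith, by linarith⟩, ⟨by linarith, by linarith⟩⟩
  -- The two alternatives correspond to two bounds of x₃: its own face, or x₃ = x₁ + (x₂ + x₃) - (x₁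
  -- + x₂) with x₁ < 1/2.
  rcases H.or₃ with h | h
  · exact c3.trans_le h
  · refine lt_of_lt_of_le ?_ h
    linarith

/-- The wall x₁ = 1/2 is sent to x₁ = ε, inside P₁ by `le₁`. It also sharpens other bounds: x₂ < (1
- ε)/2 and x₁ + x₂ + x₃ > (1 + ε)/2, whose images are (1 - ε)² and 1 - (1 - ε)²; hence the form of
`le₂` and `le₄`. -/
lemma image_G_m₁_100101 (h0 : 0 ≤ ε) (h1 : ε < 1 / 2) (hδ : δ ∈ Δ ε) :
    G ε '' (polytope canonical (m₁ ε δ) ∩ atom ![1, 0, 0, 1, 0, 1]) ⊆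
      polytope canonical (m₁ ε δ) := by
  rintro _ ⟨x, ⟨hx, hxa⟩, rfl⟩
  rw [G_100101 h0 h1 hxa, mem_polytope_m₁]
  have H := (mem_Δ_iff h1 δ).1 hδ
  have hs : 0 < 2 * (1 - ε) := by linarith
  have hp := pstar_mul h1
  obtain ⟨p1, p2⟩ := pstar_bounds h0 h1
  rw [mem_atom_vec] at hxa
  norm_num at hxa
  rw [mem_polytope_m₁] at hx
  obtain ⟨⟨a1, a1'⟩, ⟨a2, a2'⟩, ⟨a3, a3'⟩, ⟨a4, a4'⟩, ⟨a5, a5'⟩, ⟨a6, a6'⟩⟩ := hx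
  have b1' := mul_lt_mul_of_pos_left hxa.2.1.1 hs
  replace a1' := mul_lt_mul_of_pos_left a1' hs
  replace a2 := mul_lt_mul_of_pos_left a2 hs
  replace a3 := mul_pos hs a3
  replace a4' := mul_lt_mul_of_pos_left a4' hs
  replace a5 := mul_lt_mul_of_pos_left a5 hs
  replace a6' := mul_lt_mul_of_pos_left a6' hs
  have n1 := H.le₁
  have n2 := H.le₂
  have n4 := H.le₄
  have n3 := mul_le_mul_of_nonneg_left H.le₃₂ hs.le
  have hε : 0 ≤ ε * (1 / 2 - ε) := mul_nonneg h0 (by linarith)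
  simp only [Matrix.cons_val]
  refine ⟨⟨by linarith, by linarith⟩, ⟨by linarith, by linarith⟩, ⟨by linarith, by linarith⟩,
    ⟨by linarith, by linarith⟩, ⟨by linarith, by linarith⟩, ⟨by linarith, by linarith⟩⟩

set_option maxHeartbeats 800000 in
lemma image_G_m₂_110111 (h0 : 0 ≤ ε) (h1 : ε < 1 / 2) (hδ : δ ∈ Δ ε) :
    G ε '' (polytope canonical (m₂ ε δ) ∩ atom ![1, 1, 0, 1, 1, 1]) =
      polytope canonical (m₁ ε δ) := by
  have H := (mem_Δ_iff h1 δ).1 hδ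
  have hs : 0 < 2 * (1 - ε) := by linarith
  have hp := pstar_mul h1
  obtain ⟨p1, p2⟩ := pstar_bounds h0 h1
  have n13 := mul_le_mul_of_nonneg_left (H.sub_le h1 hp) hs.le
  have n0 := H.nonneg₁
  have n2 := H.nonneg₃
  have n1 := H.le₃₂
  have n3 := H.le₃₄
  have n5 := H.le₅
  have n6 := H.le₂₅
  have n7 := H.le₄₅
  apply Set.Subset.antisymm
  · rintro _ ⟨x, ⟨hx, hxa⟩, rfl⟩
    rw [G_110111 h0 h1 hxa, mem_polytope_m₁]
    rw [mem_atom_vec] at hxa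
    norm_num at hxa
    obtain ⟨-, ⟨b1, b1'⟩, ⟨b2, b2'⟩, ⟨b3, b3'⟩, ⟨b4, b4'⟩, ⟨b5, b5'⟩, ⟨b6, b6'⟩⟩ := hxa
    rw [mem_polytope_m₂] at hx
    obtain ⟨⟨a1, a1'⟩, ⟨a2, a2'⟩, ⟨a3, a3'⟩, ⟨a4, a4'⟩, ⟨a5, a5'⟩, ⟨a6, a6'⟩⟩ := hx
    replace b2 := mul_lt_mul_of_pos_left b2 hs
    replace b4' := mul_lt_mul_of_pos_left b4' hs
    replace b5 := mul_lt_mul_of_pos_left b5 hs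
    replace b6' := mul_lt_mul_of_pos_left b6' hs
    replace a1 := mul_lt_mul_of_pos_left a1 hs
    replace a1' := mul_lt_mul_of_pos_left a1' hs
    replace a2' := mul_lt_mul_of_pos_left a2' hs
    replace a3 := mul_pos hs a3
    replace a4 := mul_lt_mul_of_pos_left a4 hs
    replace a5' := mul_lt_mul_of_pos_left a5' hs
    replace a6 := mul_lt_mul_of_pos_left a6 hs
    simp only [Matrix.cons_val]
    refine ⟨⟨by linarith, by linarith⟩, ⟨by linarith, by linarith⟩, ⟨by linarith, by linarith⟩,
      ⟨by linarith, by linarith⟩, ⟨by linarith, by linarith⟩, ⟨by linarith, by linarith⟩⟩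
  · intro y hy
    rw [mem_polytope_m₁] at hy
    obtain ⟨x₁, hx₁⟩ := exists_eq_mul_add hs (y 0) (ε - 1)
    obtain ⟨x₂, hx₂⟩ := exists_eq_mul_add hs (y 1) (3 * ε / 2 - 1)
    obtain ⟨x₃, hx₃⟩ := exists_eq_mul_add hs (y 2) 0
    rw [hx₁, hx₂, hx₃] at hy
    obtain ⟨⟨a1, a1'⟩, ⟨a2, a2'⟩, ⟨a3, a3'⟩, ⟨a4, a4'⟩, ⟨a5, a5'⟩, ⟨a6, a6'⟩⟩ := hy
    have c1 : 2 * pstar ε + δ 0 < x₁ := lt_of_mul_lt_mul_left (by linarith) hs.le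
    have c1' : x₁ < 1 := lt_of_mul_lt_mul_left (by linarith) hs.le
    have c2 : 1 / 2 < x₂ := lt_of_mul_lt_mul_left (by linarith) hs.le
    have c2' : x₂ < 1 - pstar ε - δ 1 := lt_of_mul_lt_mul_left (by linarith) hs.le
    have c3 : 0 < x₃ := lt_of_mul_lt_mul_left (by linarith) hs.le
    -- The bound of the third coordinate in P₁ is stronger than the image of that in P₂, thanks to
    -- `n13`.
    have c3' : x₃ < 1 - 2 * pstar ε - δ 0 := lt_of_mul_lt_mul_left (by linarith) hs.le
    have c4 : 1 + pstar ε + δ 2 < x₁ + x₂ := lt_of_mul_lt_mul_left (by linarith) hs.le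
    have c4' : x₁ + x₂ < 3 / 2 := lt_of_mul_lt_mul_left (by linarith) hs.le
    have c5 : 1 / 2 < x₂ + x₃ := lt_of_mul_lt_mul_left (by linarith) hs.le
    have c5' : x₂ + x₃ < 1 - pstar ε - δ 2 := lt_of_mul_lt_mul_left (by linarith) hs.le
    have c6 : 1 + pstar ε + δ 3 < x₁ + x₂ + x₃ := lt_of_mul_lt_mul_left (by linarith) hs.le
    have c6' : x₁ + x₂ + x₃ < 3 / 2 := lt_of_mul_lt_mul_left (by linarith) hs.le
    have ha : ![x₁, x₂, x₃] ∈ atom ![1, 1, 0, 1, 1, 1] := by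
      rw [mem_atom_vec, mem_cube]
      norm_num
      simp only [Matrix.cons_val]
      refine ⟨⟨⟨?_, ?_⟩, ⟨?_, ?_⟩, ?_, ?_⟩, ⟨?_, ?_⟩, ⟨?_, ?_⟩, ⟨?_, ?_⟩, ⟨?_, ?_⟩, ⟨?_, ?_⟩, ?_, ?_⟩
        <;> linarith
    refine ⟨![x₁, x₂, x₃], ⟨?_, ha⟩, ?_⟩
    · rw [mem_polytope_m₂]
      simp only [Matrix.cons_val]
      refine ⟨⟨?_, ?_⟩, ⟨?_, ?_⟩, ⟨?_, ?_⟩, ⟨?_, ?_⟩, ⟨?_, ?_⟩, ?_, ?_⟩ <;> linarith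
    · rw [G_110111 h0 h1 ha]
      refine vec3_eq ?_ ?_ ?_ <;> simp only [Matrix.cons_val] <;> linarith

lemma image_G_m₂_110112 (h0 : 0 ≤ ε) (h1 : ε < 1 / 2) (hδ : δ ∈ Δ ε) :
    G ε '' (polytope canonical (m₂ ε δ) ∩ atom ![1, 1, 0, 1, 1, 2]) ⊆
      σ4231 '' polytope canonical (m₁ ε δ) := by
  have H := (mem_Δ_iff h1 δ).1 hδ
  have hs : 0 < 2 * (1 - ε) := by linarith
  have hp := pstar_mul h1
  obtain ⟨p1, p2⟩ := pstar_bounds h0 h1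
  have n13 := mul_le_mul_of_nonneg_left (H.sub_le h1 hp) hs.le
  rintro _ ⟨x, ⟨hx, hxa⟩, rfl⟩
  rw [G_110112 h0 h1 hxa]
  rw [mem_atom_vec] at hxa
  norm_num at hxa
  obtain ⟨-, ⟨b1, b1'⟩, ⟨b2, b2'⟩, ⟨b3, b3'⟩, ⟨b4, b4'⟩, ⟨b5, b5'⟩, ⟨b6, b6'⟩⟩ := hxa
  rw [mem_polytope_m₂] at hx
  obtain ⟨⟨a1, a1'⟩, ⟨a2, a2'⟩, ⟨a3, a3'⟩, ⟨a4, a4'⟩, ⟨a5, a5'⟩, ⟨a6, a6'⟩⟩ := hx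
  replace b2 := mul_lt_mul_of_pos_left b2 hs
  replace b4' := mul_lt_mul_of_pos_left b4' hs
  replace b5 := mul_lt_mul_of_pos_left b5 hs
  replace b6 := mul_lt_mul_of_pos_left b6 hs
  replace a1 := mul_lt_mul_of_pos_left a1 hs
  replace a1' := mul_lt_mul_of_pos_left a1' hs
  replace a2' := mul_lt_mul_of_pos_left a2' hs
  replace a3 := mul_pos hs a3
  replace a4 := mul_lt_mul_of_pos_left a4 hs
  replace a5' := mul_lt_mul_of_pos_left a5' hs
  replace a6 := mul_lt_mul_of_pos_left a6 hs
  replace a6' := mul_lt_mul_of_pos_left a6' hs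
  -- The witness is the involution `σ4231` applied to the image point. Its first lower bound is
  -- where `n13` is needed.
  have hy : ![2 * (1 - ε) * (1 - x 1 - x 2), 2 * (1 - ε) * x 1 + 3 * ε / 2 - 1,
      2 * (1 - ε) * (3 / 2 - x 0 - x 1)] ∈ polytope canonical (m₁ ε δ) := by
    rw [mem_polytope_m₁]
    simp only [Matrix.cons_val]
    refine ⟨⟨by linarith, by linarith⟩, ⟨by linarith, by linarith⟩, ⟨by linarith, by linarith⟩,
      ⟨by linarith, by linarith⟩, ⟨by linarith, by linarith⟩, ⟨by linarith, by linarith⟩⟩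
  refine ⟨_, hy, ?_⟩
  have hc := m₁_subset_cube h0 h1 hδ hy
  rw [mem_cube] at hc
  rw [mem_polytope_m₁] at hy
  simp only [Matrix.cons_val] at hy hc
  have e1 := mul_nonneg hs.le H.nonneg₃
  rw [σ4231_eq 0]
  · funext i
    fin_cases i <;> simp <;> ring
  all_goals simp only [Matrix.cons_val]; push_cast; linarith

/-- The wall x₁ + x₂ = 3/2 sharpens two bounds to x₁ > 1/2 + p* + `δ 1` and x₃ < 1/2 - p* - `δ 3`;
`le₁₂` and `le₁₄` say that their images stay in P₂. The wall x₂ = 1/2 is sent to x₂ = ε, which is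
handled by `le₅`. -/
lemma image_G_m₂_110212 (h0 : 0 ≤ ε) (h1 : ε < 1 / 2) (hδ : δ ∈ Δ ε) :
    G ε '' (polytope canonical (m₂ ε δ) ∩ atom ![1, 1, 0, 2, 1, 2]) ⊆
      polytope canonical (m₂ ε δ) := by
  have H := (mem_Δ_iff h1 δ).1 hδ
  have hs : 0 < 2 * (1 - ε) := by linarith
  have hp := pstar_mul h1
  obtain ⟨p1, p2⟩ := pstar_bounds h0 h1
  rintro _ ⟨x, ⟨hx, hxa⟩, rfl⟩
  rw [G_110212 h0 h1 hxa, mem_polytope_m₂]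
  rw [mem_atom_vec] at hxa
  norm_num at hxa
  obtain ⟨-, ⟨b1, b1'⟩, ⟨b2, b2'⟩, ⟨b3, b3'⟩, ⟨b4, b4'⟩, ⟨b5, b5'⟩, ⟨b6, b6'⟩⟩ := hxa
  rw [mem_polytope_m₂] at hx
  obtain ⟨⟨a1, a1'⟩, ⟨a2, a2'⟩, ⟨a3, a3'⟩, ⟨a4, a4'⟩, ⟨a5, a5'⟩, ⟨a6, a6'⟩⟩ := hx
  replace b2 := mul_lt_mul_of_pos_left b2 hs
  replace b4 := mul_lt_mul_of_pos_left b4 hs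
  replace b5 := mul_lt_mul_of_pos_left b5 hs
  replace b6 := mul_lt_mul_of_pos_left b6 hs
  replace a1' := mul_lt_mul_of_pos_left a1' hs
  replace a2' := mul_lt_mul_of_pos_left a2' hs
  replace a3 := mul_pos hs a3
  replace a4' := mul_lt_mul_of_pos_left a4' hs
  replace a5' := mul_lt_mul_of_pos_left a5' hs
  replace a6' := mul_lt_mul_of_pos_left a6' hs
  have n1 := H.le₃₂
  have n2 := H.nonneg₃
  have n3 := H.le₃₄
  have n4 := H.le₁₂
  have n9 := H.le₁₄
  have n5 := H.le₅
  have n6 := H.le₂₅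
  have n7 := H.le₄₅
  have d5 : 0 ≤ (2 * (1 - ε) - 1) * δ 4 := mul_nonneg (by linarith) (by linarith)
  have d1 : 0 ≤ (2 * (1 - ε) - 1) * δ 1 := mul_nonneg (by linarith) (by linarith)
  have d2 : 0 ≤ (2 * (1 - ε) - 1) * δ 2 := mul_nonneg (by linarith) (by linarith)
  have d3 : 0 ≤ (2 * (1 - ε) - 1) * δ 3 := mul_nonneg (by linarith) (by linarith)
  simp only [Matrix.cons_val]
  refine ⟨⟨by linarith, by linarith⟩, ⟨by linarith, by linarith⟩, ⟨by linarith, by linarith⟩,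
    ⟨by linarith, by linarith⟩, ⟨by linarith, by linarith⟩, ⟨by linarith, by linarith⟩⟩

end Sufficiency

end CoupledMap

/-! ### Localization: which atoms the explicit polytopes meet -/

namespace CoupledMap

section Sufficiency

variable {ε : ℝ} {δ : Fin 5 → ℝ}

lemma nonempty_m₁_inter_100101 (h0 : 0 ≤ ε) (h1 : ε < 1 / 2) (hδ : δ ∈ Δ ε) :
    (polytope canonical (m₁ ε δ) ∩ atom ![1, 0, 0, 1, 0, 1]).Nonempty := by
  have H := (mem_Δ_iff h1 δ).1 hδ
  have hs : 0 < 2 * (1 - ε) := by linarith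
  obtain ⟨p1, p2⟩ := pstar_bounds h0 h1
  have n1 := H.le₁
  have n2 := H.le₂
  have n4 := H.le₄
  have n3 := mul_le_mul_of_nonneg_left H.le₃₂ hs.le
  have hq : 1 / 4 < (1 - ε) ^ 2 := by nlinarith
  have hε : ε / 2 < (1 - ε) ^ 2 := by linarith
  obtain ⟨t, t0, ht⟩ : ∃ t : ℝ, 0 < t ∧ t < min (1 / 2 - ε) ((1 - ε) ^ 2 - 1 / 4) / 4 :=
    exists_between (by have : 0 < min (1 / 2 - ε) ((1 - ε) ^ 2 - 1 / 4) :=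
                        lt_min (by linarith) (by linarith)
                       linarith)
  have t1 := min_le_left (1 / 2 - ε) ((1 - ε) ^ 2 - 1 / 4)
  have t2 := min_le_right (1 / 2 - ε) ((1 - ε) ^ 2 - 1 / 4)
  -- The point (1/2, 1/4, 0) lies on the wall x₁ = 1/2 and satisfies every constraint of P₁ strictly
  -- except x₃ > 0; it is moved slightly off both planes.
  refine ⟨![1 / 2 + t, 1 / 4, t / 2], ?_, ?_⟩
  · rw [mem_polytope_m₁]
    simp only [Matrix.cons_val]
    refine ⟨⟨?_, ?_⟩, ⟨?_, ?_⟩, ⟨?_, ?_⟩, ⟨?_, ?_⟩, ⟨?_, ?_⟩, ?_, ?_⟩ <;> linarith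
  · rw [mem_atom_vec, mem_cube]
    simp only [Matrix.cons_val]
    push_cast
    refine ⟨⟨⟨?_, ?_⟩, ⟨?_, ?_⟩, ?_, ?_⟩, ⟨?_, ?_⟩, ⟨?_, ?_⟩, ⟨?_, ?_⟩, ⟨?_, ?_⟩, ⟨?_, ?_⟩, ?_, ?_⟩
      <;> linarith

lemma nonempty_m₁_inter_000101 (h0 : 0 ≤ ε) (h1 : ε < 1 / 2) (hδ : δ ∈ Δ ε) :
    (polytope canonical (m₁ ε δ) ∩ atom ![0, 0, 0, 1, 0, 1]).Nonempty := by
  have H := (mem_Δ_iff h1 δ).1 hδ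
  have hs : 0 < 2 * (1 - ε) := by linarith
  obtain ⟨p1, p2⟩ := pstar_bounds h0 h1
  have n1 := H.le₁
  have n2 := H.le₂
  have n4 := H.le₄
  have n3 := mul_le_mul_of_nonneg_left H.le₃₂ hs.le
  have hq : 1 / 4 < (1 - ε) ^ 2 := by nlinarith
  have hε : ε / 2 < (1 - ε) ^ 2 := by linarith
  obtain ⟨t, t0, ht⟩ : ∃ t : ℝ, 0 < t ∧ t < min (1 / 2 - ε) ((1 - ε) ^ 2 - 1 / 4) / 4 :=
    exists_between (by have : 0 < min (1 / 2 - ε) ((1 - ε) ^ 2 - 1 / 4) :=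
                        lt_min (by linarith) (by linarith)
                       linarith)
  have t1 := min_le_left (1 / 2 - ε) ((1 - ε) ^ 2 - 1 / 4)
  have t2 := min_le_right (1 / 2 - ε) ((1 - ε) ^ 2 - 1 / 4)
  refine ⟨![1 / 2 - t, 1 / 4, t / 2], ?_, ?_⟩
  · rw [mem_polytope_m₁]
    simp only [Matrix.cons_val]
    refine ⟨⟨?_, ?_⟩, ⟨?_, ?_⟩, ⟨?_, ?_⟩, ⟨?_, ?_⟩, ⟨?_, ?_⟩, ?_, ?_⟩ <;> linarith
  · rw [mem_atom_vec, mem_cube]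
    simp only [Matrix.cons_val]
    push_cast
    refine ⟨⟨⟨?_, ?_⟩, ⟨?_, ?_⟩, ?_, ?_⟩, ⟨?_, ?_⟩, ⟨?_, ?_⟩, ⟨?_, ?_⟩, ⟨?_, ?_⟩, ⟨?_, ?_⟩, ?_, ?_⟩
      <;> linarith

/-- Near the vertex `(1, 1/2, 0)` the polytope `P₂` looks like the whole cube. -/
lemma mem_m₂_of_near (h0 : 0 ≤ ε) (h1 : ε < 1 / 2) (hδ : δ ∈ Δ ε) {t a b c : ℝ}
    (t1 : t ≤ (1 / 2 - ε) / 10) (t2 : t ≤ (1 - 2 * pstar ε - δ 0) / 10)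
    (ha : 0 < a) (ha' : a ≤ 4 * t) (hb : 0 < b) (hb' : b ≤ 4 * t) (hc : 0 < c) (hc' : c ≤ 4 * t) :
    ![1 - a, 1 / 2 + b, c] ∈ polytope canonical (m₂ ε δ) := by
  have H := (mem_Δ_iff h1 δ).1 hδ
  obtain ⟨p1, p2⟩ := pstar_bounds h0 h1
  have n2 := H.nonneg₃
  have n1 := H.le₃₂
  have n3 := H.le₃₄
  have n5 := H.le₅
  have n6 := H.le₂₅
  have n7 := H.le₄₅
  rw [mem_polytope_m₂]
  simp only [Matrix.cons_val]
  refine ⟨⟨?_, ?_⟩, ⟨?_, ?_⟩, ⟨?_, ?_⟩, ⟨?_, ?_⟩, ⟨?_, ?_⟩, ?_, ?_⟩ <;> linarith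

lemma exists_small (h1 : ε < 1 / 2) (hδ : δ ∈ Δ ε) :
    ∃ t : ℝ, 0 < t ∧ t ≤ (1 / 2 - ε) / 10 ∧ t ≤ (1 - 2 * pstar ε - δ 0) / 10 ∧ t ≤ 1 / 100 := by
  have H := (mem_Δ_iff h1 δ).1 hδ
  have := H.lt_one_sub h1 (pstar_mul h1)
  exact ⟨min (min ((1 / 2 - ε) / 10) ((1 - 2 * pstar ε - δ 0) / 10)) (1 / 100),
    lt_min (lt_min (by linarith) (by linarith)) (by norm_num),
    (min_le_left _ _).trans (min_le_left _ _), (min_le_left _ _).trans (min_le_right _ _),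
    min_le_right _ _⟩

/-- At (1 - a, 1/2 + b, c) with small positive a, b, c, the label depends only on the signs of b - a
and b + c - a. The weights of `t` here and in the next two lemmas realize the three sign patterns.
-/
lemma nonempty_m₂_inter_110111 (h0 : 0 ≤ ε) (h1 : ε < 1 / 2) (hδ : δ ∈ Δ ε) :
    (polytope canonical (m₂ ε δ) ∩ atom ![1, 1, 0, 1, 1, 1]).Nonempty := by
  obtain ⟨t, t0, t1, t2, t3⟩ := exists_small h1 hδ
  refine ⟨![1 - 4 * t, 1 / 2 + t, t], mem_m₂_of_near h0 h1 hδ t1 t2 (by linarith) (by linarith)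
    (by linarith) (by linarith) (by linarith) (by linarith), ?_⟩
  rw [mem_atom_vec, mem_cube]
  simp only [Matrix.cons_val]
  push_cast
  refine ⟨⟨⟨?_, ?_⟩, ⟨?_, ?_⟩, ?_, ?_⟩, ⟨?_, ?_⟩, ⟨?_, ?_⟩, ⟨?_, ?_⟩, ⟨?_, ?_⟩, ⟨?_, ?_⟩, ?_, ?_⟩
    <;> linarith

lemma nonempty_m₂_inter_110112 (h0 : 0 ≤ ε) (h1 : ε < 1 / 2) (hδ : δ ∈ Δ ε) :
    (polytope canonical (m₂ ε δ) ∩ atom ![1, 1, 0, 1, 1, 2]).Nonempty := by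
  obtain ⟨t, t0, t1, t2, t3⟩ := exists_small h1 hδ
  refine ⟨![1 - 2 * t, 1 / 2 + t, 3 * t], mem_m₂_of_near h0 h1 hδ t1 t2 (by linarith)
    (by linarith) (by linarith) (by linarith) (by linarith) (by linarith), ?_⟩
  rw [mem_atom_vec, mem_cube]
  simp only [Matrix.cons_val]
  push_cast
  refine ⟨⟨⟨?_, ?_⟩, ⟨?_, ?_⟩, ?_, ?_⟩, ⟨?_, ?_⟩, ⟨?_, ?_⟩, ⟨?_, ?_⟩, ⟨?_, ?_⟩, ⟨?_, ?_⟩, ?_, ?_⟩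
    <;> linarith

lemma nonempty_m₂_inter_110212 (h0 : 0 ≤ ε) (h1 : ε < 1 / 2) (hδ : δ ∈ Δ ε) :
    (polytope canonical (m₂ ε δ) ∩ atom ![1, 1, 0, 2, 1, 2]).Nonempty := by
  obtain ⟨t, t0, t1, t2, t3⟩ := exists_small h1 hδ
  refine ⟨![1 - t, 1 / 2 + 2 * t, t], mem_m₂_of_near h0 h1 hδ t1 t2 (by linarith)
    (by linarith) (by linarith) (by linarith) (by linarith) (by linarith), ?_⟩
  rw [mem_atom_vec, mem_cube]
  simp only [Matrix.cons_val]
  push_cast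
  refine ⟨⟨⟨?_, ?_⟩, ⟨?_, ?_⟩, ?_, ?_⟩, ⟨?_, ?_⟩, ⟨?_, ?_⟩, ⟨?_, ?_⟩, ⟨?_, ?_⟩, ⟨?_, ?_⟩, ?_, ?_⟩
    <;> linarith

lemma σ4321_mem_m₂ (h0 : 0 ≤ ε) (h1 : ε < 1 / 2) (hδ : δ ∈ Δ ε) {x : Fin 3 → ℝ}
    (hx : x ∈ polytope canonical (m₂ ε δ)) : σ4321 x ∈ polytope canonical (m₂ ε δ) := by
  rw [σ4321_of_mem_cube (m₂_subset_cube h0 h1 hδ hx), mem_polytope_m₂]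
  rw [mem_polytope_m₂] at hx
  obtain ⟨a1, a2, a3, a4, a5, a6⟩ := hx
  simp only [Matrix.cons_val]
  refine ⟨⟨?_, ?_⟩, ⟨?_, ?_⟩, ⟨?_, ?_⟩, ⟨?_, ?_⟩, ⟨?_, ?_⟩, ?_, ?_⟩ <;> linarith

lemma σ4321_mem_cube {x : Fin 3 → ℝ} (hx : x ∈ cube) : σ4321 x ∈ cube := by
  rw [σ4321_of_mem_cube hx, mem_cube]
  rw [mem_cube] at hx
  simp only [Matrix.cons_val]
  refine ⟨⟨?_, ?_⟩, ⟨?_, ?_⟩, ?_, ?_⟩ <;> linarith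

lemma σ4321_σ4321 {x : Fin 3 → ℝ} (hx : x ∈ cube) : σ4321 (σ4321 x) = x := by
  rw [σ4321_of_mem_cube (σ4321_mem_cube hx), σ4321_of_mem_cube hx]
  exact vec3_eq (by simp) (by simp) (by simp)

lemma σ4321_image_eq {P : Set (Fin 3 → ℝ)} (hc : P ⊆ cube) (h : ∀ x ∈ P, σ4321 x ∈ P) :
    σ4321 '' P = P := by
  apply Set.Subset.antisymm
  · rintro _ ⟨x, hx, rfl⟩
    exact h x hx
  · intro x hx
    exact ⟨σ4321 x, h x hx, σ4321_σ4321 (hc hx)⟩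

/-- The permutation of the atoms of the cube induced by `σ4321`. -/
lemma σ4321_mem_atom {a b c d e f : ℤ} {x : Fin 3 → ℝ} (hx : x ∈ atom ![a, b, c, d, e, f]) :
    σ4321 x ∈ atom ![1 - c, 1 - b, 1 - a, 2 - e, 2 - d, 3 - f] := by
  rw [mem_atom_vec] at *
  obtain ⟨hc, a1, a2, a3, a4, a5, a6⟩ := hx
  refine ⟨σ4321_mem_cube hc, ?_⟩
  rw [σ4321_of_mem_cube hc]
  simp only [Matrix.cons_val]
  push_cast
  refine ⟨⟨?_, ?_⟩, ⟨?_, ?_⟩, ⟨?_, ?_⟩, ⟨?_, ?_⟩, ⟨?_, ?_⟩, ?_, ?_⟩ <;> linarith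

lemma eq_of_mem_atom {x : Fin 3 → ℝ} {ω ω' : Fin 6 → ℤ} (hx : x ∈ atom ω) (hx' : x ∈ atom ω') :
    ω = ω' := by
  funext i
  obtain ⟨a, b⟩ := hx.2 i
  obtain ⟨c, d⟩ := hx'.2 i
  have h1 : (ω i : ℝ) < ω' i + 1 := by linarith
  have h2 : (ω' i : ℝ) < ω i + 1 := by linarith
  norm_cast at h1 h2
  omega

lemma mem_atom_000101_or (h0 : 0 ≤ ε) (h1 : ε < 1 / 2) (hδ : δ ∈ Δ ε) {x : Fin 3 → ℝ}
    (hx : x ∈ polytope canonical (m₁ ε δ)) (hx' : x 0 ≠ 1 / 2) :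
    x ∈ atom ![0, 0, 0, 1, 0, 1] ∨ x ∈ atom ![1, 0, 0, 1, 0, 1] := by
  have H := (mem_Δ_iff h1 δ).1 hδ
  have hs : 0 < 2 * (1 - ε) := by linarith
  obtain ⟨p1, p2⟩ := pstar_bounds h0 h1
  have k2 := mul_nonneg hs.le H.nonneg₃
  have k3 := mul_nonneg hs.le (H.nonneg₃.trans H.le₃₂)
  have k4 := mul_nonneg hs.le (H.nonneg₃.trans H.le₃₄)
  have hc := m₁_subset_cube h0 h1 hδ hx
  rw [mem_polytope_m₁] at hx
  obtain ⟨a1, a2, a3, a4, a5, a6⟩ := hx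
  rcases lt_or_gt_of_ne hx' with h | h
  · left
    rw [mem_atom_vec]
    refine ⟨hc, ?_⟩
    rw [mem_cube] at hc
    push_cast
    refine ⟨⟨?_, ?_⟩, ⟨?_, ?_⟩, ⟨?_, ?_⟩, ⟨?_, ?_⟩, ⟨?_, ?_⟩, ?_, ?_⟩ <;> linarith
  · right
    rw [mem_atom_vec]
    refine ⟨hc, ?_⟩
    rw [mem_cube] at hc
    push_cast
    refine ⟨⟨?_, ?_⟩, ⟨?_, ?_⟩, ⟨?_, ?_⟩, ⟨?_, ?_⟩, ⟨?_, ?_⟩, ?_, ?_⟩ <;> linarith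

lemma mem_atom_of_mem_m₂ (h0 : 0 ≤ ε) (h1 : ε < 1 / 2) (hδ : δ ∈ Δ ε) {x : Fin 3 → ℝ}
    (hx : x ∈ polytope canonical (m₂ ε δ)) (h2 : x 1 ≠ 1 / 2) (h4 : x 0 + x 1 ≠ 3 / 2)
    (h5 : x 1 + x 2 ≠ 1 / 2) (h6 : x 0 + x 1 + x 2 ≠ 3 / 2) :
    x ∈ atom ![1, 1, 0, 1, 1, 1] ∨ x ∈ atom ![1, 1, 0, 1, 1, 2] ∨
      x ∈ atom ![1, 1, 0, 2, 1, 2] ∨ x ∈ atom ![1, 0, 0, 1, 0, 1] ∨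
      x ∈ atom ![1, 0, 0, 1, 1, 1] ∨ x ∈ atom ![1, 0, 0, 1, 1, 2] := by
  have H := (mem_Δ_iff h1 δ).1 hδ
  obtain ⟨p1, p2⟩ := pstar_bounds h0 h1
  have k0 := H.nonneg₁
  have k1 := H.nonneg₃
  have k2 := H.le₃₂
  have k3 := H.le₃₄
  have k4 := H.le₂₅
  have hc := m₂_subset_cube h0 h1 hδ hx
  rw [mem_polytope_m₂] at hx
  obtain ⟨a1, a2, a3, a4, a5, a6⟩ := hx
  simp only [mem_atom_vec, hc, true_and]
  rw [mem_cube] at hc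
  push_cast
  rcases lt_or_gt_of_ne h2 with g2 | g2
  · rcases lt_or_gt_of_ne h5 with g5 | g5
    · right; right; right; left
      refine ⟨⟨?_, ?_⟩, ⟨?_, ?_⟩, ⟨?_, ?_⟩, ⟨?_, ?_⟩, ⟨?_, ?_⟩, ?_, ?_⟩ <;> linarith
    · rcases lt_or_gt_of_ne h6 with g6 | g6
      · right; right; right; right; left
        refine ⟨⟨?_, ?_⟩, ⟨?_, ?_⟩, ⟨?_, ?_⟩, ⟨?_, ?_⟩, ⟨?_, ?_⟩, ?_, ?_⟩ <;> linarith
      · right; right; right; right; right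
        refine ⟨⟨?_, ?_⟩, ⟨?_, ?_⟩, ⟨?_, ?_⟩, ⟨?_, ?_⟩, ⟨?_, ?_⟩, ?_, ?_⟩ <;> linarith
  · rcases lt_or_gt_of_ne h4 with g4 | g4
    · rcases lt_or_gt_of_ne h6 with g6 | g6
      · left
        refine ⟨⟨?_, ?_⟩, ⟨?_, ?_⟩, ⟨?_, ?_⟩, ⟨?_, ?_⟩, ⟨?_, ?_⟩, ?_, ?_⟩ <;> linarith
      · right; left
        refine ⟨⟨?_, ?_⟩, ⟨?_, ?_⟩, ⟨?_, ?_⟩, ⟨?_, ?_⟩, ⟨?_, ?_⟩, ?_, ?_⟩ <;> linarith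
    · right; right; left
      refine ⟨⟨?_, ?_⟩, ⟨?_, ?_⟩, ⟨?_, ?_⟩, ⟨?_, ?_⟩, ⟨?_, ?_⟩, ?_, ?_⟩ <;> linarith

lemma ne_half_of_mem_atom {u : ℝ} {n : ℤ} (h : (n : ℝ) - 1 / 2 < u ∧ u < n + 1 / 2) (k : ℤ) :
    u ≠ k + 1 / 2 := by
  rintro rfl
  have h3 : (n : ℝ) < k + 1 := by linarith
  have h4 : (k : ℝ) < n := by linarith
  norm_cast at h3 h4
  omega

lemma loc_m₁ (h0 : 0 ≤ ε) (h1 : ε < 1 / 2) (hδ : δ ∈ Δ ε) (ω : Fin 6 → ℤ) :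
    (polytope canonical (m₁ ε δ) ∩ atom ω).Nonempty ↔
      ω ∈ ({![0, 0, 0, 1, 0, 1], ![1, 0, 0, 1, 0, 1]} : Set (Fin 6 → ℤ)) := by
  simp only [Set.mem_insert_iff, Set.mem_singleton_iff]
  constructor
  · rintro ⟨x, hx, hω⟩
    have := ne_half_of_mem_atom ((mem_atom ω x).1 hω).2.1 0
    rcases mem_atom_000101_or h0 h1 hδ hx (by simpa using this) with h | h
    exacts [Or.inl (eq_of_mem_atom hω h), Or.inr (eq_of_mem_atom hω h)]
  · rintro (rfl | rfl)
    exacts [nonempty_m₁_inter_000101 h0 h1 hδ, nonempty_m₁_inter_100101 h0 h1 hδ]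

lemma mem_atom_of_mem_m₂_atom (h0 : 0 ≤ ε) (h1 : ε < 1 / 2) (hδ : δ ∈ Δ ε) {x : Fin 3 → ℝ}
    {ω : Fin 6 → ℤ} (hx : x ∈ polytope canonical (m₂ ε δ)) (hω : x ∈ atom ω) :
    x ∈ atom ![1, 1, 0, 1, 1, 1] ∨ x ∈ atom ![1, 1, 0, 1, 1, 2] ∨
      x ∈ atom ![1, 1, 0, 2, 1, 2] ∨ x ∈ atom ![1, 0, 0, 1, 0, 1] ∨
      x ∈ atom ![1, 0, 0, 1, 1, 1] ∨ x ∈ atom ![1, 0, 0, 1, 1, 2] := by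
  obtain ⟨-, -, g2, -, g4, g5, g6⟩ := (mem_atom ω x).1 hω
  have e2 := ne_half_of_mem_atom g2 0
  have e4 := ne_half_of_mem_atom g4 1
  have e5 := ne_half_of_mem_atom g5 0
  have e6 := ne_half_of_mem_atom g6 1
  norm_num at e2 e4 e5 e6
  exact mem_atom_of_mem_m₂ h0 h1 hδ hx (by norm_num; exact e2) (by norm_num; exact e4)
    (by norm_num; exact e5) (by norm_num; exact e6)

lemma loc_m₂ (h0 : 0 ≤ ε) (h1 : ε < 1 / 2) (hδ : δ ∈ Δ ε) (ω : Fin 6 → ℤ) :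
    (polytope canonical (m₂ ε δ) ∩ atom ω).Nonempty ↔
      ω ∈ ({![1, 1, 0, 1, 1, 1], ![1, 1, 0, 1, 1, 2], ![1, 1, 0, 2, 1, 2],
        ![1, 0, 0, 1, 0, 1], ![1, 0, 0, 1, 1, 1], ![1, 0, 0, 1, 1, 2]} : Set (Fin 6 → ℤ)) := by
  simp only [Set.mem_insert_iff, Set.mem_singleton_iff]
  constructor
  · rintro ⟨x, hx, hω⟩
    rcases mem_atom_of_mem_m₂_atom h0 h1 hδ hx hω with h | h | h | h | h | h <;>
      simp [eq_of_mem_atom hω h]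
  · rintro (rfl | rfl | rfl | rfl | rfl | rfl)
    · exact nonempty_m₂_inter_110111 h0 h1 hδ
    · exact nonempty_m₂_inter_110112 h0 h1 hδ
    · exact nonempty_m₂_inter_110212 h0 h1 hδ
    -- The last three atoms are the `σ4321`-images of the first three, in reverse order.
    · obtain ⟨x, hx, hxa⟩ := nonempty_m₂_inter_110212 h0 h1 hδ
      exact ⟨_, σ4321_mem_m₂ h0 h1 hδ hx, by simpa using σ4321_mem_atom hxa⟩
    · obtain ⟨x, hx, hxa⟩ := nonempty_m₂_inter_110112 h0 h1 hδ
      exact ⟨_, σ4321_mem_m₂ h0 h1 hδ hx, by simpa using σ4321_mem_atom hxa⟩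
    · obtain ⟨x, hx, hxa⟩ := nonempty_m₂_inter_110111 h0 h1 hδ
      exact ⟨_, σ4321_mem_m₂ h0 h1 hδ hx, by simpa using σ4321_mem_atom hxa⟩

lemma isBounded_cube : Bornology.IsBounded cube := by
  refine (Metric.isBounded_Icc (0 : Fin 3 → ℝ) 1).subset fun x hx => ?_
  exact ⟨fun i => (hx i).1.le, fun i => (hx i).2.le⟩

theorem conditioningProblem3_of_mem_Δ (h0 : 0 ≤ ε) (h1 : ε < 1 / 2) (hδ : δ ∈ Δ ε) :
    ConditioningProblem3 ε (polytope canonical (m₁ ε δ)) (polytope canonical (m₂ ε δ)) where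
  polytope₁ := ⟨(nonempty_m₁_inter_000101 h0 h1 hδ).mono Set.inter_subset_left,
    isBounded_cube.subset (m₁_subset_cube h0 h1 hδ), _, _, _, rfl⟩
  polytope₂ := ⟨(nonempty_m₂_inter_110111 h0 h1 hδ).mono Set.inter_subset_left,
    isBounded_cube.subset (m₂_subset_cube h0 h1 hδ), _, _, _, rfl⟩
  subset₁ := m₁_subset_cube h0 h1 hδ
  subset₂ := m₂_subset_cube h0 h1 hδ
  loc₁ := loc_m₁ h0 h1 hδ
  symm₂ := σ4321_image_eq (m₂_subset_cube h0 h1 hδ) fun _ hx => σ4321_mem_m₂ h0 h1 hδ hx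
  loc₂ := loc_m₂ h0 h1 hδ
  dyn_000101 := image_G_m₁_000101 h0 h1 hδ
  dyn_100101 := image_G_m₁_100101 h0 h1 hδ
  dyn_110111 := image_G_m₂_110111 h0 h1 hδ
  dyn_110112 := image_G_m₂_110112 h0 h1 hδ
  dyn_110212 := image_G_m₂_110212 h0 h1 hδ

end Sufficiency

end CoupledMap

/-! ### Equivariance of the map and the orbit as an AsIUP -/

namespace CoupledMap

/-- None of the six sums lies in `1/2 + ℤ`; `a, …, f` are the integers nearest to them. -/
def NearestInts (x : Fin 3 → ℝ) (a b c d e f : ℤ) : Prop :=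
  ((a : ℝ) - 1 / 2 < x 0 ∧ x 0 < (a : ℝ) + 1 / 2) ∧
  ((b : ℝ) - 1 / 2 < x 1 ∧ x 1 < (b : ℝ) + 1 / 2) ∧
  ((c : ℝ) - 1 / 2 < x 2 ∧ x 2 < (c : ℝ) + 1 / 2) ∧
  ((d : ℝ) - 1 / 2 < x 0 + x 1 ∧ x 0 + x 1 < (d : ℝ) + 1 / 2) ∧
  ((e : ℝ) - 1 / 2 < x 1 + x 2 ∧ x 1 + x 2 < (e : ℝ) + 1 / 2) ∧
  ((f : ℝ) - 1 / 2 < x 0 + x 1 + x 2 ∧ x 0 + x 1 + x 2 < (f : ℝ) + 1 / 2)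

/-- None of the six sums lies in `1/2 + ℤ`. -/
def Regular (x : Fin 3 → ℝ) : Prop := ∃ a b c d e f : ℤ, NearestInts x a b c d e f

lemma NearestInts.G_apply {ε : ℝ} {a b c d e f : ℤ} {x : Fin 3 → ℝ}
    (hx : NearestInts x a b c d e f) :
    G ε x = ![Int.fract (2 * (1 - ε) * x 0 + 2 * ε * ((2 * a - b + d - e + f) / 4)),
      Int.fract (2 * (1 - ε) * x 1 + 2 * ε * ((2 * b - a - c + d + e) / 4)),
      Int.fract (2 * (1 - ε) * x 2 + 2 * ε * ((2 * c - b - d + e + f) / 4))] := by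
  obtain ⟨h1, h2, h3, h4, h5, h6⟩ := hx
  have e1 := h_eq h1.1 h1.2
  have e2 := h_eq h2.1 h2.2
  have e3 := h_eq h3.1 h3.2
  have e4 := h_eq h4.1 h4.2
  have e5 := h_eq h5.1 h5.2
  have e6 := h_eq h6.1 h6.2
  funext i
  fin_cases i <;> simp [G, B₃, e1, e2, e3, e4, e5, e6]

lemma σ4231_eq_sub_floor (x : Fin 3 → ℝ) : σ4231 x =
    ![-x 1 - x 2 - ⌊-x 1 - x 2⌋, x 1 - ⌊x 1⌋, -x 0 - x 1 - ⌊-x 0 - x 1⌋] := rfl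

lemma σ1324_eq_sub_floor (x : Fin 3 → ℝ) : σ1324 x =
    ![x 0 + x 1 - ⌊x 0 + x 1⌋, -x 1 - ⌊-x 1⌋, x 1 + x 2 - ⌊x 1 + x 2⌋] := rfl

lemma Regular.of_atom {ω : Fin 6 → ℤ} {x : Fin 3 → ℝ} (hx : x ∈ atom ω) : Regular x :=
  ⟨_, _, _, _, _, _, ((mem_atom ω x).1 hx).2⟩

/-- The symmetry permutes the six sums up to sign and integer translation, both of which preserve
1/2 + ℤ. -/
lemma Regular.of_σ4231 {x : Fin 3 → ℝ} (hx : Regular (σ4231 x)) : Regular x := by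
  obtain ⟨a, b, c, d, e, f, h⟩ := hx
  rw [σ4231_eq_sub_floor] at h
  generalize ⌊-x 1 - x 2⌋ = k at h
  generalize ⌊x 1⌋ = l at h
  generalize ⌊-x 0 - x 1⌋ = m at h
  obtain ⟨h1, h2, h3, h4, h5, h6⟩ := h
  simp only [Matrix.cons_val] at h1 h2 h3 h4 h5 h6
  refine ⟨-e - l - m, b + l, -d - k - l, -c - m, -a - k, -f - k - l - m, ?_⟩
  simp only [NearestInts]
  push_cast
  refine ⟨⟨?_, ?_⟩, ⟨?_, ?_⟩, ⟨?_, ?_⟩, ⟨?_, ?_⟩, ⟨?_, ?_⟩, ?_, ?_⟩ <;> linarith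

lemma Regular.of_σ1324 {x : Fin 3 → ℝ} (hx : Regular (σ1324 x)) : Regular x := by
  obtain ⟨a, b, c, d, e, f, h⟩ := hx
  rw [σ1324_eq_sub_floor] at h
  generalize ⌊x 0 + x 1⌋ = k at h
  generalize ⌊-x 1⌋ = l at h
  generalize ⌊x 1 + x 2⌋ = m at h
  obtain ⟨h1, h2, h3, h4, h5, h6⟩ := h
  simp only [Matrix.cons_val] at h1 h2 h3 h4 h5 h6
  refine ⟨d + k + l, -b - l, e + l + m, a + k, c + m, f + k + l + m, ?_⟩
  simp only [NearestInts]
  push_cast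
  refine ⟨⟨?_, ?_⟩, ⟨?_, ?_⟩, ⟨?_, ?_⟩, ⟨?_, ?_⟩, ⟨?_, ?_⟩, ?_, ?_⟩ <;> linarith

/-- Away from half-integers the nearest integer is odd and commutes with integer translations, so
`B₃` transforms like x itself. Regularity is essential: the convention `h = 0` on 1/2 + ℤ is not
translation invariant. -/
lemma G_σ4231 (ε : ℝ) {x : Fin 3 → ℝ} (hx : Regular x) : G ε (σ4231 x) = σ4231 (G ε x) := by
  obtain ⟨a, b, c, d, e, f, h⟩ := hx
  rw [h.G_apply, σ4231_eq_sub_floor x]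
  generalize ⌊-x 1 - x 2⌋ = k
  generalize ⌊x 1⌋ = l
  generalize ⌊-x 0 - x 1⌋ = m
  have h' : NearestInts ![-x 1 - x 2 - k, x 1 - l, -x 0 - x 1 - m]
      (-e - k) (b - l) (-d - m) (-c - k - l) (-a - l - m) (-f - k - l - m) := by
    obtain ⟨h1, h2, h3, h4, h5, h6⟩ := h
    simp only [NearestInts, Matrix.cons_val]
    push_cast
    refine ⟨⟨?_, ?_⟩, ⟨?_, ?_⟩, ⟨?_, ?_⟩, ⟨?_, ?_⟩, ⟨?_, ?_⟩, ?_, ?_⟩ <;> linarith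
  rw [h'.G_apply]
  simp only [σ4231, Matrix.cons_val]
  refine vec3_eq ?_ ?_ ?_ <;> simp only [Matrix.cons_val]
  -- Translation by -k changes the linear part by -2(1 - ε)k and the `B₃` part by -2εk, in total the
  -- integer -2k; the floors undo the inner fractional parts on the other side.
  · refine Int.fract_eq_fract.2 ⟨-2 * k -
      ⌊2 * (1 - ε) * x 1 + 2 * ε * ((2 * b - a - c + d + e) / 4)⌋ -
      ⌊2 * (1 - ε) * x 2 + 2 * ε * ((2 * c - b - d + e + f) / 4)⌋, ?_⟩
    simp only [Int.fract]
    push_cast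
    ring
  · refine Int.fract_eq_fract.2 ⟨-2 * l +
      ⌊2 * (1 - ε) * x 1 + 2 * ε * ((2 * b - a - c + d + e) / 4)⌋, ?_⟩
    simp only [Int.fract]
    push_cast
    ring
  · refine Int.fract_eq_fract.2 ⟨-2 * m -
      ⌊2 * (1 - ε) * x 0 + 2 * ε * ((2 * a - b + d - e + f) / 4)⌋ -
      ⌊2 * (1 - ε) * x 1 + 2 * ε * ((2 * b - a - c + d + e) / 4)⌋, ?_⟩
    simp only [Int.fract]
    push_cast
    ring

lemma G_σ1324 (ε : ℝ) {x : Fin 3 → ℝ} (hx : Regular x) : G ε (σ1324 x) = σ1324 (G ε x) := by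
  obtain ⟨a, b, c, d, e, f, h⟩ := hx
  rw [h.G_apply, σ1324_eq_sub_floor x]
  generalize ⌊x 0 + x 1⌋ = k
  generalize ⌊-x 1⌋ = l
  generalize ⌊x 1 + x 2⌋ = m
  have h' : NearestInts ![x 0 + x 1 - k, -x 1 - l, x 1 + x 2 - m]
      (d - k) (-b - l) (e - m) (a - k - l) (c - l - m) (f - k - l - m) := by
    obtain ⟨h1, h2, h3, h4, h5, h6⟩ := h
    simp only [NearestInts, Matrix.cons_val]
    push_cast
    refine ⟨⟨?_, ?_⟩, ⟨?_, ?_⟩, ⟨?_, ?_⟩, ⟨?_, ?_⟩, ⟨?_, ?_⟩, ?_, ?_⟩ <;> linarith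
  rw [h'.G_apply]
  simp only [σ1324, Matrix.cons_val]
  refine vec3_eq ?_ ?_ ?_ <;> simp only [Matrix.cons_val]
  · refine Int.fract_eq_fract.2 ⟨-2 * k +
      ⌊2 * (1 - ε) * x 0 + 2 * ε * ((2 * a - b + d - e + f) / 4)⌋ +
      ⌊2 * (1 - ε) * x 1 + 2 * ε * ((2 * b - a - c + d + e) / 4)⌋, ?_⟩
    simp only [Int.fract]
    push_cast
    ring
  · refine Int.fract_eq_fract.2 ⟨-2 * l -
      ⌊2 * (1 - ε) * x 1 + 2 * ε * ((2 * b - a - c + d + e) / 4)⌋, ?_⟩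
    simp only [Int.fract]
    push_cast
    ring
  · refine Int.fract_eq_fract.2 ⟨-2 * m +
      ⌊2 * (1 - ε) * x 1 + 2 * ε * ((2 * b - a - c + d + e) / 4)⌋ +
      ⌊2 * (1 - ε) * x 2 + 2 * ε * ((2 * c - b - d + e + f) / 4)⌋, ?_⟩
    simp only [Int.fract]
    push_cast
    ring

lemma fract_apply_eq {x : Fin 3 → ℝ} (hx : ∀ i, 0 ≤ x i ∧ x i < 1) (i : Fin 3) :
    Int.fract (x i) = x i := Int.fract_eq_self.2 (hx i)

lemma σ1324_range (x : Fin 3 → ℝ) (i : Fin 3) : 0 ≤ σ1324 x i ∧ σ1324 x i < 1 := by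
  fin_cases i <;> exact ⟨Int.fract_nonneg _, Int.fract_lt_one _⟩

lemma σ4231_σ4231 {x : Fin 3 → ℝ} (hx : ∀ i, 0 ≤ x i ∧ x i < 1) : σ4231 (σ4231 x) = x := by
  rw [σ4231_eq_sub_floor x, σ4231]
  refine vec3_eq ?_ ?_ ?_ <;> simp only [Matrix.cons_val]
  · exact (Int.fract_eq_fract.2 ⟨⌊x 1⌋ + ⌊-x 0 - x 1⌋, by push_cast; ring⟩).trans
      (fract_apply_eq hx _)
  · exact (Int.fract_eq_fract.2 ⟨-⌊x 1⌋, by push_cast; ring⟩).trans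
      (fract_apply_eq hx _)
  · exact (Int.fract_eq_fract.2 ⟨⌊x 1⌋ + ⌊-x 1 - x 2⌋, by push_cast; ring⟩).trans
      (fract_apply_eq hx _)

lemma σ1324_σ1324 {x : Fin 3 → ℝ} (hx : ∀ i, 0 ≤ x i ∧ x i < 1) : σ1324 (σ1324 x) = x := by
  rw [σ1324_eq_sub_floor x, σ1324]
  refine vec3_eq ?_ ?_ ?_ <;> simp only [Matrix.cons_val]
  · exact (Int.fract_eq_fract.2 ⟨-⌊-x 1⌋ - ⌊x 0 + x 1⌋, by push_cast; ring⟩).trans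
      (fract_apply_eq hx _)
  · exact (Int.fract_eq_fract.2 ⟨⌊-x 1⌋, by ring⟩).trans
      (fract_apply_eq hx _)
  · exact (Int.fract_eq_fract.2 ⟨-⌊-x 1⌋ - ⌊x 1 + x 2⌋, by push_cast; ring⟩).trans
      (fract_apply_eq hx _)

lemma σ1324_σ4231 (x : Fin 3 → ℝ) : σ1324 (σ4231 x) = σ4231 (σ1324 x) := by
  rw [σ4231_eq_sub_floor x, σ1324_eq_sub_floor x, σ1324, σ4231]
  refine vec3_eq ?_ ?_ ?_ <;> simp only [Matrix.cons_val] <;> apply Int.fract_eq_fract.2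
  · exact ⟨-⌊-x 1 - x 2⌋ - ⌊x 1⌋ - ⌊-x 1⌋ - ⌊x 1 + x 2⌋, by push_cast; ring⟩
  · exact ⟨⌊x 1⌋ + ⌊-x 1⌋, by push_cast; ring⟩
  · exact ⟨-⌊-x 0 - x 1⌋ - ⌊x 1⌋ - ⌊-x 1⌋ - ⌊x 0 + x 1⌋, by push_cast; ring⟩

lemma range_of_cube {x : Fin 3 → ℝ} (hx : x ∈ cube) (i : Fin 3) : 0 ≤ x i ∧ x i < 1 :=
  ⟨(hx i).1.le, (hx i).2⟩

lemma mem_orb {P₁ P₂ : Set (Fin 3 → ℝ)} {x : Fin 3 → ℝ} :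
    x ∈ orb P₁ P₂ ↔ ∃ y, (y ∈ P₁ ∨ y ∈ P₂) ∧
      (x = y ∨ x = σ4231 y ∨ x = σ1324 y ∨ x = σ4231 (σ1324 y)) := by
  simp only [orb, Set.mem_union, Set.mem_image, σ4321, Function.comp]
  constructor
  · rintro ((((h | ⟨y, h, rfl⟩) | ⟨y, h, rfl⟩) | ⟨y, h, rfl⟩) |
      (((h | ⟨y, h, rfl⟩) | ⟨y, h, rfl⟩) | ⟨y, h, rfl⟩))
    · exact ⟨x, Or.inl h, Or.inl rfl⟩
    · exact ⟨y, Or.inl h, by simp⟩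
    · exact ⟨y, Or.inl h, by simp⟩
    · exact ⟨y, Or.inl h, by simp⟩
    · exact ⟨x, Or.inr h, Or.inl rfl⟩
    · exact ⟨y, Or.inr h, by simp⟩
    · exact ⟨y, Or.inr h, by simp⟩
    · exact ⟨y, Or.inr h, by simp⟩
  · rintro ⟨y, h | h, rfl | rfl | rfl | rfl⟩
    · exact Or.inl (Or.inl (Or.inl (Or.inl h)))
    · exact Or.inl (Or.inl (Or.inl (Or.inr ⟨y, h, rfl⟩)))
    · exact Or.inl (Or.inl (Or.inr ⟨y, h, rfl⟩))
    · exact Or.inl (Or.inr ⟨y, h, rfl⟩)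
    · exact Or.inr (Or.inl (Or.inl (Or.inl h)))
    · exact Or.inr (Or.inl (Or.inl (Or.inr ⟨y, h, rfl⟩)))
    · exact Or.inr (Or.inl (Or.inr ⟨y, h, rfl⟩))
    · exact Or.inr (Or.inr ⟨y, h, rfl⟩)

section Orbit

variable {P₁ P₂ : Set (Fin 3 → ℝ)}

lemma σ4231_mem_orb (h₁ : P₁ ⊆ cube) (h₂ : P₂ ⊆ cube) {x : Fin 3 → ℝ} (hx : x ∈ orb P₁ P₂) :
    σ4231 x ∈ orb P₁ P₂ := by
  rw [mem_orb] at *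
  obtain ⟨y, hy, e⟩ := hx
  have hy' := range_of_cube (hy.elim (fun h => h₁ h) fun h => h₂ h)
  refine ⟨y, hy, ?_⟩
  rcases e with rfl | rfl | rfl | rfl
  · simp
  · simp [σ4231_σ4231 hy']
  · simp
  · simp [σ4231_σ4231 (σ1324_range y)]

lemma σ1324_mem_orb (h₁ : P₁ ⊆ cube) (h₂ : P₂ ⊆ cube) {x : Fin 3 → ℝ} (hx : x ∈ orb P₁ P₂) :
    σ1324 x ∈ orb P₁ P₂ := by
  rw [mem_orb] at *
  obtain ⟨y, hy, e⟩ := hx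
  have hy' := range_of_cube (hy.elim (fun h => h₁ h) fun h => h₂ h)
  refine ⟨y, hy, ?_⟩
  rcases e with rfl | rfl | rfl | rfl
  · simp
  · simp [σ1324_σ4231]
  · simp [σ1324_σ1324 hy']
  · simp [σ1324_σ4231, σ1324_σ1324 hy']

/-- Invariance of an orbit set follows from the dynamics of its generators, by symmetry. -/
lemma G_mem_orb {ε : ℝ} (h₁ : P₁ ⊆ cube) (h₂ : P₂ ⊆ cube)
    (hG : ∀ y, y ∈ P₁ ∨ y ∈ P₂ → Regular y → G ε y ∈ orb P₁ P₂) {x : Fin 3 → ℝ}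
    (hx : x ∈ orb P₁ P₂) (hr : Regular x) : G ε x ∈ orb P₁ P₂ := by
  obtain ⟨y, hy, rfl | rfl | rfl | rfl⟩ := mem_orb.1 hx
  · exact hG _ hy hr
  · rw [G_σ4231 ε hr.of_σ4231]
    exact σ4231_mem_orb h₁ h₂ (hG y hy hr.of_σ4231)
  · rw [G_σ1324 ε hr.of_σ1324]
    exact σ1324_mem_orb h₁ h₂ (hG y hy hr.of_σ1324)
  · rw [G_σ4231 ε hr.of_σ4231, G_σ1324 ε hr.of_σ4231.of_σ1324]
    exact σ4231_mem_orb h₁ h₂ (σ1324_mem_orb h₁ h₂ (hG y hy hr.of_σ4231.of_σ1324))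

end Orbit

/-- The image of an open polytope under a map that is affine and invertible on it. -/
lemma IsOpenPolytope.image {P : Set (Fin 3 → ℝ)} (hP : IsOpenPolytope P)
    {T f g : (Fin 3 → ℝ) → (Fin 3 → ℝ)} {N : Matrix (Fin 3) (Fin 3) ℝ} {c : Fin 3 → ℝ}
    (hT : ∀ y ∈ P, T y = f y) (hgf : ∀ y, g (f y) = y) (hfg : ∀ x, f (g x) = x)
    (hg : ∀ x, g x = N.mulVec x + c) (hsub : T '' P ⊆ cube) : IsOpenPolytope (T '' P) := by
  obtain ⟨hne, -, e, α, m, rfl⟩ := hP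
  refine ⟨hne.image T, isBounded_cube.subset hsub, e, α * N, fun i j => m i j - α.mulVec c i, ?_⟩
  have key : ∀ x, x ∈ polytope (α * N) (fun i j => m i j - α.mulVec c i) ↔ g x ∈ polytope α m := by
    intro x
    simp only [polytope, Set.mem_ofPred_eq, hg, Matrix.mulVec_add, Matrix.mulVec_mulVec,
      Pi.add_apply, sub_lt_iff_lt_add, lt_sub_iff_add_lt]
  ext x
  rw [key]
  constructor
  · rintro ⟨y, hy, rfl⟩
    rwa [hT y hy, hgf]
  · intro hx
    exact ⟨g x, hx, by rw [hT _ hx, hfg]⟩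

/-- The hypotheses keep all integer parts constant on P, so the symmetry acts there as one affine
bijection with explicit inverse. -/
lemma isOpenPolytope_image_σ4231 {P : Set (Fin 3 → ℝ)} (hP : IsOpenPolytope P) (k : ℤ)
    (h : ∀ y ∈ P, (0 < y 1 ∧ y 1 < 1) ∧ (0 < y 1 + y 2 ∧ y 1 + y 2 < 1) ∧
      (k < y 0 + y 1 ∧ y 0 + y 1 < k + 1)) :
    IsOpenPolytope (σ4231 '' P) ∧ σ4231 '' P ⊆ cube := by
  have hT : ∀ y ∈ P, σ4231 y = ![1 - y 1 - y 2, y 1, k + 1 - y 0 - y 1] := fun y hy => by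
    obtain ⟨a, b, c⟩ := h y hy
    exact σ4231_eq k a.1.le a.2 b.1 b.2.le c.1 c.2.le
  have hsub : σ4231 '' P ⊆ cube := by
    rintro _ ⟨y, hy, rfl⟩
    obtain ⟨a, b, c⟩ := h y hy
    rw [hT y hy, mem_cube]
    simp only [Matrix.cons_val]
    refine ⟨⟨?_, ?_⟩, ⟨?_, ?_⟩, ?_, ?_⟩ <;> linarith
  refine ⟨hP.image (f := fun y => ![1 - y 1 - y 2, y 1, k + 1 - y 0 - y 1])
    (g := fun x => ![k + 1 - x 1 - x 2, x 1, 1 - x 0 - x 1])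
    (N := !![0, -1, -1; 0, 1, 0; -1, -1, 0]) (c := ![k + 1, 0, 1]) hT ?_ ?_ ?_ hsub, hsub⟩
  · intro y
    refine vec3_eq ?_ ?_ ?_ <;> simp only [Matrix.cons_val] <;> ring
  · intro y
    refine vec3_eq ?_ ?_ ?_ <;> simp only [Matrix.cons_val] <;> ring
  · intro x
    refine vec3_eq ?_ ?_ ?_ <;>
      simp [dotProduct, Fin.sum_univ_three] <;> ring

lemma isOpenPolytope_image_σ1324 {P : Set (Fin 3 → ℝ)} (hP : IsOpenPolytope P) (k : ℤ)
    (h : ∀ y ∈ P, (0 < y 1 ∧ y 1 < 1) ∧ (0 < y 1 + y 2 ∧ y 1 + y 2 < 1) ∧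
      (k < y 0 + y 1 ∧ y 0 + y 1 < k + 1)) :
    IsOpenPolytope (σ1324 '' P) ∧ σ1324 '' P ⊆ cube := by
  have hT : ∀ y ∈ P, σ1324 y = ![y 0 + y 1 - k, 1 - y 1, y 1 + y 2] := fun y hy => by
    obtain ⟨a, b, c⟩ := h y hy
    exact σ1324_eq k a.1 a.2.le b.1.le b.2 c.1.le c.2
  have hsub : σ1324 '' P ⊆ cube := by
    rintro _ ⟨y, hy, rfl⟩
    obtain ⟨a, b, c⟩ := h y hy
    rw [hT y hy, mem_cube]
    simp only [Matrix.cons_val]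
    refine ⟨⟨?_, ?_⟩, ⟨?_, ?_⟩, ?_, ?_⟩ <;> linarith
  refine ⟨hP.image (f := fun y => ![y 0 + y 1 - k, 1 - y 1, y 1 + y 2])
    (g := fun x => ![x 0 + x 1 + k - 1, 1 - x 1, x 1 + x 2 - 1])
    (N := !![1, 1, 0; 0, -1, 0; 0, 1, 1]) (c := ![k - 1, 1, -1]) hT ?_ ?_ ?_ hsub, hsub⟩
  · intro y
    refine vec3_eq ?_ ?_ ?_ <;> simp only [Matrix.cons_val] <;> ring
  · intro y
    refine vec3_eq ?_ ?_ ?_ <;> simp only [Matrix.cons_val] <;> ring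
  · intro x
    refine vec3_eq ?_ ?_ ?_ <;>
      simp [dotProduct, Fin.sum_univ_three] <;> ring

lemma isOpenPolytope_image_σ4321 {P : Set (Fin 3 → ℝ)} (hP : IsOpenPolytope P) (hc : P ⊆ cube) :
    IsOpenPolytope (σ4321 '' P) ∧ σ4321 '' P ⊆ cube := by
  have hsub : σ4321 '' P ⊆ cube := by
    rintro _ ⟨y, hy, rfl⟩
    exact σ4321_mem_cube (hc hy)
  refine ⟨hP.image (f := fun y => ![1 - y 2, 1 - y 1, 1 - y 0])
    (g := fun y => ![1 - y 2, 1 - y 1, 1 - y 0])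
    (N := !![0, 0, -1; 0, -1, 0; -1, 0, 0]) (c := ![1, 1, 1])
    (fun y hy => σ4321_of_mem_cube (hc hy)) ?_ ?_ ?_ hsub, hsub⟩
  · intro y
    refine vec3_eq ?_ ?_ ?_ <;> simp
  · intro y
    refine vec3_eq ?_ ?_ ?_ <;> simp
  · intro x
    refine vec3_eq ?_ ?_ ?_ <;>
      simp [dotProduct, Fin.sum_univ_three] <;> ring

section Sufficiency

variable {ε : ℝ} {δ : Fin 5 → ℝ}

lemma G_mem_orb_of_mem (h0 : 0 ≤ ε) (h1 : ε < 1 / 2) (hδ : δ ∈ Δ ε) {y : Fin 3 → ℝ}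
    (hy : y ∈ polytope canonical (m₁ ε δ) ∨ y ∈ polytope canonical (m₂ ε δ)) (hr : Regular y) :
    G ε y ∈ orb (polytope canonical (m₁ ε δ)) (polytope canonical (m₂ ε δ)) := by
  have hC := conditioningProblem3_of_mem_Δ h0 h1 hδ
  set P₁ := polytope canonical (m₁ ε δ)
  set P₂ := polytope canonical (m₂ ε δ)
  have hgood : ∀ z ∈ P₂, z ∈ atom ![1, 1, 0, 1, 1, 1] ∨ z ∈ atom ![1, 1, 0, 1, 1, 2] ∨
      z ∈ atom ![1, 1, 0, 2, 1, 2] → G ε z ∈ orb P₁ P₂ := by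
    rintro z hz (h | h | h)
    · exact mem_orb.2 ⟨_, Or.inl (hC.dyn_110111 ▸ Set.mem_image_of_mem _ ⟨hz, h⟩), Or.inl rfl⟩
    · obtain ⟨w, hw, e⟩ := hC.dyn_110112 (Set.mem_image_of_mem _ ⟨hz, h⟩)
      exact mem_orb.2 ⟨w, Or.inl hw, Or.inr (Or.inl e.symm)⟩
    · exact mem_orb.2 ⟨_, Or.inr (hC.dyn_110212 (Set.mem_image_of_mem _ ⟨hz, h⟩)), Or.inl rfl⟩
  -- No dynamical condition is imposed on these three atoms. Reflecting by `σ4321` leads to the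
  -- constrained ones, and equivariance brings the image back.
  have hbad : ∀ z ∈ P₂, σ4321 z ∈ atom ![1, 1, 0, 1, 1, 1] ∨ σ4321 z ∈ atom ![1, 1, 0, 1, 1, 2] ∨
      σ4321 z ∈ atom ![1, 1, 0, 2, 1, 2] → G ε z ∈ orb P₁ P₂ := by
    intro z hz h
    have hz' := σ4321_mem_m₂ h0 h1 hδ hz
    have hr' : Regular (σ4321 z) := by
      rcases h with h | h | h <;> exact Regular.of_atom h
    have hc := hC.subset₂ hz'
    have e := congrArg (G ε) (σ4321_σ4321 (hC.subset₂ hz))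
    have hr2 : Regular (σ1324 (σ4321 z)) := by
      apply Regular.of_σ1324
      rwa [σ1324_σ1324 (range_of_cube hc)]
    rw [← e, σ4321, Function.comp, ← σ4321, G_σ4231 ε hr2, G_σ1324 ε hr']
    exact σ4231_mem_orb hC.subset₁ hC.subset₂
      (σ1324_mem_orb hC.subset₁ hC.subset₂ (hgood _ hz' h))
  obtain ⟨a, b, c, d, e, f, hn⟩ := hr
  rcases hy with hy | hy
  · have ha : y ∈ atom ![a, b, c, d, e, f] := (mem_atom_vec ..).2 ⟨hC.subset₁ hy, hn⟩
    have := (hC.loc₁ _).1 ⟨y, hy, ha⟩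
    rcases this with h | h <;> rw [h] at ha
    · exact mem_orb.2 ⟨_, Or.inr (hC.dyn_000101 (Set.mem_image_of_mem _ ⟨hy, ha⟩)), Or.inl rfl⟩
    · exact mem_orb.2 ⟨_, Or.inl (hC.dyn_100101 (Set.mem_image_of_mem _ ⟨hy, ha⟩)), Or.inl rfl⟩
  · have ha : y ∈ atom ![a, b, c, d, e, f] := (mem_atom_vec ..).2 ⟨hC.subset₂ hy, hn⟩
    rcases mem_atom_of_mem_m₂_atom h0 h1 hδ hy ha with h | h | h | h | h | h
    · exact hgood y hy (Or.inl h)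
    · exact hgood y hy (Or.inr (Or.inl h))
    · exact hgood y hy (Or.inr (Or.inr h))
    · exact hbad y hy (Or.inr (Or.inr (by simpa using σ4321_mem_atom h)))
    · exact hbad y hy (Or.inr (Or.inl (by simpa using σ4321_mem_atom h)))
    · exact hbad y hy (Or.inl (by simpa using σ4321_mem_atom h))

/-- Bounds of `P₁` that do not depend on `δ`. -/
def Coarse₁ (ε p : ℝ) (x : Fin 3 → ℝ) : Prop :=
  (1 - 2 * p < x 0 ∧ x 0 < 1 - ε) ∧ (ε / 2 < x 1 ∧ x 1 < p) ∧ (0 < x 2 ∧ x 2 < p - ε / 2) ∧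
  (1 - p < x 0 + x 1 ∧ x 0 + x 1 < 1 - ε / 2) ∧ (ε / 2 < x 1 + x 2 ∧ x 1 + x 2 < p) ∧
  (1 - p < x 0 + x 1 + x 2 ∧ x 0 + x 1 + x 2 < 1 - ε / 2)

/-- Bounds of `P₂` that do not depend on `δ`. -/
def Coarse₂ (p : ℝ) (x : Fin 3 → ℝ) : Prop :=
  (2 * p < x 0 ∧ x 0 < 1) ∧ (p < x 1 ∧ x 1 < 1 - p) ∧ (0 < x 2 ∧ x 2 < 1 - 2 * p) ∧
  (1 + p < x 0 + x 1 ∧ x 0 + x 1 < 2 - p) ∧ (p < x 1 + x 2 ∧ x 1 + x 2 < 1 - p) ∧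
  (1 + p < x 0 + x 1 + x 2 ∧ x 0 + x 1 + x 2 < 2 - p)

lemma coarse₁_of_mem (h1 : ε < 1 / 2) (hδ : δ ∈ Δ ε) {x : Fin 3 → ℝ}
    (hx : x ∈ polytope canonical (m₁ ε δ)) : Coarse₁ ε (pstar ε) x := by
  have H := (mem_Δ_iff h1 δ).1 hδ
  have hs : 0 < 2 * (1 - ε) := by linarith
  have k1 := mul_nonneg hs.le H.nonneg₁
  have k2 := mul_nonneg hs.le H.nonneg₃
  have k3 := mul_nonneg hs.le (H.nonneg₃.trans H.le₃₂)
  have k4 := mul_nonneg hs.le (H.nonneg₃.trans H.le₃₄)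
  rw [mem_polytope_m₁] at hx
  obtain ⟨a1, a2, a3, a4, a5, a6⟩ := hx
  refine ⟨⟨?_, ?_⟩, ⟨?_, ?_⟩, ⟨?_, ?_⟩, ⟨?_, ?_⟩, ⟨?_, ?_⟩, ?_, ?_⟩ <;> linarith

lemma coarse₂_of_mem (h1 : ε < 1 / 2) (hδ : δ ∈ Δ ε) {x : Fin 3 → ℝ}
    (hx : x ∈ polytope canonical (m₂ ε δ)) : Coarse₂ (pstar ε) x := by
  have H := (mem_Δ_iff h1 δ).1 hδ
  have k1 := H.nonneg₁
  have k2 := H.nonneg₃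
  have k3 := H.le₃₂
  have k4 := H.le₃₄
  have k5 := H.le₂₅
  rw [mem_polytope_m₂] at hx
  obtain ⟨a1, a2, a3, a4, a5, a6⟩ := hx
  refine ⟨⟨?_, ?_⟩, ⟨?_, ?_⟩, ⟨?_, ?_⟩, ⟨?_, ?_⟩, ⟨?_, ?_⟩, ?_, ?_⟩ <;> linarith

/-- The points of the orbit set in coordinates. -/
lemma exists_of_mem_orb (h0 : 0 ≤ ε) (h1 : ε < 1 / 2) (hδ : δ ∈ Δ ε) {x : Fin 3 → ℝ}
    (hx : x ∈ orb (polytope canonical (m₁ ε δ)) (polytope canonical (m₂ ε δ))) :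
    ∃ y, (Coarse₁ ε (pstar ε) y ∧
        (x = y ∨ x = ![1 - y 1 - y 2, y 1, 1 - y 0 - y 1] ∨ x = ![y 0 + y 1, 1 - y 1, y 1 + y 2] ∨
          x = ![1 - y 2, 1 - y 1, 1 - y 0])) ∨
      (Coarse₂ (pstar ε) y ∧
        (x = y ∨ x = ![1 - y 1 - y 2, y 1, 2 - y 0 - y 1] ∨
          x = ![y 0 + y 1 - 1, 1 - y 1, y 1 + y 2] ∨ x = ![1 - y 2, 1 - y 1, 1 - y 0])) := by
  obtain ⟨p1, p2⟩ := pstar_bounds h0 h1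
  obtain ⟨y, hy, e⟩ := mem_orb.1 hx
  refine ⟨y, ?_⟩
  rcases hy with hy | hy
  · have hc := σ4321_of_mem_cube (m₁_subset_cube h0 h1 hδ hy)
    have h := coarse₁_of_mem h1 hδ hy
    refine Or.inl ⟨h, ?_⟩
    obtain ⟨a1, a2, a3, a4, a5, a6⟩ := h
    rw [σ4321, Function.comp] at hc
    rw [hc, σ4231_eq 0, σ1324_eq 0] at e
    · simpa using e
    all_goals push_cast; linarith
  · have hc := σ4321_of_mem_cube (m₂_subset_cube h0 h1 hδ hy)
    have h := coarse₂_of_mem h1 hδ hy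
    refine Or.inr ⟨h, ?_⟩
    obtain ⟨a1, a2, a3, a4, a5, a6⟩ := h
    rw [σ4321, Function.comp] at hc
    rw [hc, σ4231_eq 1, σ1324_eq 1] at e
    · norm_num at e
      exact e
    all_goals push_cast; linarith

/-- A point and its inversion both come from P₁ or P₂ by one of four affine maps. Each of the 64
combinations is linearly infeasible, already with the bounds independent of δ. -/
lemma inversion_notMem (h0 : 0 ≤ ε) (h1 : ε < 1 / 2) (hδ : δ ∈ Δ ε) {x : Fin 3 → ℝ}
    (hx : x ∈ orb (polytope canonical (m₁ ε δ)) (polytope canonical (m₂ ε δ))) :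
    inversion x ∉ orb (polytope canonical (m₁ ε δ)) (polytope canonical (m₂ ε δ)) := by
  intro hx'
  have H := (mem_Δ_iff h1 δ).1 hδ
  have hs : 0 < 2 * (1 - ε) := by linarith
  have hp := pstar_mul h1
  obtain ⟨p1, p2⟩ := pstar_bounds h0 h1
  have k := H.le₂
  have k3 := mul_nonneg hs.le (H.nonneg₃.trans H.le₃₂)
  -- Admissibility forces (1 - ε)² ≤ p* ≤ 3/8.
  have hε : 3 / 8 < ε := by nlinarith
  have p3 : 1 / 3 < pstar ε := by nlinarith
  obtain ⟨y, hy⟩ := exists_of_mem_orb h0 h1 hδ hx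
  obtain ⟨z, hz⟩ := exists_of_mem_orb h0 h1 hδ hx'
  clear hx hx' H k k3 hp hδ p1 hs h0
  generalize pstar ε = p at *
  have e0 : inversion x 0 = 1 - x 0 := rfl
  have e1 : inversion x 1 = 1 - x 1 := rfl
  have e2 : inversion x 2 = 1 - x 2 := rfl
  generalize inversion x = x' at *
  rcases hy with ⟨⟨⟨a1, a2⟩, ⟨a3, a4⟩, ⟨a5, a6⟩, ⟨a7, a8⟩, ⟨a9, a10⟩, a11, a12⟩,
      rfl | rfl | rfl | rfl⟩ |
    ⟨⟨⟨a1, a2⟩, ⟨a3, a4⟩, ⟨a5, a6⟩, ⟨a7, a8⟩, ⟨a9, a10⟩, a11, a12⟩, rfl | rfl | rfl | rfl⟩ <;>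
  rcases hz with ⟨⟨⟨b1, b2⟩, ⟨b3, b4⟩, ⟨b5, b6⟩, ⟨b7, b8⟩, ⟨b9, b10⟩, b11, b12⟩,
      rfl | rfl | rfl | rfl⟩ |
    ⟨⟨⟨b1, b2⟩, ⟨b3, b4⟩, ⟨b5, b6⟩, ⟨b7, b8⟩, ⟨b9, b10⟩, b11, b12⟩, rfl | rfl | rfl | rfl⟩ <;>
  (try simp only [Matrix.cons_val] at e0 e1 e2) <;> linarith

theorem isAsIUP_orb (h0 : 0 ≤ ε) (h1 : ε < 1 / 2) (hδ : δ ∈ Δ ε) :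
    IsAsIUP ε (orb (polytope canonical (m₁ ε δ)) (polytope canonical (m₂ ε δ))) := by
  have hC := conditioningProblem3_of_mem_Δ h0 h1 hδ
  obtain ⟨p1, p2⟩ := pstar_bounds h0 h1
  have r₁ : ∀ y ∈ polytope canonical (m₁ ε δ), (0 < y 1 ∧ y 1 < 1) ∧
      (0 < y 1 + y 2 ∧ y 1 + y 2 < 1) ∧ (((0 : ℤ) : ℝ) < y 0 + y 1 ∧ y 0 + y 1 < (0 : ℤ) + 1) := by
    intro y hy
    obtain ⟨a1, a2, a3, a4, a5, a6⟩ := coarse₁_of_mem h1 hδ hy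
    push_cast
    refine ⟨⟨?_, ?_⟩, ⟨?_, ?_⟩, ?_, ?_⟩ <;> linarith
  have r₂ : ∀ y ∈ polytope canonical (m₂ ε δ), (0 < y 1 ∧ y 1 < 1) ∧
      (0 < y 1 + y 2 ∧ y 1 + y 2 < 1) ∧ (((1 : ℤ) : ℝ) < y 0 + y 1 ∧ y 0 + y 1 < (1 : ℤ) + 1) := by
    intro y hy
    obtain ⟨a1, a2, a3, a4, a5, a6⟩ := coarse₂_of_mem h1 hδ hy
    push_cast
    refine ⟨⟨?_, ?_⟩, ⟨?_, ?_⟩, ?_, ?_⟩ <;> linarith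
  refine ⟨⟨?_, ?_, ?_⟩, ?_⟩
  · obtain ⟨y, hy⟩ := hC.polytope₁.1
    exact ⟨y, mem_orb.2 ⟨y, Or.inl hy, Or.inl rfl⟩⟩
  · refine ⟨8, ![polytope canonical (m₁ ε δ), σ4231 '' polytope canonical (m₁ ε δ),
      σ1324 '' polytope canonical (m₁ ε δ), σ4321 '' polytope canonical (m₁ ε δ),
      polytope canonical (m₂ ε δ), σ4231 '' polytope canonical (m₂ ε δ),
      σ1324 '' polytope canonical (m₂ ε δ), σ4321 '' polytope canonical (m₂ ε δ)], ?_, ?_⟩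
    · intro k
      fin_cases k
      · exact ⟨hC.polytope₁, hC.subset₁⟩
      · exact isOpenPolytope_image_σ4231 hC.polytope₁ 0 r₁
      · exact isOpenPolytope_image_σ1324 hC.polytope₁ 0 r₁
      · exact isOpenPolytope_image_σ4321 hC.polytope₁ hC.subset₁
      · exact ⟨hC.polytope₂, hC.subset₂⟩
      · exact isOpenPolytope_image_σ4231 hC.polytope₂ 1 r₂
      · exact isOpenPolytope_image_σ1324 hC.polytope₂ 1 r₂
      · exact isOpenPolytope_image_σ4321 hC.polytope₂ hC.subset₂
    · ext x
      simp only [orb, Set.mem_iUnion, Fin.exists_fin_succ, Set.mem_union]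
      simp [or_assoc]
  · rintro ω _ ⟨x, ⟨hx, hω⟩, rfl⟩
    exact G_mem_orb hC.subset₁ hC.subset₂ (fun y hy hr => G_mem_orb_of_mem h0 h1 hδ hy hr) hx
      (Regular.of_atom hω)
  · rw [Set.eq_empty_iff_forall_notMem]
    rintro _ ⟨⟨x, hx, rfl⟩, hx'⟩
    exact inversion_notMem h0 h1 hδ hx hx'

end Sufficiency

end CoupledMap

/-! ### Difference constraints and shortest paths -/

namespace CoupledMap

/-- Strict bounds on the differences of four reals. -/
def DiffBounds (ab ac ad ba bc bd ca cb cd da db dc a b c d : ℝ) : Prop :=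
  (a - b < ab ∧ a - c < ac ∧ a - d < ad) ∧ (b - a < ba ∧ b - c < bc ∧ b - d < bd) ∧
  (c - a < ca ∧ c - b < cb ∧ c - d < cd) ∧ (d - a < da ∧ d - b < db ∧ d - c < dc)

/-- This replaces a limit θ → 0. If K > 0, the weight K / (2(K - L)) gives the value K/2 > 0, a
contradiction. -/
lemma le_of_forall_convex {K L : ℝ} (hL : L ≤ 0)
    (h : ∀ θ : ℝ, 0 < θ → θ ≤ 1 → (1 - θ) * K + θ * L ≤ 0) : K ≤ 0 := by
  by_contra! hK
  have hKL : 0 < 2 * (K - L) := by linarith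
  have h2 := h (K / (2 * (K - L))) (div_pos hK hKL) ((div_le_one hKL).2 (by linarith))
  have e : K / (2 * (K - L)) * (2 * (K - L)) = K := div_mul_cancel₀ _ hKL.ne'
  linarith

/-- Farkas' lemma for difference bounds: an upper bound of `a - b` on a non-empty system of
difference bounds is the length of a simple path from `a` to `b`. -/
lemma exists_path_le {s t ab ac ad ba bc bd ca cb cd da db dc a₀ b₀ c₀ d₀ : ℝ}
    (hne : DiffBounds ab ac ad ba bc bd ca cb cd da db dc a₀ b₀ c₀ d₀)
    (h : ∀ a b c d, DiffBounds ab ac ad ba bc bd ca cb cd da db dc a b c d → s * (a - b) ≤ t) :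
    s * ab ≤ t ∨ s * (ac + cb) ≤ t ∨ s * (ad + db) ≤ t ∨ s * (ac + cd + db) ≤ t ∨
      s * (ad + dc + cb) ≤ t := by
  have h0 := h _ _ _ _ hne
  obtain ⟨⟨q1, q2, q3⟩, ⟨q4, q5, q6⟩, ⟨q7, q8, q9⟩, q10, q11, q12⟩ := hne
  -- `A`, `C`, `D` are the shortest-path lengths to b from a, c, d. With the value 0 at b they form
  -- a solution of the non-strict system at which a - b is maximal.
  obtain ⟨A, hA, A1, A2, A3, A4, A5⟩ : ∃ A, (A = ab ∨ A = ac + cb ∨ A = ad + db ∨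
      A = ac + cd + db ∨ A = ad + dc + cb) ∧ A ≤ ab ∧ A ≤ ac + cb ∧ A ≤ ad + db ∧
      A ≤ ac + cd + db ∧ A ≤ ad + dc + cb := by
    refine ⟨min ab (min (ac + cb) (min (ad + db) (min (ac + cd + db) (ad + dc + cb)))), ?_, ?_⟩
    · rcases min_choice ab (min (ac + cb) (min (ad + db) (min (ac + cd + db) (ad + dc + cb))))
        with e | e <;> rw [e] <;> [simp; skip]
      rcases min_choice (ac + cb) (min (ad + db) (min (ac + cd + db) (ad + dc + cb)))
        with e | e <;> rw [e] <;> [simp; skip]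
      rcases min_choice (ad + db) (min (ac + cd + db) (ad + dc + cb))
        with e | e <;> rw [e] <;> [simp; skip]
      rcases min_choice (ac + cd + db) (ad + dc + cb) with e | e <;> rw [e] <;> simp
    · simp
  obtain ⟨C, hC, C1, C2, C3, C4, C5⟩ : ∃ C, (C = cb ∨ C = ca + ab ∨ C = cd + db ∨
      C = ca + ad + db ∨ C = cd + da + ab) ∧ C ≤ cb ∧ C ≤ ca + ab ∧ C ≤ cd + db ∧
      C ≤ ca + ad + db ∧ C ≤ cd + da + ab := by
    refine ⟨min cb (min (ca + ab) (min (cd + db) (min (ca + ad + db) (cd + da + ab)))), ?_, ?_⟩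
    · rcases min_choice cb (min (ca + ab) (min (cd + db) (min (ca + ad + db) (cd + da + ab))))
        with e | e <;> rw [e] <;> [simp; skip]
      rcases min_choice (ca + ab) (min (cd + db) (min (ca + ad + db) (cd + da + ab)))
        with e | e <;> rw [e] <;> [simp; skip]
      rcases min_choice (cd + db) (min (ca + ad + db) (cd + da + ab))
        with e | e <;> rw [e] <;> [simp; skip]
      rcases min_choice (ca + ad + db) (cd + da + ab) with e | e <;> rw [e] <;> simp
    · simp
  obtain ⟨D, hD, D1, D2, D3, D4, D5⟩ : ∃ D, (D = db ∨ D = da + ab ∨ D = dc + cb ∨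
      D = da + ac + cb ∨ D = dc + ca + ab) ∧ D ≤ db ∧ D ≤ da + ab ∧ D ≤ dc + cb ∧
      D ≤ da + ac + cb ∧ D ≤ dc + ca + ab := by
    refine ⟨min db (min (da + ab) (min (dc + cb) (min (da + ac + cb) (dc + ca + ab)))), ?_, ?_⟩
    · rcases min_choice db (min (da + ab) (min (dc + cb) (min (da + ac + cb) (dc + ca + ab))))
        with e | e <;> rw [e] <;> [simp; skip]
      rcases min_choice (da + ab) (min (dc + cb) (min (da + ac + cb) (dc + ca + ab)))
        with e | e <;> rw [e] <;> [simp; skip]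
      rcases min_choice (dc + cb) (min (da + ac + cb) (dc + ca + ab))
        with e | e <;> rw [e] <;> [simp; skip]
      rcases min_choice (da + ac + cb) (dc + ca + ab) with e | e <;> rw [e] <;> simp
    · simp
  -- The remaining constraints for these potentials. Paths that would repeat a node can be
  -- shortened, since a solution of the strict system makes every cycle positive.
  have w2 : A - C ≤ ac := by rcases hC with e | e | e | e | e <;> rw [e] <;> linarith
  have w3 : A - D ≤ ad := by rcases hD with e | e | e | e | e <;> rw [e] <;> linarith
  have w4 : 0 - A ≤ ba := by rcases hA with e | e | e | e | e <;> rw [e] <;> linarith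
  have w5 : 0 - C ≤ bc := by rcases hC with e | e | e | e | e <;> rw [e] <;> linarith
  have w6 : 0 - D ≤ bd := by rcases hD with e | e | e | e | e <;> rw [e] <;> linarith
  have w7 : C - A ≤ ca := by rcases hA with e | e | e | e | e <;> rw [e] <;> linarith
  have w9 : C - D ≤ cd := by rcases hD with e | e | e | e | e <;> rw [e] <;> linarith
  have w10 : D - A ≤ da := by rcases hA with e | e | e | e | e <;> rw [e] <;> linarith
  have w12 : D - C ≤ dc := by rcases hC with e | e | e | e | e <;> rw [e] <;> linarith
  have hconv : ∀ θ u v w : ℝ, 0 < θ → θ ≤ 1 → u ≤ w → v < w → (1 - θ) * u + θ * v < w := by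
    intro θ u v w h1 h2 h3 h4
    have k1 := mul_le_mul_of_nonneg_left h3 (sub_nonneg.2 h2)
    have k2 := mul_lt_mul_of_pos_left h4 h1
    linarith
  -- The extremal potentials may violate strictness. Mixing in any positive weight of the given
  -- strict solution restores it, and the weight is then removed.
  have hfin : s * A - t ≤ 0 := by
    refine le_of_forall_convex (L := s * (a₀ - b₀) - t) (by linarith) fun θ h1 h2 => ?_
    have := h ((1 - θ) * A + θ * a₀) (θ * b₀) ((1 - θ) * C + θ * c₀) ((1 - θ) * D + θ * d₀)
      ⟨⟨?_, ?_, ?_⟩, ⟨?_, ?_, ?_⟩, ⟨?_, ?_, ?_⟩, ?_, ?_, ?_⟩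
    · linarith
    · linarith [hconv θ _ _ _ h1 h2 A1 q1]
    · linarith [hconv θ _ _ _ h1 h2 w2 q2]
    · linarith [hconv θ _ _ _ h1 h2 w3 q3]
    · linarith [hconv θ _ _ _ h1 h2 w4 q4]
    · linarith [hconv θ _ _ _ h1 h2 w5 q5]
    · linarith [hconv θ _ _ _ h1 h2 w6 q6]
    · linarith [hconv θ _ _ _ h1 h2 w7 q7]
    · linarith [hconv θ _ _ _ h1 h2 C1 q8]
    · linarith [hconv θ _ _ _ h1 h2 w9 q9]
    · linarith [hconv θ _ _ _ h1 h2 w10 q10]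
    · linarith [hconv θ _ _ _ h1 h2 D1 q11]
    · linarith [hconv θ _ _ _ h1 h2 w12 q12]
  have hfin' : s * A ≤ t := by linarith
  rcases hA with e | e | e | e | e <;> rw [e] at hfin'
  · exact Or.inl hfin'
  · exact Or.inr (Or.inl hfin')
  · exact Or.inr (Or.inr (Or.inl hfin'))
  · exact Or.inr (Or.inr (Or.inr (Or.inl hfin')))
  · exact Or.inr (Or.inr (Or.inr (Or.inr hfin')))

/-- The constraints of a canonical polytope. -/
def Slabs (l₁ u₁ l₂ u₂ l₃ u₃ l₄ u₄ l₅ u₅ l₆ u₆ x₁ x₂ x₃ : ℝ) : Prop :=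
  (l₁ < x₁ ∧ x₁ < u₁) ∧ (l₂ < x₂ ∧ x₂ < u₂) ∧ (l₃ < x₃ ∧ x₃ < u₃) ∧
  (l₄ < x₁ + x₂ ∧ x₁ + x₂ < u₄) ∧ (l₅ < x₂ + x₃ ∧ x₂ + x₃ < u₅) ∧
  (l₆ < x₁ + x₂ + x₃ ∧ x₁ + x₂ + x₃ < u₆)

section Paths

variable {s t l₁ u₁ l₂ u₂ l₃ u₃ l₄ u₄ l₅ u₅ l₆ u₆ : ℝ}

/-- The nodes are 0, x₃, x₂ + x₃ and x₁ + x₂ + x₃, whose pairwise differences are the six forms; the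
five alternatives are the simple paths between the two nodes that differ by x₁. The lemmas below do
the same for other pairs of nodes. -/
lemma le_fst (hne : ∃ x₁ x₂ x₃, Slabs l₁ u₁ l₂ u₂ l₃ u₃ l₄ u₄ l₅ u₅ l₆ u₆ x₁ x₂ x₃)
    (h : ∀ x₁ x₂ x₃, Slabs l₁ u₁ l₂ u₂ l₃ u₃ l₄ u₄ l₅ u₅ l₆ u₆ x₁ x₂ x₃ → t ≤ s * x₁) :
    t ≤ s * l₁ ∨ t ≤ s * (l₄ - u₂) ∨ t ≤ s * (l₆ - u₅) ∨ t ≤ s * (l₆ - u₃ - u₂) ∨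
      t ≤ s * (l₄ + l₃ - u₅) := by
  obtain ⟨x₁, x₂, x₃, ⟨k1, k2⟩, ⟨k3, k4⟩, ⟨k5, k6⟩, ⟨k7, k8⟩, ⟨k9, k10⟩, k11, k12⟩ := hne
  have := exists_path_le (s := s) (t := -t) (ab := -l₁) (ac := u₂) (ad := u₅) (ba := u₁)
    (bc := u₄) (bd := u₆) (ca := -l₂) (cb := -l₄) (cd := u₃) (da := -l₅) (db := -l₆) (dc := -l₃)
    (a₀ := x₂ + x₃) (b₀ := x₁ + x₂ + x₃) (c₀ := x₃) (d₀ := 0)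
    (by refine ⟨⟨?_, ?_, ?_⟩, ⟨?_, ?_, ?_⟩, ⟨?_, ?_, ?_⟩, ?_, ?_, ?_⟩ <;> linarith)
    (fun a b c d ⟨⟨g1, g2, g3⟩, ⟨g4, g5, g6⟩, ⟨g7, g8, g9⟩, g10, g11, g12⟩ => by
      have := h (b - a) (a - c) (c - d)
        (by refine ⟨⟨?_, ?_⟩, ⟨?_, ?_⟩, ⟨?_, ?_⟩, ⟨?_, ?_⟩, ⟨?_, ?_⟩, ?_, ?_⟩ <;> linarith)
      linarith)
  rcases this with e | e | e | e | e
  · exact Or.inl (by linarith)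
  · exact Or.inr (Or.inl (by linarith))
  · exact Or.inr (Or.inr (Or.inl (by linarith)))
  · exact Or.inr (Or.inr (Or.inr (Or.inl (by linarith))))
  · exact Or.inr (Or.inr (Or.inr (Or.inr (by linarith))))

lemma snd_le (hne : ∃ x₁ x₂ x₃, Slabs l₁ u₁ l₂ u₂ l₃ u₃ l₄ u₄ l₅ u₅ l₆ u₆ x₁ x₂ x₃)
    (h : ∀ x₁ x₂ x₃, Slabs l₁ u₁ l₂ u₂ l₃ u₃ l₄ u₄ l₅ u₅ l₆ u₆ x₁ x₂ x₃ → s * x₂ ≤ t) :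
    s * u₂ ≤ t ∨ s * (u₄ - l₁) ≤ t ∨ s * (u₅ - l₃) ≤ t ∨ s * (u₆ - l₁ - l₃) ≤ t ∨
      s * (u₅ - l₆ + u₄) ≤ t := by
  obtain ⟨x₁, x₂, x₃, ⟨k1, k2⟩, ⟨k3, k4⟩, ⟨k5, k6⟩, ⟨k7, k8⟩, ⟨k9, k10⟩, k11, k12⟩ := hne
  have := exists_path_le (s := s) (t := t) (ab := u₂) (ac := -l₁) (ad := u₅) (ba := -l₂)
    (bc := -l₄) (bd := u₃) (ca := u₁) (cb := u₄) (cd := u₆) (da := -l₅) (db := -l₃) (dc := -l₆)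
    (a₀ := x₂ + x₃) (b₀ := x₃) (c₀ := x₁ + x₂ + x₃) (d₀ := 0)
    (by refine ⟨⟨?_, ?_, ?_⟩, ⟨?_, ?_, ?_⟩, ⟨?_, ?_, ?_⟩, ?_, ?_, ?_⟩ <;> linarith)
    (fun a b c d ⟨⟨g1, g2, g3⟩, ⟨g4, g5, g6⟩, ⟨g7, g8, g9⟩, g10, g11, g12⟩ => by
      have := h (c - a) (a - b) (b - d)
        (by refine ⟨⟨?_, ?_⟩, ⟨?_, ?_⟩, ⟨?_, ?_⟩, ⟨?_, ?_⟩, ⟨?_, ?_⟩, ?_, ?_⟩ <;> linarith)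
      linarith)
  rcases this with e | e | e | e | e
  · exact Or.inl (by linarith)
  · exact Or.inr (Or.inl (by linarith))
  · exact Or.inr (Or.inr (Or.inl (by linarith)))
  · exact Or.inr (Or.inr (Or.inr (Or.inl (by linarith))))
  · exact Or.inr (Or.inr (Or.inr (Or.inr (by linarith))))

lemma le_sum (hne : ∃ x₁ x₂ x₃, Slabs l₁ u₁ l₂ u₂ l₃ u₃ l₄ u₄ l₅ u₅ l₆ u₆ x₁ x₂ x₃)
    (h : ∀ x₁ x₂ x₃, Slabs l₁ u₁ l₂ u₂ l₃ u₃ l₄ u₄ l₅ u₅ l₆ u₆ x₁ x₂ x₃ →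
      t ≤ s * (x₁ + x₂ + x₃)) :
    t ≤ s * l₆ ∨ t ≤ s * (l₅ + l₁) ∨ t ≤ s * (l₃ + l₄) ∨ t ≤ s * (l₅ - u₂ + l₄) ∨
      t ≤ s * (l₃ + l₂ + l₁) := by
  obtain ⟨x₁, x₂, x₃, ⟨k1, k2⟩, ⟨k3, k4⟩, ⟨k5, k6⟩, ⟨k7, k8⟩, ⟨k9, k10⟩, k11, k12⟩ := hne
  have := exists_path_le (s := s) (t := -t) (ab := -l₆) (ac := -l₅) (ad := -l₃) (ba := u₆)
    (bc := u₁) (bd := u₄) (ca := u₅) (cb := -l₁) (cd := u₂) (da := u₃) (db := -l₄) (dc := -l₂)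
    (a₀ := 0) (b₀ := x₁ + x₂ + x₃) (c₀ := x₂ + x₃) (d₀ := x₃)
    (by refine ⟨⟨?_, ?_, ?_⟩, ⟨?_, ?_, ?_⟩, ⟨?_, ?_, ?_⟩, ?_, ?_, ?_⟩ <;> linarith)
    (fun a b c d ⟨⟨g1, g2, g3⟩, ⟨g4, g5, g6⟩, ⟨g7, g8, g9⟩, g10, g11, g12⟩ => by
      have := h (b - c) (c - d) (d - a)
        (by refine ⟨⟨?_, ?_⟩, ⟨?_, ?_⟩, ⟨?_, ?_⟩, ⟨?_, ?_⟩, ⟨?_, ?_⟩, ?_, ?_⟩ <;> linarith)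
      linarith)
  rcases this with e | e | e | e | e
  · exact Or.inl (by linarith)
  · exact Or.inr (Or.inl (by linarith))
  · exact Or.inr (Or.inr (Or.inl (by linarith)))
  · exact Or.inr (Or.inr (Or.inr (Or.inl (by linarith))))
  · exact Or.inr (Or.inr (Or.inr (Or.inr (by linarith))))

lemma thd_le (hne : ∃ x₁ x₂ x₃, Slabs l₁ u₁ l₂ u₂ l₃ u₃ l₄ u₄ l₅ u₅ l₆ u₆ x₁ x₂ x₃)
    (h : ∀ x₁ x₂ x₃, Slabs l₁ u₁ l₂ u₂ l₃ u₃ l₄ u₄ l₅ u₅ l₆ u₆ x₁ x₂ x₃ → s * x₃ ≤ t) :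
    s * u₃ ≤ t ∨ s * (u₆ - l₄) ≤ t ∨ s * (u₅ - l₂) ≤ t ∨ s * (u₁ + u₅ - l₄) ≤ t ∨
      s * (u₆ - l₁ - l₂) ≤ t := by
  obtain ⟨x₁, x₂, x₃, ⟨k1, k2⟩, ⟨k3, k4⟩, ⟨k5, k6⟩, ⟨k7, k8⟩, ⟨k9, k10⟩, k11, k12⟩ := hne
  have := exists_path_le (s := s) (t := t) (ab := u₃) (ac := -l₄) (ad := -l₂) (ba := -l₃)
    (bc := -l₆) (bd := -l₅) (ca := u₄) (cb := u₆) (cd := u₁) (da := u₂) (db := u₅) (dc := -l₁)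
    (a₀ := x₃) (b₀ := 0) (c₀ := x₁ + x₂ + x₃) (d₀ := x₂ + x₃)
    (by refine ⟨⟨?_, ?_, ?_⟩, ⟨?_, ?_, ?_⟩, ⟨?_, ?_, ?_⟩, ?_, ?_, ?_⟩ <;> linarith)
    (fun a b c d ⟨⟨g1, g2, g3⟩, ⟨g4, g5, g6⟩, ⟨g7, g8, g9⟩, g10, g11, g12⟩ => by
      have := h (c - d) (d - a) (a - b)
        (by refine ⟨⟨?_, ?_⟩, ⟨?_, ?_⟩, ⟨?_, ?_⟩, ⟨?_, ?_⟩, ⟨?_, ?_⟩, ?_, ?_⟩ <;> linarith)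
      linarith)
  rcases this with e | e | e | e | e
  · exact Or.inl (by linarith)
  · exact Or.inr (Or.inl (by linarith))
  · exact Or.inr (Or.inr (Or.inl (by linarith)))
  · exact Or.inr (Or.inr (Or.inr (Or.inl (by linarith))))
  · exact Or.inr (Or.inr (Or.inr (Or.inr (by linarith))))

lemma le_snd_add_thd
    (hne : ∃ x₁ x₂ x₃, Slabs l₁ u₁ l₂ u₂ l₃ u₃ l₄ u₄ l₅ u₅ l₆ u₆ x₁ x₂ x₃)
    (h : ∀ x₁ x₂ x₃, Slabs l₁ u₁ l₂ u₂ l₃ u₃ l₄ u₄ l₅ u₅ l₆ u₆ x₁ x₂ x₃ → t ≤ s * (x₂ + x₃)) :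
    t ≤ s * l₅ ∨ t ≤ s * (l₆ - u₁) ∨ t ≤ s * (l₃ + l₂) ∨ t ≤ s * (l₆ - u₄ + l₂) ∨
      t ≤ s * (l₃ + l₄ - u₁) := by
  obtain ⟨x₁, x₂, x₃, ⟨k1, k2⟩, ⟨k3, k4⟩, ⟨k5, k6⟩, ⟨k7, k8⟩, ⟨k9, k10⟩, k11, k12⟩ := hne
  have := exists_path_le (s := s) (t := -t) (ab := -l₅) (ac := -l₆) (ad := -l₃) (ba := u₅)
    (bc := -l₁) (bd := u₂) (ca := u₆) (cb := u₁) (cd := u₄) (da := u₃) (db := -l₂) (dc := -l₄)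
    (a₀ := 0) (b₀ := x₂ + x₃) (c₀ := x₁ + x₂ + x₃) (d₀ := x₃)
    (by refine ⟨⟨?_, ?_, ?_⟩, ⟨?_, ?_, ?_⟩, ⟨?_, ?_, ?_⟩, ?_, ?_, ?_⟩ <;> linarith)
    (fun a b c d ⟨⟨g1, g2, g3⟩, ⟨g4, g5, g6⟩, ⟨g7, g8, g9⟩, g10, g11, g12⟩ => by
      have := h (c - b) (b - d) (d - a)
        (by refine ⟨⟨?_, ?_⟩, ⟨?_, ?_⟩, ⟨?_, ?_⟩, ⟨?_, ?_⟩, ⟨?_, ?_⟩, ?_, ?_⟩ <;> linarith)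
      linarith)
  rcases this with e | e | e | e | e
  · exact Or.inl (by linarith)
  · exact Or.inr (Or.inl (by linarith))
  · exact Or.inr (Or.inr (Or.inl (by linarith)))
  · exact Or.inr (Or.inr (Or.inr (Or.inl (by linarith))))
  · exact Or.inr (Or.inr (Or.inr (Or.inr (by linarith))))

lemma le_fst_add_snd
    (hne : ∃ x₁ x₂ x₃, Slabs l₁ u₁ l₂ u₂ l₃ u₃ l₄ u₄ l₅ u₅ l₆ u₆ x₁ x₂ x₃)
    (h : ∀ x₁ x₂ x₃, Slabs l₁ u₁ l₂ u₂ l₃ u₃ l₄ u₄ l₅ u₅ l₆ u₆ x₁ x₂ x₃ → t ≤ s * (x₁ + x₂)) :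
    t ≤ s * l₄ ∨ t ≤ s * (l₂ + l₁) ∨ t ≤ s * (l₆ - u₃) ∨ t ≤ s * (l₂ - u₅ + l₆) ∨
      t ≤ s * (l₅ + l₁ - u₃) := by
  obtain ⟨x₁, x₂, x₃, ⟨k1, k2⟩, ⟨k3, k4⟩, ⟨k5, k6⟩, ⟨k7, k8⟩, ⟨k9, k10⟩, k11, k12⟩ := hne
  have := exists_path_le (s := s) (t := -t) (ab := -l₄) (ac := -l₂) (ad := u₃) (ba := u₄)
    (bc := u₁) (bd := u₆) (ca := u₂) (cb := -l₁) (cd := u₅) (da := -l₃) (db := -l₆) (dc := -l₅)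
    (a₀ := x₃) (b₀ := x₁ + x₂ + x₃) (c₀ := x₂ + x₃) (d₀ := 0)
    (by refine ⟨⟨?_, ?_, ?_⟩, ⟨?_, ?_, ?_⟩, ⟨?_, ?_, ?_⟩, ?_, ?_, ?_⟩ <;> linarith)
    (fun a b c d ⟨⟨g1, g2, g3⟩, ⟨g4, g5, g6⟩, ⟨g7, g8, g9⟩, g10, g11, g12⟩ => by
      have := h (b - c) (c - a) (a - d)
        (by refine ⟨⟨?_, ?_⟩, ⟨?_, ?_⟩, ⟨?_, ?_⟩, ⟨?_, ?_⟩, ⟨?_, ?_⟩, ?_, ?_⟩ <;> linarith)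
      linarith)
  rcases this with e | e | e | e | e
  · exact Or.inl (by linarith)
  · exact Or.inr (Or.inl (by linarith))
  · exact Or.inr (Or.inr (Or.inl (by linarith)))
  · exact Or.inr (Or.inr (Or.inr (Or.inl (by linarith))))
  · exact Or.inr (Or.inr (Or.inr (Or.inr (by linarith))))

lemma snd_add_thd_le
    (hne : ∃ x₁ x₂ x₃, Slabs l₁ u₁ l₂ u₂ l₃ u₃ l₄ u₄ l₅ u₅ l₆ u₆ x₁ x₂ x₃)
    (h : ∀ x₁ x₂ x₃, Slabs l₁ u₁ l₂ u₂ l₃ u₃ l₄ u₄ l₅ u₅ l₆ u₆ x₁ x₂ x₃ → s * (x₂ + x₃) ≤ t) :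
    s * u₅ ≤ t ∨ s * (u₆ - l₁) ≤ t ∨ s * (u₂ + u₃) ≤ t ∨ s * (u₄ - l₁ + u₃) ≤ t ∨
      s * (u₂ - l₄ + u₆) ≤ t := by
  obtain ⟨x₁, x₂, x₃, ⟨k1, k2⟩, ⟨k3, k4⟩, ⟨k5, k6⟩, ⟨k7, k8⟩, ⟨k9, k10⟩, k11, k12⟩ := hne
  have := exists_path_le (s := s) (t := t) (ab := u₅) (ac := -l₁) (ad := u₂) (ba := -l₅)
    (bc := -l₆) (bd := -l₃) (ca := u₁) (cb := u₆) (cd := u₄) (da := -l₂) (db := u₃) (dc := -l₄)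
    (a₀ := x₂ + x₃) (b₀ := 0) (c₀ := x₁ + x₂ + x₃) (d₀ := x₃)
    (by refine ⟨⟨?_, ?_, ?_⟩, ⟨?_, ?_, ?_⟩, ⟨?_, ?_, ?_⟩, ?_, ?_, ?_⟩ <;> linarith)
    (fun a b c d ⟨⟨g1, g2, g3⟩, ⟨g4, g5, g6⟩, ⟨g7, g8, g9⟩, g10, g11, g12⟩ => by
      have := h (c - a) (a - d) (d - b)
        (by refine ⟨⟨?_, ?_⟩, ⟨?_, ?_⟩, ⟨?_, ?_⟩, ⟨?_, ?_⟩, ⟨?_, ?_⟩, ?_, ?_⟩ <;> linarith)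
      linarith)
  rcases this with e | e | e | e | e
  · exact Or.inl (by linarith)
  · exact Or.inr (Or.inl (by linarith))
  · exact Or.inr (Or.inr (Or.inl (by linarith)))
  · exact Or.inr (Or.inr (Or.inr (Or.inl (by linarith))))
  · exact Or.inr (Or.inr (Or.inr (Or.inr (by linarith))))

end Paths

end CoupledMap

/-! ### From bounds on cells to the inequalities of the parameter set -/

namespace CoupledMap

/-- Tightness of the bounds of `P₂`: triangle inequalities. -/
structure Tight (p d₁ d₂ d₃ d₄ d₅ : ℝ) : Prop where
  add₃₂ : d₃ + d₂ ≤ d₁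
  add₃₄ : d₃ + d₄ ≤ d₁
  le₃₂ : d₃ ≤ d₂
  le₃₄ : d₃ ≤ d₄
  le₂₅ : d₂ ≤ d₅
  le₄₅ : d₄ ≤ d₅
  add₅₂ : d₅ + d₁ ≤ 1 - 2 * p + d₂
  add₅₄ : d₅ + d₁ ≤ 1 - 2 * p + d₄
  add₁₂ : d₁ + d₂ ≤ 1 - 2 * p + d₃
  add₁₄ : d₁ + d₄ ≤ 1 - 2 * p + d₃
  add₂₅ : d₂ + d₅ ≤ 1 - 2 * p

section Necessity

variable {ε p d₁ d₂ d₃ d₄ d₅ : ℝ}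

/-- The cell is P₂ ∩ A₁₁₀₁₁₂ and `hC` bounds x₂ + x₃ from above. By tightness three of the competing
paths are no shorter than the face bound 1 - p - d₃; the fourth would contradict that x₃ ranges over
an interval of positive length. -/
lemma Tight.sub_le (T : Tight p d₁ d₂ d₃ d₄ d₅) (h1 : ε < 1 / 2)
    (hp : p * ε = (3 * p - 1 + ε / 2) / 2)
    (hne : ∃ x₁ x₂ x₃, Slabs (2 * p + d₁) 1 (1 / 2) (1 - p - d₂) 0 (1 - 2 * p - d₁) (1 + p + d₃)
      (3 / 2) (1 / 2) (1 - p - d₃) (3 / 2) (2 - p - d₄) x₁ x₂ x₃)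
    (hC : ∀ x₁ x₂ x₃, Slabs (2 * p + d₁) 1 (1 / 2) (1 - p - d₂) 0 (1 - 2 * p - d₁) (1 + p + d₃)
      (3 / 2) (1 / 2) (1 - p - d₃) (3 / 2) (2 - p - d₄) x₁ x₂ x₃ →
      1 - 2 * p + 2 * (1 - ε) * d₁ ≤ 2 * (1 - ε) * (1 - x₂ - x₃)) :
    2 * (1 - ε) * (d₁ - d₃) ≤ p - ε / 2 := by
  have hs : 0 < 2 * (1 - ε) := by linarith
  have := T.add₁₂
  have := T.add₁₄
  have := T.add₂₅
  have := T.le₄₅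
  have key : 2 * (1 - ε) * (1 - p - d₃) ≤ 2 * (1 - ε) - (1 - 2 * p + 2 * (1 - ε) * d₁) →
      2 * (1 - ε) * (d₁ - d₃) ≤ p - ε / 2 := fun h => by linarith
  rcases snd_add_thd_le (s := 2 * (1 - ε)) (t := 2 * (1 - ε) - (1 - 2 * p + 2 * (1 - ε) * d₁)) hne
    (fun x₁ x₂ x₃ hx => by linarith [hC x₁ x₂ x₃ hx]) with h | h | h | h | h
  · exact key h
  · exact key ((mul_le_mul_of_nonneg_left (by linarith) hs.le).trans h)
  · exact key ((mul_le_mul_of_nonneg_left (by linarith) hs.le).trans h)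
  · obtain ⟨x₁, x₂, x₃, a1, -⟩ := hne
    have := mul_pos hs (show 0 < 1 - 2 * p - d₁ by linarith)
    linarith
  · exact key ((mul_le_mul_of_nonneg_left (by linarith) hs.le).trans h)

/-- Cells A and B are the parts of P₁ left and right of x₁ = 1/2, and D is P₂ ∩ A₁₁₀₂₁₂. Each
inequality comes from one image coordinate on one cell: tightness compares the five paths, and in
most cases a single one survives. Cell A yields d₁, d₃ ≥ 0 and `or₃`, cell B yields `le₂` and `le₄`,
and cell D yields `le₁₂`, `le₁₄` and `le₅`. -/
theorem Tight.admissible (T : Tight p d₁ d₂ d₃ d₄ d₅) (h0 : 0 ≤ ε) (h1 : ε < 1 / 2)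
    (hp : p * ε = (3 * p - 1 + ε / 2) / 2)
    (h5 : p + d₅ ≤ 1 / 2) (hd1 : 2 * (1 - ε) * d₁ ≤ 2 * p - (1 - ε))
    (h13 : 2 * (1 - ε) * (d₁ - d₃) ≤ p - ε / 2)
    (hneA : ∃ x₁ x₂ x₃, Slabs (1 - 2 * p + 2 * (1 - ε) * d₁) (1 / 2) (ε / 2)
      (p - 2 * (1 - ε) * d₂) 0 (2 * p - ε - 2 * (1 - ε) * d₁) (1 - p + 2 * (1 - ε) * d₃)
      (1 - ε / 2) (ε / 2) (p - 2 * (1 - ε) * d₃) (1 - p + 2 * (1 - ε) * d₄) (1 - ε / 2) x₁ x₂ x₃)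
    (hA : ∀ x₁ x₂ x₃, Slabs (1 - 2 * p + 2 * (1 - ε) * d₁) (1 / 2) (ε / 2)
      (p - 2 * (1 - ε) * d₂) 0 (2 * p - ε - 2 * (1 - ε) * d₁) (1 - p + 2 * (1 - ε) * d₃)
      (1 - ε / 2) (ε / 2) (p - 2 * (1 - ε) * d₃) (1 - p + 2 * (1 - ε) * d₄) (1 - ε / 2) x₁ x₂ x₃ →
      Slabs (2 * p + d₁) 1 (p + d₂) (1 - p - d₂) 0 (1 - 2 * p - d₁) (1 + p + d₃) (2 - p - d₅)
        (p + d₅) (1 - p - d₃) (1 + p + d₄) (2 - p - d₄)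
        (2 * (1 - ε) * x₁ + ε) (2 * (1 - ε) * x₂ + ε / 2) (2 * (1 - ε) * x₃))
    (hneB : ∃ x₁ x₂ x₃, Slabs (1 / 2) (1 - ε) (ε / 2)
      (p - 2 * (1 - ε) * d₂) 0 (2 * p - ε - 2 * (1 - ε) * d₁) (1 - p + 2 * (1 - ε) * d₃)
      (1 - ε / 2) (ε / 2) (p - 2 * (1 - ε) * d₃) (1 - p + 2 * (1 - ε) * d₄) (1 - ε / 2) x₁ x₂ x₃)
    (hB : ∀ x₁ x₂ x₃, Slabs (1 / 2) (1 - ε) (ε / 2)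
      (p - 2 * (1 - ε) * d₂) 0 (2 * p - ε - 2 * (1 - ε) * d₁) (1 - p + 2 * (1 - ε) * d₃)
      (1 - ε / 2) (ε / 2) (p - 2 * (1 - ε) * d₃) (1 - p + 2 * (1 - ε) * d₄) (1 - ε / 2) x₁ x₂ x₃ →
      Slabs (1 - 2 * p + 2 * (1 - ε) * d₁) (1 - ε) (ε / 2)
        (p - 2 * (1 - ε) * d₂) 0 (2 * p - ε - 2 * (1 - ε) * d₁) (1 - p + 2 * (1 - ε) * d₃)
        (1 - ε / 2) (ε / 2) (p - 2 * (1 - ε) * d₃) (1 - p + 2 * (1 - ε) * d₄) (1 - ε / 2)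
        (2 * (1 - ε) * x₁ + 2 * ε - 1) (2 * (1 - ε) * x₂) (2 * (1 - ε) * x₃))
    (hneD : ∃ x₁ x₂ x₃, Slabs (2 * p + d₁) 1 (p + d₂) (1 - p - d₂) 0 (1 - 2 * p - d₁) (3 / 2)
      (2 - p - d₅) (p + d₅) (1 - p - d₃) (1 + p + d₄) (2 - p - d₄) x₁ x₂ x₃)
    (hD : ∀ x₁ x₂ x₃, Slabs (2 * p + d₁) 1 (p + d₂) (1 - p - d₂) 0 (1 - 2 * p - d₁) (3 / 2)
      (2 - p - d₅) (p + d₅) (1 - p - d₃) (1 + p + d₄) (2 - p - d₄) x₁ x₂ x₃ →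
      Slabs (2 * p + d₁) 1 (p + d₂) (1 - p - d₂) 0 (1 - 2 * p - d₁) (1 + p + d₃) (2 - p - d₅)
        (p + d₅) (1 - p - d₃) (1 + p + d₄) (2 - p - d₄)
        (2 * (1 - ε) * x₁ + 2 * ε - 1) (2 * (1 - ε) * x₂ + 2 * ε - 1) (2 * (1 - ε) * x₃)) :
    Admissible ε p d₁ d₂ d₃ d₄ d₅ := by
  have hs : 0 < 2 * (1 - ε) := by linarith
  have hs1 : 0 < 2 * (1 - ε) - 1 := by linarith
  have hss : 0 < (2 * (1 - ε)) ^ 2 - 1 := by nlinarith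
  have t1 := T.add₃₂
  have t2 := T.add₃₄
  have t3 := T.le₃₂
  have t4 := T.le₃₄
  have t5 := T.le₂₅
  have t6 := T.le₄₅
  have t9 := T.add₁₂
  have t10 := T.add₁₄
  have t11 := T.add₂₅
  have s1 := mul_le_mul_of_nonneg_left t1 hs.le
  have s2 := mul_le_mul_of_nonneg_left t2 hs.le
  have s3 := mul_le_mul_of_nonneg_left t3 hs.le
  have s4 := mul_le_mul_of_nonneg_left t4 hs.le
  have s10 := mul_le_mul_of_nonneg_left t10 hs.le
  have hpos1 : 2 * p + d₁ < 1 := by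
    obtain ⟨x₁, x₂, x₃, a1, -⟩ := hneD
    linarith
  have hposA : ε / 2 < p - 2 * (1 - ε) * d₂ ∧ 0 < 2 * p - ε - 2 * (1 - ε) * d₁ ∧
      1 - p + 2 * (1 - ε) * d₃ < 1 ∧ 1 - p + 2 * (1 - ε) * d₄ < 1 := by
    obtain ⟨x₁, x₂, x₃, a1, a2, a3, a4, a5, a6⟩ := hneA
    refine ⟨?_, ?_, ?_, ?_⟩ <;> linarith
  obtain ⟨hposU2, hposU3, hposL4, hposL6⟩ := hposA
  -- Expansion moves every face away from the fixed plane of the branch, at level 0 or 1. These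
  -- strict gains exclude, in each `con` below, that a face satisfies the required bound by itself.
  have n1 := mul_pos hs1 (sub_pos.2 hpos1)
  have nU2 := mul_pos hs1 (show 0 < p - 2 * (1 - ε) * d₂ by linarith)
  have nL4 := mul_pos hs1 (sub_pos.2 hposL4)
  have nL6 := mul_pos hs1 (sub_pos.2 hposL6)
  have n5 := mul_pos hs1 (show 0 < 1 - (p + d₅) by linarith)
  -- the two minima of `G` on the left part of `P₁`
  have kA1 : 2 * p + d₁ - ε ≤ 2 * (1 - ε) * (1 - 2 * p + 2 * (1 - ε) * d₁) := by
    rcases le_fst (s := 2 * (1 - ε)) (t := 2 * p + d₁ - ε) hneA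
      (fun x₁ x₂ x₃ hx => by linarith [(hA x₁ x₂ x₃ hx).1.1]) with h | h | h | h | h
    · exact h
    all_goals exact h.trans (mul_le_mul_of_nonneg_left (by linarith) hs.le)
  have kA4 : 1 + p + d₃ - 3 * ε / 2 ≤ 2 * (1 - ε) * (1 - p + 2 * (1 - ε) * d₃) := by
    rcases le_fst_add_snd (s := 2 * (1 - ε)) (t := 1 + p + d₃ - 3 * ε / 2) hneA
      (fun x₁ x₂ x₃ hx => by linarith [(hA x₁ x₂ x₃ hx).2.2.2.1.1]) with h | h | h | h | h
    · exact h
    all_goals exact h.trans (mul_le_mul_of_nonneg_left (by linarith) hs.le)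
  have hd1' : 0 ≤ d₁ := nonneg_of_mul_nonneg_right (show 0 ≤ ((2 * (1 - ε)) ^ 2 - 1) * d₁ by
    linarith) hss
  have hd3' : 0 ≤ d₃ := nonneg_of_mul_nonneg_right (show 0 ≤ ((2 * (1 - ε)) ^ 2 - 1) * d₃ by
    linarith) hss
  refine ⟨hd1', hd1, ?_, ?_, ?_, ?_, hd3', t3, t4, t1, t2, t5, t6, ?_, T.add₅₂, T.add₅₄, ?_⟩
  · have key : 2 * p + d₁ + 1 - 2 * ε ≤ 2 * (1 - ε) * (1 / 2 + p + d₂) →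
        d₁ ≤ ε * (1 - 2 * p) + 2 * (1 - ε) * d₂ := fun h => by linarith
    have con : ¬ 2 * p + d₁ + 1 - 2 * ε ≤ 2 * (1 - ε) * (2 * p + d₁) := fun h => by linarith
    rcases le_fst (s := 2 * (1 - ε)) (t := 2 * p + d₁ + 1 - 2 * ε) hneD
      (fun x₁ x₂ x₃ hx => by linarith [(hD x₁ x₂ x₃ hx).1.1]) with h | h | h | h | h
    · exact absurd h con
    · exact key (h.trans (mul_le_mul_of_nonneg_left (by linarith) hs.le))
    · exact absurd (h.trans (mul_le_mul_of_nonneg_left (by linarith) hs.le)) con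
    · exact absurd (h.trans (mul_le_mul_of_nonneg_left (by linarith) hs.le)) con
    · exact key (h.trans (mul_le_mul_of_nonneg_left (by linarith) hs.le))
  · have key : 2 * (1 - ε) * (1 / 2 - p - d₄) ≤ 1 - 2 * p - d₁ →
        d₁ ≤ ε * (1 - 2 * p) + 2 * (1 - ε) * d₄ := fun h => by linarith
    have con : ¬ 2 * (1 - ε) * (1 - 2 * p - d₁) ≤ 1 - 2 * p - d₁ := fun h => by linarith
    rcases thd_le (s := 2 * (1 - ε)) (t := 1 - 2 * p - d₁) hneD
      (fun x₁ x₂ x₃ hx => by linarith [(hD x₁ x₂ x₃ hx).2.2.1.2]) with h | h | h | h | h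
    · exact absurd h con
    · exact key ((mul_le_mul_of_nonneg_left (by linarith) hs.le).trans h)
    · exact absurd ((mul_le_mul_of_nonneg_left (by linarith) hs.le).trans h) con
    · exact key ((mul_le_mul_of_nonneg_left (by linarith) hs.le).trans h)
    · exact absurd ((mul_le_mul_of_nonneg_left (by linarith) hs.le).trans h) con
  · have key : 2 * (1 - ε) * ((1 - ε) / 2) ≤ p - 2 * (1 - ε) * d₂ →
        2 * (1 - ε) * d₂ ≤ p - (1 - ε) ^ 2 := fun h => by linarith
    have con : ¬ 2 * (1 - ε) * (p - 2 * (1 - ε) * d₂) ≤ p - 2 * (1 - ε) * d₂ :=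
      fun h => by linarith
    rcases snd_le (s := 2 * (1 - ε)) (t := p - 2 * (1 - ε) * d₂) hneB
      (fun x₁ x₂ x₃ hx => by linarith [(hB x₁ x₂ x₃ hx).2.1.2]) with h | h | h | h | h
    · exact absurd h con
    · exact key ((mul_le_mul_of_nonneg_left (by linarith) hs.le).trans h)
    · exact absurd ((mul_le_mul_of_nonneg_left (by linarith) hs.le).trans h) con
    · exact key ((mul_le_mul_of_nonneg_left (by linarith) hs.le).trans h)
    · exact absurd ((mul_le_mul_of_nonneg_left (by linarith) hs.le).trans h) con
  · have key : 1 - p + 2 * (1 - ε) * d₄ + 1 - 2 * ε ≤ 2 * (1 - ε) * (1 / 2 + ε / 2) →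
        2 * (1 - ε) * d₄ ≤ p - (1 - ε) ^ 2 := fun h => by linarith
    have con : ¬ 1 - p + 2 * (1 - ε) * d₄ + 1 - 2 * ε ≤
        2 * (1 - ε) * (1 - p + 2 * (1 - ε) * d₄) := fun h => by linarith
    rcases le_sum (s := 2 * (1 - ε)) (t := 1 - p + 2 * (1 - ε) * d₄ + 1 - 2 * ε) hneB
      (fun x₁ x₂ x₃ hx => by linarith [(hB x₁ x₂ x₃ hx).2.2.2.2.2.1]) with h | h | h | h | h
    · exact absurd h con
    · exact key (h.trans (mul_le_mul_of_nonneg_left (by linarith) hs.le))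
    · exact absurd (h.trans (mul_le_mul_of_nonneg_left (by linarith) hs.le)) con
    · exact absurd (h.trans (mul_le_mul_of_nonneg_left (by linarith) hs.le)) con
    · exact key (h.trans (mul_le_mul_of_nonneg_left (by linarith) hs.le))
  · have key : p + d₅ + 1 - 2 * ε ≤ 2 * (1 - ε) * (1 / 2) → d₅ ≤ ε - p := fun h => by linarith
    have con : ¬ p + d₅ + 1 - 2 * ε ≤ 2 * (1 - ε) * (p + d₅) := fun h => by linarith
    rcases le_snd_add_thd (s := 2 * (1 - ε)) (t := p + d₅ + 1 - 2 * ε) hneD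
      (fun x₁ x₂ x₃ hx => by linarith [(hD x₁ x₂ x₃ hx).2.2.2.2.1.1]) with h | h | h | h | h
    · exact absurd h con
    · exact absurd (h.trans (mul_le_mul_of_nonneg_left (by linarith) hs.le)) con
    · exact absurd (h.trans (mul_le_mul_of_nonneg_left (by linarith) hs.le)) con
    · exact absurd (h.trans (mul_le_mul_of_nonneg_left (by linarith) hs.le)) con
    · exact key (h.trans (mul_le_mul_of_nonneg_left (by linarith) hs.le))
  · rcases thd_le (s := 2 * (1 - ε)) (t := 1 - 2 * p - d₁) hneA
      (fun x₁ x₂ x₃ hx => by linarith [(hA x₁ x₂ x₃ hx).2.2.1.2]) with h | h | h | h | h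
    · exact Or.inl ((mul_le_mul_of_nonneg_left (by linarith) hs.le).trans h)
    · exact Or.inl ((mul_le_mul_of_nonneg_left (by linarith) hs.le).trans h)
    · exact Or.inl ((mul_le_mul_of_nonneg_left (by linarith) hs.le).trans h)
    -- The path through x₁ < 1/2, x₂ + x₃ and x₁ + x₂ is the only one not dominated by the bound p -
    -- ε/2 - 2(1 - ε)d₃, which explains the minimum in `Δ`.
    · exact Or.inr ((mul_le_mul_of_nonneg_left (by linarith) hs.le).trans h)
    · exact Or.inl ((mul_le_mul_of_nonneg_left (by linarith) hs.le).trans h)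

end Necessity

end CoupledMap

/-! ### Pointwise consequences of the conditioning problem -/

namespace CoupledMap

lemma isOpen_polytope {e : ℕ} (α : Matrix (Fin e) (Fin 3) ℝ) (m : Matrix (Fin e) (Fin 2) ℝ) :
    IsOpen (polytope α m) := by
  have : polytope α m = ⋂ i, {x | m i 0 < α.mulVec x i ∧ α.mulVec x i < m i 1} := by
    ext x; simp [polytope]
  rw [this]
  refine isOpen_iInter_of_finite fun i => ?_
  have hc : Continuous fun x : Fin 3 → ℝ => α.mulVec x i :=
    (continuous_apply i).comp (Continuous.matrix_mulVec continuous_const continuous_id)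
  exact (isOpen_lt continuous_const hc).inter (isOpen_lt hc continuous_const)

lemma convex_polytope {e : ℕ} (α : Matrix (Fin e) (Fin 3) ℝ) (m : Matrix (Fin e) (Fin 2) ℝ) :
    Convex ℝ (polytope α m) := by
  intro x hx y hy a b ha hb hab i
  have := convex_Ioo (m i 0) (m i 1) (hx i) (hy i) ha hb hab
  simpa [Matrix.mulVec_add, Matrix.mulVec_smul] using this

lemma exists_mem_fst_eq {P : Set (Fin 3 → ℝ)} (hP : Convex ℝ P) {x y : Fin 3 → ℝ} (hx : x ∈ P)
    (hy : y ∈ P) {c : ℝ} (h1 : x 0 ≤ c) (h2 : c < y 0) : ∃ z ∈ P, z 0 = c := by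
  have hpos : 0 < y 0 - x 0 := by linarith
  refine ⟨((y 0 - c) / (y 0 - x 0)) • x + ((c - x 0) / (y 0 - x 0)) • y,
    hP hx hy (div_nonneg (by linarith) hpos.le) (div_nonneg (by linarith) hpos.le) ?_, ?_⟩
  · field_simp
    ring
  · simp only [Pi.add_apply, Pi.smul_apply, smul_eq_mul]
    field_simp
    ring

lemma eventually_nearest (u : ℝ) {c : ℝ} (hc : 0 < c) :
    ∀ᶠ t in nhdsWithin (0 : ℝ) (Set.Ioi 0),
      ∃ n : ℤ, (n : ℝ) - 1 / 2 < u + c * t ∧ u + c * t < n + 1 / 2 := by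
  have h1 := Int.floor_le (u + 1 / 2)
  have h2 := Int.lt_floor_add_one (u + 1 / 2)
  have hpos : 0 < (⌊u + 1 / 2⌋ + 1 / 2 - u) / c := div_pos (by linarith) hc
  filter_upwards [Ioo_mem_nhdsGT hpos] with t ht
  have h3 := mul_pos hc ht.1
  have h4 := (lt_div_iff₀' hc).1 ht.2
  exact ⟨⌊u + 1 / 2⌋, by linarith, by linarith⟩

/-- Moving along (1, 1, 1) increases the six sums at rates 1, 2 or 3, so all of them leave 1/2 + ℤ
at once. Information about atoms, which only concerns regular points, is thereby carried to every
point of an open set. -/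
lemma exists_regular_gt {V : Set (Fin 3 → ℝ)} (hV : IsOpen V) {x : Fin 3 → ℝ} (hx : x ∈ V) :
    ∃ w ∈ V, Regular w ∧ ∀ i, x i < w i := by
  have hc : Continuous fun t : ℝ => fun i : Fin 3 => x i + t := by fun_prop
  have e0 : ∀ᶠ t in nhdsWithin (0 : ℝ) (Set.Ioi 0), (fun i : Fin 3 => x i + t) ∈ V := by
    refine (hc.continuousAt.eventually_mem ?_).filter_mono nhdsWithin_le_nhds
    simpa using hV.mem_nhds hx
  have hp : ∀ᶠ t in nhdsWithin (0 : ℝ) (Set.Ioi 0), 0 < t := eventually_mem_nhdsWithin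
  obtain ⟨t, ht, t0, ⟨a, ha⟩, ⟨b, hb⟩, ⟨c, hc⟩, ⟨d, hd⟩, ⟨e, he⟩, ⟨f, hf⟩⟩ :=
    (e0.and (hp.and ((eventually_nearest (x 0) one_pos).and
      ((eventually_nearest (x 1) one_pos).and ((eventually_nearest (x 2) one_pos).and
      ((eventually_nearest (x 0 + x 1) two_pos).and ((eventually_nearest (x 1 + x 2) two_pos).and
      (eventually_nearest (x 0 + x 1 + x 2) three_pos)))))))).exists
  refine ⟨_, ht, ⟨a, b, c, d, e, f, ?_⟩, fun i => by simpa using t0⟩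
  simp only [NearestInts]
  refine ⟨⟨?_, ?_⟩, ⟨?_, ?_⟩, ⟨?_, ?_⟩, ⟨?_, ?_⟩, ⟨?_, ?_⟩, ?_, ?_⟩ <;> linarith

lemma exists_regular_lt {V : Set (Fin 3 → ℝ)} (hV : IsOpen V) {x : Fin 3 → ℝ} (hx : x ∈ V) :
    ∃ w ∈ V, Regular w ∧ ∀ i, w i < x i := by
  obtain ⟨w, hw, ⟨a, b, c, d, e, f, h1, h2, h3, h4, h5, h6⟩, hlt⟩ :=
    exists_regular_gt (hV.preimage continuous_neg) (x := -x) (by simpa using hx)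
  refine ⟨-w, hw, ⟨-a, -b, -c, -d, -e, -f, ?_⟩, fun i => ?_⟩
  · simp only [NearestInts, Pi.neg_apply]
    push_cast
    refine ⟨⟨?_, ?_⟩, ⟨?_, ?_⟩, ⟨?_, ?_⟩, ⟨?_, ?_⟩, ⟨?_, ?_⟩, ?_, ?_⟩ <;> linarith
  · have := hlt i
    simp only [Pi.neg_apply] at this ⊢
    linarith

/-- A form increasing along the coordinates does not attain its infimum on an open set, so the best
lower bound is automatically strict. -/
lemma exists_strict_inf {P : Set (Fin 3 → ℝ)} (hP : IsOpen P) (hne : P.Nonempty) (hc : P ⊆ cube)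
    (f : (Fin 3 → ℝ) → ℝ) (hf : ∀ x y : Fin 3 → ℝ, (∀ i, x i < y i) → f x < f y)
    (h0 : ∀ x ∈ cube, 0 ≤ f x) :
    ∃ a, (∀ x ∈ P, a < f x) ∧ ∀ c, (∀ x ∈ P, c ≤ f x) → c ≤ a := by
  have hb : BddBelow (f '' P) := ⟨0, by rintro _ ⟨x, hx, rfl⟩; exact h0 x (hc hx)⟩
  have hg := isGLB_csInf (hne.image f) hb
  refine ⟨sInf (f '' P), fun x hx => ?_, fun c h => ?_⟩
  · obtain ⟨w, hw, -, hlt⟩ := exists_regular_lt hP hx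
    exact (hg.1 ⟨w, hw, rfl⟩).trans_lt (hf _ _ hlt)
  · exact hg.2 (by rintro _ ⟨x, hx, rfl⟩; exact h x hx)

lemma exists_strict_sup {P : Set (Fin 3 → ℝ)} (hP : IsOpen P) (hne : P.Nonempty) (hc : P ⊆ cube)
    (f : (Fin 3 → ℝ) → ℝ) (hf : ∀ x y : Fin 3 → ℝ, (∀ i, x i < y i) → f x < f y)
    {C : ℝ} (h0 : ∀ x ∈ cube, f x ≤ C) :
    ∃ b, (∀ x ∈ P, f x < b) ∧ ∀ c, (∀ x ∈ P, f x ≤ c) → b ≤ c := by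
  have hb : BddAbove (f '' P) := ⟨C, by rintro _ ⟨x, hx, rfl⟩; exact h0 x (hc hx)⟩
  have hg := isLUB_csSup (hne.image f) hb
  refine ⟨sSup (f '' P), fun x hx => ?_, fun c h => ?_⟩
  · obtain ⟨w, hw, -, hlt⟩ := exists_regular_gt hP hx
    exact (hf _ _ hlt).trans_le (hg.1 ⟨w, hw, rfl⟩)
  · exact hg.2 (by rintro _ ⟨x, hx, rfl⟩; exact h x hx)

namespace ConditioningProblem3

variable {ε : ℝ} {P₁ P₂ : Set (Fin 3 → ℝ)}

lemma atom_of_mem₁ (H : ConditioningProblem3 ε P₁ P₂) {x : Fin 3 → ℝ} (hx : x ∈ P₁)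
    (hr : Regular x) : x ∈ atom ![0, 0, 0, 1, 0, 1] ∨ x ∈ atom ![1, 0, 0, 1, 0, 1] := by
  obtain ⟨a, b, c, d, e, f, hn⟩ := hr
  have ha : x ∈ atom ![a, b, c, d, e, f] := (mem_atom_vec ..).2 ⟨H.subset₁ hx, hn⟩
  rcases (H.loc₁ _).1 ⟨x, hx, ha⟩ with h | h <;> rw [h] at ha
  exacts [Or.inl ha, Or.inr ha]

lemma atom_of_mem₂ (H : ConditioningProblem3 ε P₁ P₂) {x : Fin 3 → ℝ} (hx : x ∈ P₂)
    (hr : Regular x) : x ∈ atom ![1, 1, 0, 1, 1, 1] ∨ x ∈ atom ![1, 1, 0, 1, 1, 2] ∨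
      x ∈ atom ![1, 1, 0, 2, 1, 2] ∨ x ∈ atom ![1, 0, 0, 1, 0, 1] ∨
      x ∈ atom ![1, 0, 0, 1, 1, 1] ∨ x ∈ atom ![1, 0, 0, 1, 1, 2] := by
  obtain ⟨a, b, c, d, e, f, hn⟩ := hr
  have ha : x ∈ atom ![a, b, c, d, e, f] := (mem_atom_vec ..).2 ⟨H.subset₂ hx, hn⟩
  rcases (H.loc₂ _).1 ⟨x, hx, ha⟩ with h | h | h | h | h | h <;> rw [h] at ha <;> simp [ha]

/-- The bounds shared by the permitted atoms hold at regular points on either side of x; squeezing x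
strictly between two of them keeps the inequalities strict. -/
lemma bounds₁ (H : ConditioningProblem3 ε P₁ P₂) (ho : IsOpen P₁) {x : Fin 3 → ℝ} (hx : x ∈ P₁) :
    x 1 < 1 / 2 ∧ x 2 < 1 / 2 ∧ (1 / 2 < x 0 + x 1 ∧ x 0 + x 1 < 3 / 2) ∧ x 1 + x 2 < 1 / 2 ∧
      (1 / 2 < x 0 + x 1 + x 2 ∧ x 0 + x 1 + x 2 < 3 / 2) := by
  have key : ∀ w ∈ P₁, Regular w → w 1 < 1 / 2 ∧ w 2 < 1 / 2 ∧
      (1 / 2 < w 0 + w 1 ∧ w 0 + w 1 < 3 / 2) ∧ w 1 + w 2 < 1 / 2 ∧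
      (1 / 2 < w 0 + w 1 + w 2 ∧ w 0 + w 1 + w 2 < 3 / 2) := by
    intro w hw hr
    rcases H.atom_of_mem₁ hw hr with h | h <;> rw [mem_atom_vec] at h <;> push_cast at h <;>
      obtain ⟨-, a1, a2, a3, a4, a5, a6⟩ := h <;>
      refine ⟨?_, ?_, ⟨?_, ?_⟩, ?_, ?_, ?_⟩ <;> linarith
  obtain ⟨w, hw, hr, hlt⟩ := exists_regular_gt ho hx
  obtain ⟨v, hv, hr', hlt'⟩ := exists_regular_lt ho hx
  obtain ⟨a1, a2, a3, a4, a5⟩ := key w hw hr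
  obtain ⟨b1, b2, b3, b4, b5⟩ := key v hv hr'
  have := hlt 0; have := hlt 1; have := hlt 2
  have := hlt' 0; have := hlt' 1; have := hlt' 2
  refine ⟨?_, ?_, ⟨?_, ?_⟩, ?_, ?_, ?_⟩ <;> linarith

lemma bounds₂ (H : ConditioningProblem3 ε P₁ P₂) (ho : IsOpen P₂) {x : Fin 3 → ℝ} (hx : x ∈ P₂) :
    1 / 2 < x 0 ∧ x 2 < 1 / 2 ∧ 1 / 2 < x 0 + x 1 ∧ x 1 + x 2 < 3 / 2 ∧
      (1 / 2 < x 0 + x 1 + x 2 ∧ x 0 + x 1 + x 2 < 5 / 2) := by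
  have key : ∀ w ∈ P₂, Regular w → 1 / 2 < w 0 ∧ w 2 < 1 / 2 ∧ 1 / 2 < w 0 + w 1 ∧
      w 1 + w 2 < 3 / 2 ∧ (1 / 2 < w 0 + w 1 + w 2 ∧ w 0 + w 1 + w 2 < 5 / 2) := by
    intro w hw hr
    rcases H.atom_of_mem₂ hw hr with h | h | h | h | h | h <;> rw [mem_atom_vec] at h <;>
      push_cast at h <;> obtain ⟨-, a1, a2, a3, a4, a5, a6⟩ := h <;>
      refine ⟨?_, ?_, ?_, ?_, ?_, ?_⟩ <;> linarith
  obtain ⟨w, hw, hr, hlt⟩ := exists_regular_gt ho hx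
  obtain ⟨v, hv, hr', hlt'⟩ := exists_regular_lt ho hx
  obtain ⟨a1, a2, a3, a4, a5⟩ := key w hw hr
  obtain ⟨b1, b2, b3, b4, b5⟩ := key v hv hr'
  have := hlt 0; have := hlt 1; have := hlt 2
  have := hlt' 0; have := hlt' 1; have := hlt' 2
  refine ⟨?_, ?_, ?_, ?_, ?_, ?_⟩ <;> linarith

lemma map_000101 (H : ConditioningProblem3 ε P₁ P₂) (ho : IsOpen P₁) (h0 : 0 ≤ ε)
    (h1 : ε < 1 / 2) {x : Fin 3 → ℝ} (hx : x ∈ P₁) (hl : x 0 < 1 / 2) :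
    ![2 * (1 - ε) * x 0 + ε, 2 * (1 - ε) * x 1 + ε / 2, 2 * (1 - ε) * x 2] ∈ P₂ := by
  have ha : x ∈ atom ![0, 0, 0, 1, 0, 1] := by
    have hc := H.subset₁ hx
    obtain ⟨a1, a2, a3, a4, a5⟩ := H.bounds₁ ho hx
    rw [mem_atom_vec]
    refine ⟨hc, ?_⟩
    rw [mem_cube] at hc
    push_cast
    refine ⟨⟨?_, ?_⟩, ⟨?_, ?_⟩, ⟨?_, ?_⟩, ⟨?_, ?_⟩, ⟨?_, ?_⟩, ?_, ?_⟩ <;> linarith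
  rw [← G_000101 h0 h1 ha]
  exact H.dyn_000101 (Set.mem_image_of_mem _ ⟨hx, ha⟩)

lemma map_100101 (H : ConditioningProblem3 ε P₁ P₂) (ho : IsOpen P₁) (h0 : 0 ≤ ε)
    (h1 : ε < 1 / 2) {x : Fin 3 → ℝ} (hx : x ∈ P₁) (hl : 1 / 2 < x 0) :
    ![2 * (1 - ε) * x 0 + 2 * ε - 1, 2 * (1 - ε) * x 1, 2 * (1 - ε) * x 2] ∈ P₁ := by
  have ha : x ∈ atom ![1, 0, 0, 1, 0, 1] := by
    have hc := H.subset₁ hx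
    obtain ⟨a1, a2, a3, a4, a5⟩ := H.bounds₁ ho hx
    rw [mem_atom_vec]
    refine ⟨hc, ?_⟩
    rw [mem_cube] at hc
    push_cast
    refine ⟨⟨?_, ?_⟩, ⟨?_, ?_⟩, ⟨?_, ?_⟩, ⟨?_, ?_⟩, ⟨?_, ?_⟩, ?_, ?_⟩ <;> linarith
  rw [← G_100101 h0 h1 ha]
  exact H.dyn_100101 (Set.mem_image_of_mem _ ⟨hx, ha⟩)

lemma map_110112 (H : ConditioningProblem3 ε P₁ P₂) (ho : IsOpen P₂) (h0 : 0 ≤ ε)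
    (h1 : ε < 1 / 2) {x : Fin 3 → ℝ} (hx : x ∈ P₂) (hl : 1 / 2 < x 1) (hl' : x 0 + x 1 < 3 / 2)
    (hl6 : 3 / 2 < x 0 + x 1 + x 2) :
    ![2 * (1 - ε) * x 0 + 3 * ε / 2 - 1, 2 * (1 - ε) * x 1 + 3 * ε / 2 - 1,
      2 * (1 - ε) * x 2 + ε / 2] ∈ σ4231 '' P₁ := by
  have ha : x ∈ atom ![1, 1, 0, 1, 1, 2] := by
    have hc := H.subset₂ hx
    obtain ⟨a1, a2, a3, a4, a5⟩ := H.bounds₂ ho hx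
    rw [mem_atom_vec]
    refine ⟨hc, ?_⟩
    rw [mem_cube] at hc
    push_cast
    refine ⟨⟨?_, ?_⟩, ⟨?_, ?_⟩, ⟨?_, ?_⟩, ⟨?_, ?_⟩, ⟨?_, ?_⟩, ?_, ?_⟩ <;> linarith
  rw [← G_110112 h0 h1 ha]
  exact H.dyn_110112 (Set.mem_image_of_mem _ ⟨hx, ha⟩)

lemma map_110212 (H : ConditioningProblem3 ε P₁ P₂) (ho : IsOpen P₂) (h0 : 0 ≤ ε)
    (h1 : ε < 1 / 2) {x : Fin 3 → ℝ} (hx : x ∈ P₂) (hl : 3 / 2 < x 0 + x 1) :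
    ![2 * (1 - ε) * x 0 + 2 * ε - 1, 2 * (1 - ε) * x 1 + 2 * ε - 1, 2 * (1 - ε) * x 2] ∈ P₂ := by
  have ha : x ∈ atom ![1, 1, 0, 2, 1, 2] := by
    have hc := H.subset₂ hx
    obtain ⟨a1, a2, a3, a4, a5⟩ := H.bounds₂ ho hx
    rw [mem_atom_vec]
    refine ⟨hc, ?_⟩
    rw [mem_cube] at hc
    push_cast
    refine ⟨⟨?_, ?_⟩, ⟨?_, ?_⟩, ⟨?_, ?_⟩, ⟨?_, ?_⟩, ⟨?_, ?_⟩, ?_, ?_⟩ <;> linarith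
  rw [← G_110212 h0 h1 ha]
  exact H.dyn_110212 (Set.mem_image_of_mem _ ⟨hx, ha⟩)

/-- This is where equality, and not just inclusion, on atom 110111 matters: it determines P₁ from
P₂. -/
lemma mem₁_iff (H : ConditioningProblem3 ε P₁ P₂) (ho : IsOpen P₂) (h0 : 0 ≤ ε)
    (h1 : ε < 1 / 2) (x : Fin 3 → ℝ) :
    ![2 * (1 - ε) * x 0 + ε - 1, 2 * (1 - ε) * x 1 + 3 * ε / 2 - 1, 2 * (1 - ε) * x 2] ∈ P₁ ↔
      x ∈ P₂ ∧ 1 / 2 < x 1 ∧ x 0 + x 1 < 3 / 2 ∧ 1 / 2 < x 1 + x 2 ∧ x 0 + x 1 + x 2 < 3 / 2 := by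
  have hs : 2 * (1 - ε) ≠ 0 := by linarith
  constructor
  · intro h
    rw [← H.dyn_110111] at h
    obtain ⟨y, ⟨hy, hya⟩, e⟩ := h
    rw [G_110111 h0 h1 hya] at e
    have e0 := congrFun e 0
    have e1 := congrFun e 1
    have e2 := congrFun e 2
    simp only [Matrix.cons_val] at e0 e1 e2
    have f0 : y 0 = x 0 := mul_left_cancel₀ hs (by linarith)
    have f1 : y 1 = x 1 := mul_left_cancel₀ hs (by linarith)
    have f2 : y 2 = x 2 := mul_left_cancel₀ hs (by linarith)
    have hyx : y = x := by
      funext i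
      fin_cases i
      exacts [f0, f1, f2]
    subst hyx
    rw [mem_atom_vec] at hya
    push_cast at hya
    obtain ⟨-, a1, a2, a3, a4, a5, a6⟩ := hya
    exact ⟨hy, by linarith, by linarith, by linarith, by linarith⟩
  · rintro ⟨hx, b1, b2, b3, b4⟩
    have ha : x ∈ atom ![1, 1, 0, 1, 1, 1] := by
      have hc := H.subset₂ hx
      obtain ⟨a1, a2, a3, a4, a5⟩ := H.bounds₂ ho hx
      rw [mem_atom_vec]
      refine ⟨hc, ?_⟩
      rw [mem_cube] at hc
      push_cast
      refine ⟨⟨?_, ?_⟩, ⟨?_, ?_⟩, ⟨?_, ?_⟩, ⟨?_, ?_⟩, ⟨?_, ?_⟩, ?_, ?_⟩ <;> linarith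
    rw [← G_110111 h0 h1 ha, ← H.dyn_110111]
    exact Set.mem_image_of_mem _ ⟨hx, ha⟩

lemma symm_mem₂ (H : ConditioningProblem3 ε P₁ P₂) {x : Fin 3 → ℝ} (hx : x ∈ P₂) :
    ![1 - x 2, 1 - x 1, 1 - x 0] ∈ P₂ := by
  rw [← σ4321_of_mem_cube (H.subset₂ hx), ← H.symm₂]
  exact Set.mem_image_of_mem _ hx

end ConditioningProblem3

end CoupledMap

/-! ### Every solution comes from a parameter -/

namespace CoupledMap

namespace ConditioningProblem3

variable {ε : ℝ} {M₁ M₂ : Matrix (Fin 6) (Fin 2) ℝ}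

/-- P₁ crosses the wall x₁ = 1/2 by convexity, and just left of it the image has first coordinate
close to (1 - ε) + ε = 1. -/
lemma one_le_of_forall_fst_lt {P₂ : Set (Fin 3 → ℝ)}
    (H : ConditioningProblem3 ε (polytope canonical M₁) P₂) (h0 : 0 ≤ ε)
    (h1 : ε < 1 / 2) {b : ℝ} (hb : ∀ x ∈ P₂, x 0 < b) : 1 ≤ b := by
  have hs : 0 < 2 * (1 - ε) := by linarith
  have ho := isOpen_polytope canonical M₁
  by_contra! hlt
  obtain ⟨y, hy, hya⟩ := (H.loc₁ ![0, 0, 0, 1, 0, 1]).2 (by simp)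
  obtain ⟨z, hz, hza⟩ := (H.loc₁ ![1, 0, 0, 1, 0, 1]).2 (by simp)
  rw [mem_atom_vec] at hya hza
  push_cast at hya hza
  have hy' : y 0 < 1 / 2 := by linarith [hya.2.1.2]
  have hz' : 1 / 2 < z 0 := by linarith [hza.2.1.1]
  have hc : (b - ε) / (2 * (1 - ε)) < 1 / 2 := by
    rw [div_lt_iff₀ hs]
    linarith
  obtain ⟨w, hw, e⟩ := exists_mem_fst_eq (convex_polytope canonical M₁) hy hz
    (c := max ((b - ε) / (2 * (1 - ε))) (y 0)) (le_max_right _ _)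
    (max_lt (hc.trans hz') (hy'.trans hz'))
  have hw2 := hb _ (H.map_000101 ho h0 h1 hw (by rw [e]; exact max_lt hc hy'))
  simp only [Matrix.cons_val] at hw2
  have h3 := le_max_left ((b - ε) / (2 * (1 - ε))) (y 0)
  rw [← e, div_le_iff₀ hs] at h3
  linarith

/-- Just right of the wall x₁ = 1/2 the image, again in P₁, has first coordinate close to (1 - ε) +
2ε - 1 = ε. -/
lemma le_of_forall_lt_fst {P₂ : Set (Fin 3 → ℝ)}
    (H : ConditioningProblem3 ε (polytope canonical M₁) P₂) (h0 : 0 ≤ ε)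
    (h1 : ε < 1 / 2) {a : ℝ} (ha : ∀ x ∈ polytope canonical M₁, a < x 0) : a ≤ ε := by
  have hs : 0 < 2 * (1 - ε) := by linarith
  have ho := isOpen_polytope canonical M₁
  by_contra! hlt
  obtain ⟨y, hy, hya⟩ := (H.loc₁ ![0, 0, 0, 1, 0, 1]).2 (by simp)
  obtain ⟨z, hz, hza⟩ := (H.loc₁ ![1, 0, 0, 1, 0, 1]).2 (by simp)
  rw [mem_atom_vec] at hya hza
  push_cast at hya hza
  have hy' : y 0 < 1 / 2 := by linarith [hya.2.1.2]
  have hz' : 1 / 2 < z 0 := by linarith [hza.2.1.1]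
  have hc : 1 / 2 < (a - 2 * ε + 1) / (2 * (1 - ε)) := by
    rw [lt_div_iff₀ hs]
    linarith
  obtain ⟨c, hc1, hc2⟩ := exists_between (lt_min hc hz')
  obtain ⟨w, hw, e⟩ := exists_mem_fst_eq (convex_polytope canonical M₁) hy hz (c := c)
    (by linarith) (hc2.trans_le (min_le_right _ _))
  have hw2 := ha _ (H.map_100101 ho h0 h1 hw (by rw [e]; exact hc1))
  simp only [Matrix.cons_val] at hw2
  have h3 := hc2.trans_le (min_le_left _ _)
  rw [← e, lt_div_iff₀ hs] at h3
  linarith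

/-- The second polytope of a solution, in terms of its tight bounds. -/
lemma exists_eq_m₂ (H : ConditioningProblem3 ε (polytope canonical M₁) (polytope canonical M₂))
    (h0 : 0 ≤ ε) (h1 : ε < 1 / 2) :
    ∃ δ : Fin 5 → ℝ, polytope canonical M₂ = polytope canonical (m₂ ε δ) ∧
      Tight (pstar ε) (δ 0) (δ 1) (δ 2) (δ 3) (δ 4) := by
  have hsymm : ∀ x ∈ polytope canonical M₂, ![1 - x 2, 1 - x 1, 1 - x 0] ∈ polytope canonical M₂ :=
    fun x hx => H.symm_mem₂ hx
  have ho := isOpen_polytope canonical M₂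
  have hone := fun b => H.one_le_of_forall_fst_lt h0 h1 (b := b)
  have hne := H.polytope₂.1
  have hcube := H.subset₂
  clear H
  have hM := mem_polytope_canonical M₂
  generalize polytope canonical M₂ = P at *
  -- The symmetry exchanges x₁ with 1 - x₃ and x₁ + x₂ with 2 - (x₂ + x₃), and reflects x₂ and the
  -- total sum. Six extrema therefore give all twelve bounds, and the supremum of x₁ is 1.
  obtain ⟨a₁, ha₁, ha₁'⟩ := exists_strict_inf ho hne hcube (fun x => x 0)
    (fun x y h => h 0) (fun x hx => (hx 0).1.le)
  obtain ⟨b₁, hb₁, hb₁'⟩ := exists_strict_sup ho hne hcube (fun x => x 0)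
    (fun x y h => h 0) (fun x hx => (hx 0).2.le)
  obtain ⟨a₂, ha₂, ha₂'⟩ := exists_strict_inf ho hne hcube (fun x => x 1)
    (fun x y h => h 1) (fun x hx => (hx 1).1.le)
  obtain ⟨a₄, ha₄, ha₄'⟩ := exists_strict_inf ho hne hcube (fun x => x 0 + x 1)
    (fun x y h => add_lt_add (h 0) (h 1)) (fun x hx => by linarith [(hx 0).1, (hx 1).1])
  obtain ⟨b₄, hb₄, hb₄'⟩ := exists_strict_sup ho hne hcube (fun x => x 0 + x 1)
    (fun x y h => add_lt_add (h 0) (h 1)) (C := 2) (fun x hx => by linarith [(hx 0).2, (hx 1).2])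
  obtain ⟨a₆, ha₆, ha₆'⟩ := exists_strict_inf ho hne hcube (fun x => x 0 + x 1 + x 2)
    (fun x y h => add_lt_add (add_lt_add (h 0) (h 1)) (h 2))
    (fun x hx => by linarith [(hx 0).1, (hx 1).1, (hx 2).1])
  obtain rfl : b₁ = 1 := le_antisymm (hb₁' 1 fun x hx => (hcube hx 0).2.le) (hone _ hb₁)
  have hb : ∀ x ∈ P, Slabs a₁ 1 a₂ (1 - a₂) 0 (1 - a₁) a₄ b₄ (2 - b₄) (2 - a₄) a₆ (3 - a₆)
      (x 0) (x 1) (x 2) := by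
    intro x hx
    have c1 := ha₁ x hx
    have c2 := ha₂ x hx
    have c3 := ha₄ x hx
    have c4 := hb₄ x hx
    have c5 := ha₆ x hx
    have c6 := hb₁ x hx
    have d1 := ha₁ _ (hsymm x hx)
    have d2 := ha₂ _ (hsymm x hx)
    have d3 := ha₄ _ (hsymm x hx)
    have d4 := hb₄ _ (hsymm x hx)
    have d5 := ha₆ _ (hsymm x hx)
    have d6 := hb₁ _ (hsymm x hx)
    simp only [Matrix.cons_val] at c1 c2 c3 c4 c5 c6 d1 d2 d3 d4 d5 d6
    refine ⟨⟨?_, ?_⟩, ⟨?_, ?_⟩, ⟨?_, ?_⟩, ⟨?_, ?_⟩, ⟨?_, ?_⟩, ?_, ?_⟩ <;> linarith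
  have hmem : ∀ x, x ∈ P ↔ Slabs a₁ 1 a₂ (1 - a₂) 0 (1 - a₁) a₄ b₄ (2 - b₄) (2 - a₄) a₆ (3 - a₆)
      (x 0) (x 1) (x 2) := by
    refine fun x => ⟨hb x, fun hx => ?_⟩
    -- Given bounds cannot be better than the optimal ones, which recovers P from its extrema;
    -- applying them to reflected points treats the opposite faces.
    have hM' := fun y hy => (hM ![1 - y 2, 1 - y 1, 1 - y 0]).1 (hsymm y hy)
    simp only [Matrix.cons_val] at hM'
    have c1 := ha₁' (M₂ 0 0) fun y hy => ((hM y).1 hy).1.1.le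
    have c1' := hb₁' (M₂ 0 1) fun y hy => ((hM y).1 hy).1.2.le
    have c2 := ha₂' (M₂ 1 0) fun y hy => ((hM y).1 hy).2.1.1.le
    have c2' := ha₂' (1 - M₂ 1 1) fun y hy => by linarith [(hM' y hy).2.1.2]
    have c3 := hb₁' (1 - M₂ 2 0) fun y hy => by linarith [(hM' y hy).2.2.1.1]
    have c3' := ha₁' (1 - M₂ 2 1) fun y hy => by linarith [(hM' y hy).2.2.1.2]
    have c4 := ha₄' (M₂ 3 0) fun y hy => ((hM y).1 hy).2.2.2.1.1.le
    have c4' := hb₄' (M₂ 3 1) fun y hy => ((hM y).1 hy).2.2.2.1.2.le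
    have c5 := hb₄' (2 - M₂ 4 0) fun y hy => by linarith [(hM' y hy).2.2.2.2.1.1]
    have c5' := ha₄' (2 - M₂ 4 1) fun y hy => by linarith [(hM' y hy).2.2.2.2.1.2]
    have c6 := ha₆' (M₂ 5 0) fun y hy => ((hM y).1 hy).2.2.2.2.2.1.le
    have c6' := ha₆' (3 - M₂ 5 1) fun y hy => by linarith [(hM' y hy).2.2.2.2.2.2]
    obtain ⟨x1, x2, x3, x4, x5, x6⟩ := hx
    rw [hM]
    refine ⟨⟨?_, ?_⟩, ⟨?_, ?_⟩, ⟨?_, ?_⟩, ⟨?_, ?_⟩, ⟨?_, ?_⟩, ?_, ?_⟩ <;> linarith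
  -- Optimality against bounds obtained by adding two constraints: these are the inequalities of
  -- `Tight`.
  have e1 := ha₁' (a₄ + a₂ - 1) fun x hx => by
    obtain ⟨x1, x2, x3, x4, x5, x6⟩ := hb x hx
    linarith
  have e2 := ha₁' (a₆ + a₄ - 2) fun x hx => by
    obtain ⟨x1, x2, x3, x4, x5, x6⟩ := hb x hx
    linarith
  have e3 := ha₂' (a₄ - 1) fun x hx => by
    obtain ⟨x1, x2, x3, x4, x5, x6⟩ := hb x hx
    linarith
  have e4 := ha₆' a₄ fun x hx => by
    obtain ⟨x1, x2, x3, x4, x5, x6⟩ := hb x hx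
    linarith
  have e5 := hb₄' (2 - a₂) fun x hx => by
    obtain ⟨x1, x2, x3, x4, x5, x6⟩ := hb x hx
    linarith
  have e6 := hb₄' (3 - a₆) fun x hx => by
    obtain ⟨x1, x2, x3, x4, x5, x6⟩ := hb x hx
    linarith
  have e7 := ha₂' (a₁ + 1 - b₄) fun x hx => by
    obtain ⟨x1, x2, x3, x4, x5, x6⟩ := hb x hx
    linarith
  have e8 := ha₆' (a₁ + 2 - b₄) fun x hx => by
    obtain ⟨x1, x2, x3, x4, x5, x6⟩ := hb x hx
    linarith
  have e9 := ha₄' (a₁ + a₂) fun x hx => by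
    obtain ⟨x1, x2, x3, x4, x5, x6⟩ := hb x hx
    linarith
  have e10 := ha₄' (a₆ + a₁ - 1) fun x hx => by
    obtain ⟨x1, x2, x3, x4, x5, x6⟩ := hb x hx
    linarith
  have e11 := hb₁' (b₄ - a₂) fun x hx => by
    obtain ⟨x1, x2, x3, x4, x5, x6⟩ := hb x hx
    linarith
  refine ⟨![a₁ - 2 * pstar ε, a₂ - pstar ε, a₄ - 1 - pstar ε, a₆ - 1 - pstar ε,
    2 - pstar ε - b₄], ?_, ?_⟩
  · ext x
    rw [hmem, mem_polytope_m₂]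
    simp only [Matrix.cons_val, Slabs]
    ring_nf
  · simp only [Matrix.cons_val]
    constructor <;> linarith

/-- The affine image of P₂ ∩ A₁₁₀₁₁₁. The levels ε/2 and 1 - ε/2 are images of walls, and 1 - ε is
the image of x₁ = 1. The upper bound of x₃ is still the image of that of P₂ and differs from the one
in `m₁`. -/
lemma mem₁_iff_slabs {P₁ : Set (Fin 3 → ℝ)} {δ : Fin 5 → ℝ}
    (H : ConditioningProblem3 ε P₁ (polytope canonical (m₂ ε δ)))
    (h0 : 0 ≤ ε) (h1 : ε < 1 / 2) (y : Fin 3 → ℝ) :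
    y ∈ P₁ ↔ Slabs (1 - 2 * pstar ε + 2 * (1 - ε) * δ 0) (1 - ε) (ε / 2)
      (pstar ε - 2 * (1 - ε) * δ 1) 0 (2 * pstar ε - ε - 2 * (1 - ε) * δ 0)
      (1 - pstar ε + 2 * (1 - ε) * δ 2) (1 - ε / 2) (ε / 2) (pstar ε - 2 * (1 - ε) * δ 2)
      (1 - pstar ε + 2 * (1 - ε) * δ 3) (1 - ε / 2) (y 0) (y 1) (y 2) := by
  have hs : 0 < 2 * (1 - ε) := by linarith
  have hp := pstar_mul h1
  obtain ⟨q, hq, hqa⟩ := (H.loc₂ ![1, 1, 0, 1, 1, 1]).2 (by simp)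
  obtain ⟨r, hr, hra⟩ := (H.loc₂ ![1, 1, 0, 2, 1, 2]).2 (by simp)
  obtain ⟨v, hv, hva⟩ := (H.loc₂ ![1, 0, 0, 1, 0, 1]).2 (by simp)
  rw [mem_polytope_m₂] at hq hr hv
  rw [mem_atom_vec] at hqa hra hva
  push_cast at hqa hra hva
  -- Sample points of P₂ in suitable atoms show that each of the four walls supersedes the parallel
  -- face of P₂ in this cell.
  have f1 : pstar ε + δ 1 < 1 / 2 := by linarith [hq.2.1.2, hqa.2.2.1.1]
  have f2 : 3 / 2 < 2 - pstar ε - δ 4 := by linarith [hr.2.2.2.1.2, hra.2.2.2.2.1.1]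
  have f3 : pstar ε + δ 4 < 1 / 2 := by linarith [hv.2.2.2.2.1.1, hva.2.2.2.2.2.1.2]
  have f4 : 3 / 2 < 2 - pstar ε - δ 3 := by
    linarith [hr.2.2.2.2.2.2, hra.2.2.2.2.2.2.1]
  clear hq hr hv hqa hra hva
  obtain ⟨x₁, hx₁⟩ := exists_eq_mul_add hs (y 0) (ε - 1)
  obtain ⟨x₂, hx₂⟩ := exists_eq_mul_add hs (y 1) (3 * ε / 2 - 1)
  obtain ⟨x₃, hx₃⟩ := exists_eq_mul_add hs (y 2) 0
  have hy : ![2 * (1 - ε) * x₁ + ε - 1, 2 * (1 - ε) * x₂ + 3 * ε / 2 - 1, 2 * (1 - ε) * x₃] = y :=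
    vec3_eq (by linarith) (by linarith) (by linarith)
  have key := H.mem₁_iff (isOpen_polytope _ _) h0 h1 ![x₁, x₂, x₃]
  simp only [Matrix.cons_val] at key
  rw [hy, mem_polytope_m₂] at key
  simp only [Matrix.cons_val] at key
  rw [key, hx₁, hx₂, hx₃]
  clear key hy hx₁ hx₂ hx₃
  constructor
  · rintro ⟨⟨⟨a1, a1'⟩, ⟨a2, a2'⟩, ⟨a3, a3'⟩, ⟨a4, a4'⟩, ⟨a5, a5'⟩, ⟨a6, a6'⟩⟩, b2, b4, b5, b6⟩
    replace b2 := mul_lt_mul_of_pos_left b2 hs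
    replace b4 := mul_lt_mul_of_pos_left b4 hs
    replace b5 := mul_lt_mul_of_pos_left b5 hs
    replace b6 := mul_lt_mul_of_pos_left b6 hs
    replace a1 := mul_lt_mul_of_pos_left a1 hs
    replace a1' := mul_lt_mul_of_pos_left a1' hs
    replace a2' := mul_lt_mul_of_pos_left a2' hs
    replace a3 := mul_pos hs a3
    replace a3' := mul_lt_mul_of_pos_left a3' hs
    replace a4 := mul_lt_mul_of_pos_left a4 hs
    replace a5' := mul_lt_mul_of_pos_left a5' hs
    replace a6 := mul_lt_mul_of_pos_left a6 hs
    refine ⟨⟨?_, ?_⟩, ⟨?_, ?_⟩, ⟨?_, ?_⟩, ⟨?_, ?_⟩, ⟨?_, ?_⟩, ?_, ?_⟩ <;> linarith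
  · rintro ⟨⟨a1, a1'⟩, ⟨a2, a2'⟩, ⟨a3, a3'⟩, ⟨a4, a4'⟩, ⟨a5, a5'⟩, ⟨a6, a6'⟩⟩
    have c1 : 2 * pstar ε + δ 0 < x₁ := lt_of_mul_lt_mul_left (by linarith) hs.le
    have c1' : x₁ < 1 := lt_of_mul_lt_mul_left (by linarith) hs.le
    have c2 : 1 / 2 < x₂ := lt_of_mul_lt_mul_left (by linarith) hs.le
    have c2' : x₂ < 1 - pstar ε - δ 1 := lt_of_mul_lt_mul_left (by linarith) hs.le
    have c3 : 0 < x₃ := lt_of_mul_lt_mul_left (by linarith) hs.le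
    have c3' : x₃ < 1 - 2 * pstar ε - δ 0 := lt_of_mul_lt_mul_left (by linarith) hs.le
    have c4 : 1 + pstar ε + δ 2 < x₁ + x₂ := lt_of_mul_lt_mul_left (by linarith) hs.le
    have c4' : x₁ + x₂ < 3 / 2 := lt_of_mul_lt_mul_left (by linarith) hs.le
    have c5 : 1 / 2 < x₂ + x₃ := lt_of_mul_lt_mul_left (by linarith) hs.le
    have c5' : x₂ + x₃ < 1 - pstar ε - δ 2 := lt_of_mul_lt_mul_left (by linarith) hs.le
    have c6 : 1 + pstar ε + δ 3 < x₁ + x₂ + x₃ := lt_of_mul_lt_mul_left (by linarith) hs.le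
    have c6' : x₁ + x₂ + x₃ < 3 / 2 := lt_of_mul_lt_mul_left (by linarith) hs.le
    refine ⟨⟨⟨?_, ?_⟩, ⟨?_, ?_⟩, ⟨?_, ?_⟩, ⟨?_, ?_⟩, ⟨?_, ?_⟩, ?_, ?_⟩, ?_, ?_, ?_, ?_⟩ <;> linarith

/-- `σ4231` turns the lower bound of x₁ in P₁ into an upper bound of x₂ + x₃ on the 110112 cell,
since the preimage of the image point has first coordinate 2(1 - ε)(1 - x₂ - x₃). -/
lemma two_mul_sub_le {δ : Fin 5 → ℝ}
    (H : ConditioningProblem3 ε (polytope canonical M₁) (polytope canonical (m₂ ε δ)))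
    (h0 : 0 ≤ ε) (h1 : ε < 1 / 2) (T : Tight (pstar ε) (δ 0) (δ 1) (δ 2) (δ 3) (δ 4)) :
    2 * (1 - ε) * (δ 0 - δ 2) ≤ pstar ε - ε / 2 := by
  have hp := pstar_mul h1
  have ho₂ := isOpen_polytope canonical (m₂ ε δ)
  have h₁ := H.mem₁_iff_slabs h0 h1
  have h₂ := mem_polytope_m₂ ε δ
  obtain ⟨v, hv, hva⟩ := (H.loc₂ ![1, 0, 0, 1, 0, 1]).2 (by simp)
  obtain ⟨r, hr, hra⟩ := (H.loc₂ ![1, 1, 0, 1, 1, 2]).2 (by simp)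
  rw [mem_atom_vec] at hva hra
  push_cast at hva hra
  rw [h₂] at hv hr
  refine T.sub_le h1 hp ⟨r 0, r 1, r 2, ?_⟩ fun x₁ x₂ x₃ hx => ?_
  · obtain ⟨a1, a2, a3, a4, a5, a6⟩ := hr
    obtain ⟨-, b1, b2, b3, b4, b5, b6⟩ := hra
    refine ⟨⟨?_, ?_⟩, ⟨?_, ?_⟩, ⟨?_, ?_⟩, ⟨?_, ?_⟩, ⟨?_, ?_⟩, ?_, ?_⟩ <;> linarith
  · obtain ⟨a1, a2, a3, a4, a5, a6⟩ := hx
    have hx2 : ![x₁, x₂, x₃] ∈ polytope canonical (m₂ ε δ) := by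
      have t1 := T.le₂₅
      have t2 := T.le₄₅
      rw [h₂]
      simp only [Matrix.cons_val]
      refine ⟨⟨?_, ?_⟩, ⟨?_, ?_⟩, ⟨?_, ?_⟩, ⟨?_, ?_⟩, ⟨?_, ?_⟩, ?_, ?_⟩ <;> linarith
    obtain ⟨u, hu, e⟩ := H.map_110112 ho₂ h0 h1 hx2 a2.1 a4.2 a6.1
    have hcu := H.subset₁ hu
    have hbu := H.bounds₁ (isOpen_polytope canonical M₁) hu
    rw [h₁] at hu
    obtain ⟨g1, g2, g3, g4, g5, g6⟩ := hu
    rw [mem_cube] at hcu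
    rw [σ4231_eq 0 (by linarith) (by linarith) (by linarith) (by linarith)
      (by push_cast; linarith) (by push_cast; linarith)] at e
    have e1 := congrFun e 1
    have e2 := congrFun e 2
    simp only [Matrix.cons_val] at e1 e2
    push_cast at e2
    linarith

theorem exists_mem_Δ (H : ConditioningProblem3 ε (polytope canonical M₁) (polytope canonical M₂))
    (h0 : 0 ≤ ε) (h1 : ε < 1 / 2) :
    ∃ δ ∈ Δ ε, polytope canonical M₁ = polytope canonical (m₁ ε δ) ∧
      polytope canonical M₂ = polytope canonical (m₂ ε δ) := by
  obtain ⟨δ, hδ, T⟩ := H.exists_eq_m₂ h0 h1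
  rw [hδ] at H
  have hs : 0 < 2 * (1 - ε) := by linarith
  have hp := pstar_mul h1
  have ho₁ := isOpen_polytope canonical M₁
  have ho₂ := isOpen_polytope canonical (m₂ ε δ)
  have h₁ := H.mem₁_iff_slabs h0 h1
  have h₂ := mem_polytope_m₂ ε δ
  obtain ⟨v, hv, hva⟩ := (H.loc₂ ![1, 0, 0, 1, 0, 1]).2 (by simp)
  obtain ⟨w, hw, hwa⟩ := (H.loc₂ ![1, 1, 0, 2, 1, 2]).2 (by simp)
  obtain ⟨y, hy, hya⟩ := (H.loc₁ ![0, 0, 0, 1, 0, 1]).2 (by simp)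
  obtain ⟨z, hz, hza⟩ := (H.loc₁ ![1, 0, 0, 1, 0, 1]).2 (by simp)
  rw [mem_atom_vec] at hva hwa hya hza
  push_cast at hva hwa hya hza
  rw [h₂] at hv hw
  rw [h₁] at hy hz
  have f3 : pstar ε + δ 4 < 1 / 2 := by linarith [hv.2.2.2.2.1.1, hva.2.2.2.2.2.1.2]
  have h13 := H.two_mul_sub_le h0 h1 T
  have hadm : Admissible ε (pstar ε) (δ 0) (δ 1) (δ 2) (δ 3) (δ 4) := by
    refine T.admissible h0 h1 hp f3.le ?_ h13 ⟨y 0, y 1, y 2, ?_⟩ ?_ ⟨z 0, z 1, z 2, ?_⟩ ?_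
      ⟨w 0, w 1, w 2, ?_⟩ ?_
    · have := H.le_of_forall_lt_fst h0 h1 (a := 1 - 2 * pstar ε + 2 * (1 - ε) * δ 0)
        fun x hx => ((h₁ x).1 hx).1.1
      linarith
    · exact ⟨⟨hy.1.1, by linarith [hya.2.1.2]⟩, hy.2⟩
    · intro x₁ x₂ x₃ hx
      have hm : ![x₁, x₂, x₃] ∈ polytope canonical M₁ :=
        (h₁ _).2 ⟨⟨hx.1.1, hx.1.2.trans (by linarith)⟩, hx.2⟩
      exact (h₂ _).1 (H.map_000101 ho₁ h0 h1 hm hx.1.2)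
    · exact ⟨⟨by linarith [hza.2.1.1], hz.1.2⟩, hz.2⟩
    · intro x₁ x₂ x₃ hx
      have hL := H.le_of_forall_lt_fst h0 h1 (a := 1 - 2 * pstar ε + 2 * (1 - ε) * δ 0)
        fun x hx => ((h₁ x).1 hx).1.1
      have hm : ![x₁, x₂, x₃] ∈ polytope canonical M₁ :=
        (h₁ _).2 ⟨⟨lt_of_le_of_lt (by linarith) hx.1.1, hx.1.2⟩, hx.2⟩
      exact (h₁ _).1 (H.map_100101 ho₁ h0 h1 hm hx.1.1)
    · exact ⟨hw.1, hw.2.1, hw.2.2.1, ⟨by linarith [hwa.2.2.2.2.1.1], hw.2.2.2.1.2⟩,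
        hw.2.2.2.2.1, hw.2.2.2.2.2⟩
    · intro x₁ x₂ x₃ hx
      obtain ⟨a1, a2, a3, a4, a5, a6⟩ := hx
      have hm : ![x₁, x₂, x₃] ∈ polytope canonical (m₂ ε δ) := by
        have t1 := T.le₃₄
        have t2 := T.le₄₅
        exact (h₂ _).2 ⟨a1, a2, a3, ⟨lt_trans (by linarith) a4.1, a4.2⟩, a5, a6⟩
      exact (h₂ _).1 (H.map_110212 ho₂ h0 h1 hm a4.1)
  refine ⟨δ, (mem_Δ_iff h1 δ).2 hadm, ?_, hδ⟩
  ext x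
  rw [h₁, mem_polytope_m₁]
  -- Only the upper bounds of x₃ differ. The one in `m₁` follows from x₃ = (x₂ + x₃) - x₂, and by
  -- `h13` it is at least as strong as the other.
  constructor <;> rintro ⟨a1, a2, a3, a4, a5, a6⟩
  · exact ⟨a1, a2, ⟨a3.1, by linarith⟩, a4, a5, a6⟩
  · exact ⟨a1, a2, ⟨a3.1, by linarith⟩, a4, a5, a6⟩

end ConditioningProblem3

/-! ### The cubic and the threshold -/

section Threshold

lemma exists_root : ∃ r : ℝ, (∀ t : ℝ, 4 * t ^ 3 - 14 * t ^ 2 + 15 * t - 4 = 0 ↔ t = r) ∧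
    0 < r ∧ r < 1 / 2 ∧
    ∀ t : ℝ, t < 1 / 2 → (r ≤ t ↔ 0 ≤ 4 * t ^ 3 - 14 * t ^ 2 + 15 * t - 4) := by
  have hc : ContinuousOn (fun t : ℝ => 4 * t ^ 3 - 14 * t ^ 2 + 15 * t - 4) (Set.Icc 0 (1 / 2)) := by
    fun_prop
  obtain ⟨r, ⟨r0, r1⟩, hr⟩ := intermediate_value_Ioo (by norm_num) hc
    (show (0 : ℝ) ∈ Set.Ioo _ _ by norm_num)
  simp only at hr
  have hpos : ∀ t : ℝ, 1 / 2 ≤ t → 0 < 4 * t ^ 3 - 14 * t ^ 2 + 15 * t - 4 := by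
    intro t ht
    -- This form shows positivity for t ≥ 1/2, so only the increasing branch t < 1/2 can carry a
    -- root.
    have : 4 * t ^ 3 - 14 * t ^ 2 + 15 * t - 4 = (t - 1 / 2) * (2 * t - 3) ^ 2 + 1 / 2 := by ring
    nlinarith [mul_nonneg (sub_nonneg.2 ht) (sq_nonneg (2 * t - 3))]
  have hmono : ∀ a b : ℝ, a < b → b < 1 / 2 →
      4 * a ^ 3 - 14 * a ^ 2 + 15 * a - 4 < 4 * b ^ 3 - 14 * b ^ 2 + 15 * b - 4 := by
    intro a b hab hb
    have : 0 < (b - a) * (4 * (b ^ 2 + a * b + a ^ 2) - 14 * (a + b) + 15) :=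
      mul_pos (by linarith) (by
        have hm := mul_pos (sub_pos.2 hb) (sub_pos.2 (hab.trans hb))
        nlinarith [sq_nonneg (1 / 2 - a), sq_nonneg (1 / 2 - b)])
    nlinarith
  refine ⟨r, fun t => ⟨fun h => ?_, fun h => h ▸ hr⟩, r0, r1, fun t ht => ⟨fun h => ?_, fun h => ?_⟩⟩
  · by_contra hne
    rcases le_or_gt (1 / 2) t with h2 | h2
    · linarith [hpos t h2]
    · rcases lt_or_gt_of_ne hne with h3 | h3
      · linarith [hmono t r h3 r1]
      · linarith [hmono r t h3 h2]
  · rcases h.eq_or_lt with rfl | h3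
    · exact hr.ge
    · linarith [hmono r t h3 ht]
  · by_contra! h3
    linarith [hmono t r h3 r1]

lemma sq_le_pstar_iff {ε : ℝ} (h1 : ε < 1 / 2) :
    (1 - ε) ^ 2 ≤ pstar ε ↔ 0 ≤ 4 * ε ^ 3 - 14 * ε ^ 2 + 15 * ε - 4 := by
  rw [pstar, le_div_iff₀ (by linarith)]
  constructor <;> intro h <;> linarith

lemma nonempty_Δ_iff {ε : ℝ} (h0 : 0 ≤ ε) (h1 : ε < 1 / 2) :
    (Δ ε).Nonempty ↔ (1 - ε) ^ 2 ≤ pstar ε := by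
  have hs : 0 < 2 * (1 - ε) := by linarith
  constructor
  · rintro ⟨δ, hδ⟩
    have H := (mem_Δ_iff h1 δ).1 hδ
    linarith [H.le₂, mul_nonneg hs.le (H.nonneg₃.trans H.le₃₂)]
  · intro h
    obtain ⟨p1, p2⟩ := pstar_bounds h0 h1
    have hp := pstar_mul h1
    have hε : 3 / 8 < ε := by nlinarith
    -- At δ = 0 the second alternative of `or₃` is an equality, since 2(1 - ε)(2p* - 1/2) = 1 - 2p*.
    refine ⟨0, (mem_Δ_iff h1 0).2 ?_⟩
    constructor <;> simp only [Pi.zero_apply]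
    all_goals first | (right; nlinarith) | nlinarith

end Threshold

end CoupledMap

theorem mainTheorem2 :
    ∃ ε₃ : ℝ, (∀ t : ℝ, 4 * t ^ 3 - 14 * t ^ 2 + 15 * t - 4 = 0 ↔ t = ε₃) ∧
      0 < ε₃ ∧ ε₃ < 1 / 2 ∧
      ∀ ε : ℝ, 0 ≤ ε → ε < 1 / 2 →
        ((∃ m₁ m₂ : Matrix (Fin 6) (Fin 2) ℝ,
            CoupledMap.ConditioningProblem3 ε
              (CoupledMap.polytope CoupledMap.canonical m₁)
              (CoupledMap.polytope CoupledMap.canonical m₂)) ↔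
          ε ∈ Set.Ico ε₃ (1 / 2)) ∧
        (∀ m₁ m₂ : Matrix (Fin 6) (Fin 2) ℝ,
          CoupledMap.ConditioningProblem3 ε
              (CoupledMap.polytope CoupledMap.canonical m₁)
              (CoupledMap.polytope CoupledMap.canonical m₂) ↔
            ∃ δ ∈ CoupledMap.Δ ε,
              CoupledMap.polytope CoupledMap.canonical m₁ =
                CoupledMap.polytope CoupledMap.canonical (CoupledMap.m₁ ε δ) ∧
              CoupledMap.polytope CoupledMap.canonical m₂ =
                CoupledMap.polytope CoupledMap.canonical (CoupledMap.m₂ ε δ)) ∧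
        (∀ δ ∈ CoupledMap.Δ ε,
          CoupledMap.IsAsIUP ε
            (CoupledMap.orb
              (CoupledMap.polytope CoupledMap.canonical (CoupledMap.m₁ ε δ))
              (CoupledMap.polytope CoupledMap.canonical (CoupledMap.m₂ ε δ)))) := by
  obtain ⟨r, hr, r0, r1, hsign⟩ := CoupledMap.exists_root
  refine ⟨r, hr, r0, r1, fun ε h0 h1 => ?_⟩
  have hiff : r ≤ ε ↔ (CoupledMap.Δ ε).Nonempty := by
    rw [CoupledMap.nonempty_Δ_iff h0 h1, CoupledMap.sq_le_pstar_iff h1, hsign ε h1]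
  refine ⟨⟨?_, ?_⟩, fun m₁ m₂ => ⟨fun H => H.exists_mem_Δ h0 h1, ?_⟩, fun δ hδ =>
    CoupledMap.isAsIUP_orb h0 h1 hδ⟩
  · rintro ⟨m₁, m₂, H⟩
    obtain ⟨δ, hδ, -⟩ := H.exists_mem_Δ h0 h1
    exact ⟨hiff.2 ⟨δ, hδ⟩, h1⟩
  · rintro ⟨h, -⟩
    obtain ⟨δ, hδ⟩ := hiff.1 h
    exact ⟨_, _, CoupledMap.conditioningProblem3_of_mem_Δ h0 h1 hδ⟩
  · rintro ⟨δ, hδ, e₁, e₂⟩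
    rw [e₁, e₂]
    exact CoupledMap.conditioningProblem3_of_mem_Δ h0 h1 hδ
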